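/- Let $\mathfrak g$ be a finite dimensional complex Lie algebra with a symmetric invariant bilinear form $\kappa$. Let $S$ range over quasi-compact quasi-separated $\mathbb C$-schemes, $p:X\to S$ over smooth separated families of curves, and $\Sigma=\Sigma_J=(\sigma_j)_{j\in J}$ over finite families of sections of $p$. Let $\mathcal O_{\overline\Sigma}$ and $\mathcal O_{\overline\Sigma^*}$ be the sheaves on $S$ of functions on the formal neighbourhood and on the punctured formal neighbourhood of $\Sigma$. Let $\hat{\mathfrak g}_{\Sigma}=\mathfrak g\otimes_{\mathbb C}\mathcal O_{\overline\Sigma^*}\oplus\mathcal O_S\mathbf 1$, with $\mathbf 1$ central and $$[X\otimes f,Y\otimes g]=[X,Y]\otimes fg+\kappa(X,Y)\,\mathrm{Res}_\Sigma(g\,df)\,\mathbf 1 .$$ Let $\mathcal U^1$ be the quotient of the enveloping algebra of $\hat{\mathfrak g}_\Sigma$ by the ideal generated by $1-\mathbf 1$, and let $$\mathcal U_\kappa(\hat{\mathfrak g}_\Sigma)=\varprojlim_n \mathcal U^1/\mathcal U^1\cdot(\mathfrak g\otimes\mathcal O_{\overline\Sigma}(-n\Sigma)).$$ Let $Z_\kappa(\hat{\mathfrak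 g}_\Sigma)\subset\mathcal U_\kappa(\hat{\mathfrak g}_\Sigma)$ be its sheaf-theoretic center with the subspace topology: its sections over $U$ are the sections over $U$ whose bracket with every section over every open subset of $U$ vanishes. For a surjection of finite sets $J\twoheadrightarrow I$ with fibres $J_i$, let $i_{J/I}:V_{J/I}\to S$ be the closed subscheme where $\sigma_j=\sigma_{j'}$ for all $j,j'$ in the same fibre, with the induced family $\Sigma_I$ of $I$ sections over $V_{J/I}$. Let $j_{J/I}:U_{J/I}\to S$ be the open subscheme where $\sigma_j\ne\sigma_{j'}$ for all $j,j'$ in different fibres, and let $\Sigma_{J_i}=(\sigma_j)_{j\in J_i}$. A pseudo-factorization structure on a collection of sheaves of topological algebras $\mathcal A_\Sigma$, one for each $(S,X,\Sigma)$, that is natural under base change in $S$ consists of continuous morphisms of $\mathcal O$-algebras $$\mathrm{Ran}_{J/I}:\hat i_{J/I}^*\mathcal A_{\Sigma_J}\to\mathcal A_{\Sigma_I},\qquad \mathrm{fact}_{J/I}:\hat j_{J/I}^*\bigotimes^!_{i\in I}\mathcal A_{\Sigma_{J_i}}\to\hat j_{J/I}^*\mathcal A_{\Sigma_J},$$ compatible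 with base change, such that for $K\twoheadrightarrow J\twoheadrightarrow I$, with fibres $K_i$ and $J_i$ over $i\in I$, $$\mathrm{Ran}_{K/I}=\mathrm{Ran}_{J/I}\circ\hat i_{J/I}^*\mathrm{Ran}_{K/J},\qquad \mathrm{fact}_{K/J}=\hat j_{K/J}^*\mathrm{fact}_{K/I}\circ\hat j_{K/J}^*\bigotimes^!_{i}\mathrm{fact}_{K_i/J_i},$$ $$\hat j_{J/I}^*\mathrm{Ran}_{K/J}\circ\hat i_{K/J}^*\mathrm{fact}_{K/I}=\mathrm{fact}_{J/I}\circ\hat j_{J/I}^*\bigotimes^!_{i}\mathrm{Ran}_{K_i/J_i}.$$ Then the following hold. 1. The collection $\mathcal U_\kappa(\hat{\mathfrak g}_\Sigma)$ has exactly one pseudo-factorization structure, natural under base change, such that $\mathrm{Ran}$ and the base change morphisms send $X\otimes f$ to $X\otimes f'$, where $f'$ is the pullback of $f$, and such that $\mathrm{fact}_{J/I}$ sends the tensor product of $X\otimes f$ in the factor $i$ with the units of the other factors to $X\otimes\tilde f$, where $\tilde f$ is the extension by zero of $f$ from the punctured formal neighbourhood of $\Sigma_{J_i}$ to that of $\Sigma_J$.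 2. This structure induces, for all surjections $J\twoheadrightarrow I$, unique morphisms $$\mathrm{Ran}^Z_{J/I}:\hat i_{J/I}^*Z_\kappa(\hat{\mathfrak g}_{\Sigma_J})\to Z_\kappa(\hat{\mathfrak g}_{\Sigma_I}),\qquad \mathrm{fact}^Z_{J/I}:\hat j_{J/I}^*\bigotimes^!_{i\in I}Z_\kappa(\hat{\mathfrak g}_{\Sigma_{J_i}})\to\hat j_{J/I}^*Z_\kappa(\hat{\mathfrak g}_{\Sigma_J})$$ (and base change morphisms) that are compatible with the inclusions $Z_\kappa(\hat{\mathfrak g}_{\Sigma})\subset\mathcal U_\kappa(\hat{\mathfrak g}_{\Sigma})$, and they form a pseudo-factorization structure on the collection $Z_\kappa(\hat{\mathfrak g}_\Sigma)$. 3. Over all sufficiently small affine opens of $S$ (those over which the infinitesimal neighbourhoods of $\Sigma$ are affine and $\Sigma$ has a global equation; they form a basis of the topology), the sections of $Z_\kappa(\hat{\mathfrak g}_\Sigma)$ are separated and complete, with a basis of neighbourhoods of zero consisting of ideals. Thus $Z_\kappa(\hat{\mathfrak g}_\Sigma)$ is a complete topological pseudo-factorization algebra. -/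

import Mathlib

open AlgebraicGeometry CategoryTheory TensorProduct TopologicalSpace

noncomputable section

/-!
Sheaves on `S` are handled through their sections over a basis of affine opens of `S`, the charts.
A morphism `f^* 𝒜 → ℬ` out of a (completed) pullback along `f : T ⟶ S` is handled, by adjunction,
as a compatible family of continuous ring homomorphisms `𝒜(W) → ℬ(W')`, for charts `W' ≤ f⁻¹ W`,
that are semilinear over `𝒪(W) → 𝒪(W')`. A continuous morphism out of a completed tensor product
into a complete algebra is given by its restriction to the tensor product before completion.
-/

namespace FactorizableCenter

theorem le_map_iff_appLE {X Y : Scheme.{0}} (f : X ⟶ Y) (I : Y.IdealSheafData)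
    (K : X.IdealSheafData) :
    I ≤ K.map f ↔ ∀ (U : Y.affineOpens) (V : X.affineOpens) (e : V.1 ≤ f ⁻¹ᵁ U.1),
      I.ideal U ≤ (K.ideal V).comap (f.appLE U.1 V.1 e).hom := by
  unfold Scheme.IdealSheafData.map Scheme.Hom.ker
  rw [Scheme.IdealSheafData.le_ofIdeals_iff]
  constructor
  · intro h U V e a ha
    have h1 := h U ha
    rw [Ideal.mem_comap, ← K.ker_subschemeι_app V, RingHom.mem_ker]
    rw [RingHom.mem_ker, Scheme.Hom.comp_app] at h1
    rw [Scheme.Hom.appLE, ← CommRingCat.comp_apply]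
    rw [Category.assoc, K.subschemeι.naturality, ← Category.assoc, CommRingCat.comp_apply]
    exact (congrArg _ h1).trans (map_zero _)
  · intro h U a ha
    rw [RingHom.mem_ker]
    apply (K.subscheme.sheaf).eq_of_locally_eq' (fun V : {V : X.affineOpens // V.1 ≤ f ⁻¹ᵁ U.1} =>
      K.subschemeι ⁻¹ᵁ V.1.1) ((K.subschemeι ≫ f) ⁻¹ᵁ U.1) 
      (fun V => homOfLE (fun x hx => V.2 hx))
    · intro x hx
      obtain ⟨_, ⟨V, hV, rfl⟩, hxV, hVU⟩ := X.isBasis_affineOpens.exists_subset_of_mem_open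
        (show K.subschemeι x ∈ (f ⁻¹ᵁ U.1 : X.Opens) from hx) (f ⁻¹ᵁ U.1).2
      exact TopologicalSpace.Opens.mem_iSup.2 ⟨⟨⟨V, hV⟩, hVU⟩, hxV⟩
    · rintro ⟨V, hV⟩
      have h1 := h U V hV ha
      rw [Ideal.mem_comap, ← K.ker_subschemeι_app V, RingHom.mem_ker, Scheme.Hom.appLE,
        ← CommRingCat.comp_apply, Category.assoc, K.subschemeι.naturality] at h1
      exact h1.trans (map_zero (K.subscheme.presheaf.map _).hom).symm

theorem mul_le_map_mul {X Y : Scheme.{0}} (f : X ⟶ Y) {I J : Y.IdealSheafData}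
    {K L : X.IdealSheafData} (h1 : I ≤ K.map f) (h2 : J ≤ L.map f) :
    I * J ≤ (K * L).map f := by
  rw [le_map_iff_appLE] at *
  intro U V e
  refine Ideal.mul_le.2 fun a ha b hb => ?_
  rw [Ideal.mem_comap, map_mul]
  exact Ideal.mul_mem_mul (h1 U V e ha) (h2 U V e hb)

theorem pow_le_map_pow {X Y : Scheme.{0}} (f : X ⟶ Y) {I : Y.IdealSheafData}
    {K : X.IdealSheafData} (h : I ≤ K.map f) (n : ℕ) : I ^ n ≤ (K ^ n).map f := by
  induction n with
  | zero => simp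
  | succ n ih => rw [pow_succ, pow_succ]; exact mul_le_map_mul f ih h

theorem prod_le_map_prod {X Y : Scheme.{0}} (f : X ⟶ Y) {ι : Type} (s : Finset ι)
    {I : ι → Y.IdealSheafData} {K : ι → X.IdealSheafData} (h : ∀ i, I i ≤ (K i).map f) :
    ∏ i ∈ s, I i ≤ (∏ i ∈ s, K i).map f := by
  classical
  induction s using Finset.induction_on with
  | empty => simp
  | insert a s ha ih => 
    rw [Finset.prod_insert ha, Finset.prod_insert ha]; exact mul_le_map_mul f (h a) ih

theorem appLE_square {X Y Y' Z : Scheme.{0}} {g : X ⟶ Y} {h : Y ⟶ Z} {g' : X ⟶ Y'}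
    {h' : Y' ⟶ Z} (e : g ≫ h = g' ≫ h') {U : Z.Opens} {V : Y.Opens} {V' : Y'.Opens}
    {W : X.Opens} (e₁ : V ≤ h ⁻¹ᵁ U) (e₂ : W ≤ g ⁻¹ᵁ V) (e₁' : V' ≤ h' ⁻¹ᵁ U)
    (e₂' : W ≤ g' ⁻¹ᵁ V') (a : Γ(Z, U)) :
    (g.appLE V W e₂).hom ((h.appLE U V e₁).hom a) =
      (g'.appLE V' W e₂').hom ((h'.appLE U V' e₁').hom a) := by
  have : h.appLE U V e₁ ≫ g.appLE V W e₂ = h'.appLE U V' e₁' ≫ g'.appLE V' W e₂' := by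
    rw [Scheme.Hom.appLE_comp_appLE, Scheme.Hom.appLE_comp_appLE]
    simp only [e]
  exact congrArg (fun φ => φ.hom a) this

theorem appLE_eq_self {X : Scheme.{0}} {g : X ⟶ X} (e : g = 𝟙 X) {U : X.Opens}
    (h : U ≤ g ⁻¹ᵁ U) (a : Γ(X, U)) : (g.appLE U U h).hom a = a := by
  subst e
  have : (𝟙 X : X ⟶ X).appLE U U h = 𝟙 _ := by
    exact (Category.id_comp _).trans (X.presheaf.map_id _)
  rw [this]; rfl

theorem appLE_triangle {X Y Z : Scheme.{0}} {g : X ⟶ Y} {h : Y ⟶ Z} {k : X ⟶ Z}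
    (e : g ≫ h = k) {U : Z.Opens} {V : Y.Opens} {W : X.Opens} (e₁ : V ≤ h ⁻¹ᵁ U)
    (e₂ : W ≤ g ⁻¹ᵁ V) (e₃ : W ≤ k ⁻¹ᵁ U) (a : Γ(Z, U)) :
    (g.appLE V W e₂).hom ((h.appLE U V e₁).hom a) = (k.appLE U W e₃).hom a := by
  have : h.appLE U V e₁ ≫ g.appLE V W e₂ = k.appLE U W e₃ := by
    rw [Scheme.Hom.appLE_comp_appLE]
    simp only [e]
  exact congrArg (fun φ => φ.hom a) this

theorem le_preimage_of_comp_eq {X Y Z : Scheme.{0}} {g : X ⟶ Y} {h : Y ⟶ Z} {k : X ⟶ Z}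
    (e : g ≫ h = k) (W : Z.Opens) : k ⁻¹ᵁ W ≤ g ⁻¹ᵁ (h ⁻¹ᵁ W) := by
  subst e; exact le_rfl

/-- A smooth separated family of curves `p : X ⟶ S` over a quasi-compact quasi-separated complex
scheme `S`, with a finite family `Σ = (σ j)` of sections. -/
structure MarkedCurve : Type 1 where
  S : Scheme.{0}
  X : Scheme.{0}
  str : S ⟶ Spec (CommRingCat.of ℂ)
  p : X ⟶ S
  smooth : SmoothOfRelativeDimension 1 p
  separated : IsSeparated p
  compact : CompactSpace S
  quasiSeparated : QuasiSeparatedSpace S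
  J : Type
  fintype : Fintype J
  σ : J → (S ⟶ X)
  σ_p : ∀ j, σ j ≫ p = 𝟙 S

attribute [instance] MarkedCurve.smooth MarkedCurve.separated MarkedCurve.compact
  MarkedCurve.quasiSeparated MarkedCurve.fintype

namespace MarkedCurve

variable (M : MarkedCurve)

/-- The ideal of `Σ`: the product of the ideals of the sections. -/
def idealSheaf : M.X.IdealSheafData := ∏ j, (M.σ j).ker

/-- The closed subscheme of `X` defined by the `n`-th power of the ideal of `Σ`. -/
def thick (n : ℕ) : Scheme.{0} := (M.idealSheaf ^ n).subscheme

/-- The closed immersion of the `n`-th neighbourhood into `X`. -/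
def thickι (n : ℕ) : M.thick n ⟶ M.X := (M.idealSheaf ^ n).subschemeι

instance (n : ℕ) : IsClosedImmersion (M.thickι n) :=
  inferInstanceAs (IsClosedImmersion (M.idealSheaf ^ n).subschemeι)

theorem ker_thickι (n : ℕ) : (M.thickι n).ker = M.idealSheaf ^ n :=
  (M.idealSheaf ^ n).ker_subschemeι

/-- The projection of the `n`-th neighbourhood to `S`. -/
def thickProj (n : ℕ) : M.thick n ⟶ M.S := M.thickι n ≫ M.p

theorem idealSheaf_pow_succ_le (n : ℕ) : M.idealSheaf ^ (n + 1) ≤ M.idealSheaf ^ n := by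
  intro U
  simp only [Scheme.IdealSheafData.ideal_pow, Pi.pow_apply]
  exact Ideal.pow_le_pow_right (Nat.le_succ n)

/-- The inclusion of successive neighbourhoods. -/
def thickTrans (n : ℕ) : M.thick n ⟶ M.thick (n + 1) :=
  Scheme.IdealSheafData.inclusion (M.idealSheaf_pow_succ_le n)

theorem thickTrans_ι (n : ℕ) : M.thickTrans n ≫ M.thickι (n + 1) = M.thickι n :=
  Scheme.IdealSheafData.inclusion_subschemeι _

theorem thickTrans_proj (n : ℕ) : M.thickTrans n ≫ M.thickProj (n + 1) = M.thickProj n := by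
  rw [thickProj, ← Category.assoc, thickTrans_ι, thickProj]

/-- The ring `𝒪_S(W)`. -/
abbrev A (W : M.S.Opens) : Type := Γ(M.S, W)

/-- The structure map `ℂ → 𝒪_S(W)`. -/
def scalars (W : M.S.Opens) : ℂ →+* M.A W :=
  (M.str.appLE ⊤ W le_top).hom.comp (Scheme.ΓSpecIso (CommRingCat.of ℂ)).inv.hom

instance (W : M.S.Opens) : Algebra ℂ (M.A W) :=
  RingHom.toAlgebra (M.scalars W)

/-- Functions on the `n`-th neighbourhood over `W`. -/
abbrev thickRing (n : ℕ) (W : M.S.Opens) : Type := Γ(M.thick n, M.thickProj n ⁻¹ᵁ W)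

/-- The structure map of the `n`-th neighbourhood. -/
def thickStr (n : ℕ) (W : M.S.Opens) : M.A W →+* M.thickRing n W := ((M.thickProj n).appLE W _ le_rfl).hom

/-- Restriction between successive neighbourhoods. -/
def thickRes (n : ℕ) (W : M.S.Opens) : M.thickRing (n + 1) W →+* M.thickRing n W :=
  ((M.thickTrans n).appLE (M.thickProj (n + 1) ⁻¹ᵁ W) (M.thickProj n ⁻¹ᵁ W)
    (le_preimage_of_comp_eq (M.thickTrans_proj n) W)).hom

/-- Compatible families of functions on the neighbourhoods of `Σ`. -/
def formalSubring (W : M.S.Opens) : Subring (∀ n, M.thickRing n W) where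
  carrier := {s | ∀ n, M.thickRes n W (s (n + 1)) = s n}
  mul_mem' ha hb n := by simp [ha n, hb n]
  one_mem' n := by simp
  add_mem' ha hb n := by simp [ha n, hb n]
  zero_mem' n := by simp
  neg_mem' ha n := by simp [ha n]

/-- The ring `𝒪_{Σ̄}(W)` of functions on the formal neighbourhood of `Σ`, the limit over `n` of
the functions on the `n`-th neighbourhoods. -/
abbrev R (W : M.S.Opens) : Type := M.formalSubring W

/-- The projection to the `n`-th neighbourhood. -/
def lev (n : ℕ) (W : M.S.Opens) : M.R W →+* M.thickRing n W :=
  (Pi.evalRingHom _ n).comp (M.formalSubring W).subtype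

/-- The ideal `𝒪_{Σ̄}(-nΣ)(W)`. -/
def van (n : ℕ) (W : M.S.Opens) : Ideal (M.R W) := RingHom.ker (M.lev n W)

theorem thickRes_str (n : ℕ) (W : M.S.Opens) (a : M.A W) :
    M.thickRes n W (M.thickStr (n + 1) W a) = M.thickStr n W a := by
  exact appLE_triangle (M.thickTrans_proj n) _ _ _ a

/-- The structure map `𝒪_S(W) → 𝒪_{Σ̄}(W)`. -/
def formalStr (W : M.S.Opens) : M.A W →+* M.R W :=
  RingHom.codRestrict (RingHom.pi fun n => M.thickStr n W) (M.formalSubring W)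
    fun a n => M.thickRes_str n W a

instance (W : M.S.Opens) : Algebra (M.A W) (M.R W) := (M.formalStr W).toAlgebra

instance (W : M.S.Opens) : Algebra ℂ (M.R W) :=
  ((M.formalStr W).comp (algebraMap ℂ (M.A W))).toAlgebra

instance (W : M.S.Opens) : IsScalarTower ℂ (M.A W) (M.R W) :=
  IsScalarTower.of_algebraMap_eq fun _ => rfl

/-- The same curve with the subfamily of sections selected by `e`. -/
abbrev sub {J' : Type} [Fintype J'] (e : J' → M.J) : MarkedCurve where
  S := M.S
  X := M.X
  str := M.str
  p := M.p
  smooth := M.smooth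
  separated := M.separated
  compact := M.compact
  quasiSeparated := M.quasiSeparated
  J := J'
  fintype := inferInstance
  σ := fun j => M.σ (e j)
  σ_p := fun j => M.σ_p (e j)

end MarkedCurve

/-- A morphism of families of curves along which every section of the source is a pullback of its
own section of the target. -/
structure MarkedMap (M' M : MarkedCurve) where
  f : M'.S ⟶ M.S
  F : M'.X ⟶ M.X
  comm : F ≫ M.p = M'.p ≫ f
  str : f ≫ M.str = M'.str
  sel : ∃ e : M'.J → M.J, Function.Injective e ∧ ∀ j, M'.σ j ≫ F = f ≫ M.σ (e j)

namespace MarkedMap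

variable {M M' M'' : MarkedCurve}

theorem idealSheaf_le (m : MarkedMap M' M) : M.idealSheaf ≤ M'.idealSheaf.map m.F := by
  classical
  obtain ⟨e, he, h⟩ := m.sel
  have h1 : M.idealSheaf ≤ ∏ j : M'.J, (M.σ (e j)).ker := by
    rw [MarkedCurve.idealSheaf, ← Finset.prod_image (s := Finset.univ) (g := e)
      (f := fun j => (M.σ j).ker) (fun a _ b _ hab => he hab),
      ← Finset.prod_sdiff (Finset.subset_univ (Finset.univ.image e))]
    intro U
    exact Ideal.mul_le_right (I := Scheme.IdealSheafData.ideal _ U)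
  refine h1.trans (prod_le_map_prod _ _ fun j => ?_)
  rw [Scheme.IdealSheafData.map_ker, h j]
  exact Scheme.Hom.le_ker_comp _ _

/-- The induced morphism between the `n`-th neighbourhoods. -/
def thick (m : MarkedMap M' M) (n : ℕ) : M'.thick n ⟶ M.thick n :=
  IsClosedImmersion.lift (M.thickι n) (M'.thickι n ≫ m.F) (by
    rw [MarkedCurve.ker_thickι]
    exact pow_le_map_pow m.F m.idealSheaf_le n)

theorem thick_ι (m : MarkedMap M' M) (n : ℕ) :
    m.thick n ≫ M.thickι n = M'.thickι n ≫ m.F :=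
  IsClosedImmersion.lift_fac _ _ _

theorem thick_proj (m : MarkedMap M' M) (n : ℕ) :
    m.thick n ≫ M.thickProj n = M'.thickProj n ≫ m.f := by
  rw [MarkedCurve.thickProj, ← Category.assoc, thick_ι, Category.assoc, m.comm,
    ← Category.assoc, MarkedCurve.thickProj]

theorem thick_trans (m : MarkedMap M' M) (n : ℕ) :
    M'.thickTrans n ≫ m.thick (n + 1) = m.thick n ≫ M.thickTrans n := by
  rw [← cancel_mono (M.thickι (n + 1)), Category.assoc, thick_ι, ← Category.assoc,
    MarkedCurve.thickTrans_ι, Category.assoc, MarkedCurve.thickTrans_ι, thick_ι]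

variable (m : MarkedMap M' M) {W : M.S.Opens} {W' : M'.S.Opens} (hW : W' ≤ m.f ⁻¹ᵁ W)

/-- Pullback of functions on the base. -/
def base : M.A W →+* M'.A W' := (m.f.appLE W W' hW).hom

theorem preimage_le (m : MarkedMap M' M) {W : M.S.Opens} {W' : M'.S.Opens}
    (hW : W' ≤ m.f ⁻¹ᵁ W) (n : ℕ) :
    M'.thickProj n ⁻¹ᵁ W' ≤ m.thick n ⁻¹ᵁ (M.thickProj n ⁻¹ᵁ W) :=
  fun _ hx => le_preimage_of_comp_eq (m.thick_proj n) W (hW hx)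

/-- Pullback of functions on the `n`-th neighbourhood. -/
def level (n : ℕ) : M.thickRing n W →+* M'.thickRing n W' :=
  ((m.thick n).appLE _ _ (m.preimage_le hW n)).hom

theorem level_res (n : ℕ) (a : M.thickRing (n + 1) W) :
    M'.thickRes n W' (m.level hW (n + 1) a) = m.level hW n (M.thickRes n W a) :=
  appLE_square (m.thick_trans n) _ _ _ _ a

theorem level_str (n : ℕ) (a : M.A W) :
    m.level hW n (M.thickStr n W a) = M'.thickStr n W' (m.base hW a) :=
  appLE_square (m.thick_proj n) _ _ _ _ a

/-- Pullback of functions on the formal neighbourhood. -/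
def formal : M.R W →+* M'.R W' :=
  RingHom.codRestrict
    (RingHom.pi fun n => (m.level hW n).comp (M.lev n W)) (M'.formalSubring W') fun a n => by
      change M'.thickRes n W' (m.level hW (n + 1) (a.1 (n + 1))) = m.level hW n (a.1 n)
      rw [level_res, a.2 n]

theorem lev_formal (n : ℕ) (a : M.R W) :
    M'.lev n W' (m.formal hW a) = m.level hW n (M.lev n W a) := rfl

theorem formal_mem_van {n : ℕ} {a : M.R W} (ha : a ∈ M.van n W) :
    m.formal hW a ∈ M'.van n W' := by
  rw [MarkedCurve.van, RingHom.mem_ker] at *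
  rw [lev_formal, ha, map_zero]

theorem formal_algebraMap (a : M.A W) :
    m.formal hW (algebraMap (M.A W) (M.R W) a) = algebraMap _ _ (m.base hW a) :=
  Subtype.ext (funext fun n => m.level_str hW n a)

theorem base_scalars (c : ℂ) : m.base hW (M.scalars W c) = M'.scalars W' c :=
  appLE_triangle (g := m.f) (h := M.str) m.str (U := ⊤) (V := W) (W := W') le_top hW le_top _

theorem base_algebraMap (c : ℂ) :
    m.base hW (algebraMap ℂ (M.A W) c) = algebraMap ℂ (M'.A W') c := by
  exact m.base_scalars hW c

theorem formal_comp {m : MarkedMap M' M} {m' : MarkedMap M'' M'} {m'' : MarkedMap M'' M}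
    (e : m''.F = m'.F ≫ m.F) {W : M.S.Opens}
    {W' : M'.S.Opens} {W'' : M''.S.Opens} (h : W' ≤ m.f ⁻¹ᵁ W) (h' : W'' ≤ m'.f ⁻¹ᵁ W')
    (h'' : W'' ≤ m''.f ⁻¹ᵁ W) (a : M.R W) :
    m''.formal h'' a = m'.formal h' (m.formal h a) := by
  refine Subtype.ext (funext fun n => ?_)
  refine (appLE_triangle ?_ _ _ _ _).symm
  rw [← cancel_mono (M.thickι n), Category.assoc, thick_ι, ← Category.assoc, thick_ι, thick_ι,
    Category.assoc, e]

theorem base_comp {m : MarkedMap M' M} {m' : MarkedMap M'' M'} {m'' : MarkedMap M'' M}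
    (e : m''.f = m'.f ≫ m.f) {W : M.S.Opens}
    {W' : M'.S.Opens} {W'' : M''.S.Opens} (h : W' ≤ m.f ⁻¹ᵁ W) (h' : W'' ≤ m'.f ⁻¹ᵁ W')
    (h'' : W'' ≤ m''.f ⁻¹ᵁ W) (a : M.A W) :
    m''.base h'' a = m'.base h' (m.base h a) :=
  (appLE_triangle e.symm _ _ _ _).symm

theorem formal_eq_self {m : MarkedMap M M} (e : m.F = 𝟙 _) {W : M.S.Opens}
    (h : W ≤ m.f ⁻¹ᵁ W) (a : M.R W) : m.formal h a = a := by
  refine Subtype.ext (funext fun n => ?_)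
  have : m.thick n = 𝟙 _ := by
    rw [← cancel_mono (M.thickι n), thick_ι, Category.id_comp, e, Category.comp_id]
  exact appLE_eq_self this _ _

theorem base_eq_self {m : MarkedMap M M} (e : m.f = 𝟙 _) {W : M.S.Opens}
    (h : W ≤ m.f ⁻¹ᵁ W) (a : M.A W) : m.base h a = a := appLE_eq_self e _ _

end MarkedMap

/-- A base change `f : T ⟶ S` together with a surjection `π : J ↠ I` and a family of `I` sections
over `T` such that the pullback of `σ j` is the section `π j`; that is, a morphism from `T` to the
closed subscheme `V_{J/I}` of `S` where the sections in the same block coincide. The case `T =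
V_{J/I}` is universal, and the case of `f = 𝟙` and `π = id` is trivial. -/
structure Collapse (M' M : MarkedCurve) where
  f : M'.S ⟶ M.S
  F : M'.X ⟶ M.X
  isPullback : IsPullback F M'.p M.p f
  str : f ≫ M.str = M'.str
  π : M.J → M'.J
  π_surj : Function.Surjective π
  comm : ∀ j, M'.σ (π j) ≫ F = f ≫ M.σ j

namespace Collapse

variable {M M' M'' : MarkedCurve}

/-- The underlying morphism of marked curves. -/
def toMap (m : Collapse M' M) : MarkedMap M' M where
  f := m.f
  F := m.F
  comm := m.isPullback.w
  str := m.str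
  sel := ⟨Function.surjInv m.π_surj, Function.injective_surjInv m.π_surj, fun j => by
    have h := m.comm (Function.surjInv m.π_surj j)
    rwa [Function.surjInv_eq m.π_surj] at h⟩

/-- The identity collapse. -/
def refl (M : MarkedCurve) : Collapse M M where
  f := 𝟙 _
  F := 𝟙 _
  isPullback := IsPullback.of_horiz_isIso ⟨by simp⟩
  str := by simp
  π := id
  π_surj := Function.surjective_id
  comm := by simp

/-- Composition of collapses. -/
def comp (m : Collapse M' M) (m' : Collapse M'' M') : Collapse M'' M where
  f := m'.f ≫ m.f
  F := m'.F ≫ m.F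
  isPullback := m'.isPullback.paste_horiz m.isPullback
  str := by rw [Category.assoc, m.str, m'.str]
  π := m'.π ∘ m.π
  π_surj := m'.π_surj.comp m.π_surj
  comm := fun j => by
    rw [← Category.assoc, Function.comp, m'.comm, Category.assoc, m.comm, Category.assoc]

variable (m : Collapse M' M) {W : M.S.Opens} {W' : M'.S.Opens}
  (h : W' ≤ m.f ⁻¹ᵁ W)

/-- Pullback of functions on the base. -/
def base : M.A W →+* M'.A W' := m.toMap.base h

/-- Pullback of functions on the formal neighbourhood. -/
def formal : M.R W →+* M'.R W' := m.toMap.formal h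

theorem formal_algebraMap (a : M.A W) :
    m.formal h (algebraMap (M.A W) (M.R W) a) = algebraMap _ _ (m.base h a) :=
  m.toMap.formal_algebraMap h a

theorem base_algebraMap (c : ℂ) :
    m.base h (algebraMap ℂ (M.A W) c) = algebraMap ℂ (M'.A W') c :=
  m.toMap.base_algebraMap h c

theorem formal_mem_van {n : ℕ} {a : M.R W} (ha : a ∈ M.van n W) :
    m.formal h a ∈ M'.van n W' := m.toMap.formal_mem_van h ha

theorem formal_comp (m : Collapse M' M) (m' : Collapse M'' M') {W : M.S.Opens}
    {W' : M'.S.Opens} {W'' : M''.S.Opens} (h : W' ≤ m.f ⁻¹ᵁ W) (h' : W'' ≤ m'.f ⁻¹ᵁ W')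
    (h'' : W'' ≤ (m.comp m').f ⁻¹ᵁ W) (a : M.R W) :
    (m.comp m').formal h'' a = m'.formal h' (m.formal h a) :=
  MarkedMap.formal_comp (m := m.toMap) (m' := m'.toMap) (m'' := (m.comp m').toMap) rfl h h' h'' a

theorem base_comp (m : Collapse M' M) (m' : Collapse M'' M') {W : M.S.Opens}
    {W' : M'.S.Opens} {W'' : M''.S.Opens} (h : W' ≤ m.f ⁻¹ᵁ W) (h' : W'' ≤ m'.f ⁻¹ᵁ W')
    (h'' : W'' ≤ (m.comp m').f ⁻¹ᵁ W) (a : M.A W) :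
    (m.comp m').base h'' a = m'.base h' (m.base h a) :=
  MarkedMap.base_comp (m := m.toMap) (m' := m'.toMap) (m'' := (m.comp m').toMap) rfl h h' h'' a

theorem le_refl_preimage {W W' : M.S.Opens} (h : W' ≤ W) : W' ≤ (refl M).f ⁻¹ᵁ W := h

theorem formal_refl {W : M.S.Opens} (h : W ≤ (refl M).f ⁻¹ᵁ W) (a : M.R W) :
    (refl M).formal h a = a :=
  MarkedMap.formal_eq_self (m := (refl M).toMap) rfl h a

theorem base_refl {W : M.S.Opens} (h : W ≤ (refl M).f ⁻¹ᵁ W) (a : M.A W) :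
    (refl M).base h a = a :=
  MarkedMap.base_eq_self (m := (refl M).toMap) rfl h a

end Collapse

namespace MarkedCurve

variable (M : MarkedCurve)

/-- The functions on the formal neighbourhood whose zero locus is supported on `Σ`: they divide a
power of the ideal of `Σ`, universally with respect to base change. -/
def off (W : M.S.Opens) : Submonoid (M.R W) where
  carrier := {s | ∃ k : ℕ, ∀ (M' : MarkedCurve) (m : Collapse M' M) (W' : M'.S.affineOpens)
    (h : W'.1 ≤ m.f ⁻¹ᵁ W), M'.van 1 W'.1 ^ k ≤ Ideal.span {m.formal h s}}
  one_mem' := ⟨0, fun M' m W' h => by simp⟩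
  mul_mem' := by
    rintro s t ⟨k, hk⟩ ⟨l, hl⟩
    refine ⟨k + l, fun M' m W' h => ?_⟩
    rw [map_mul, pow_add, ← Ideal.span_singleton_mul_span_singleton]
    exact Ideal.mul_mono (hk M' m W' h) (hl M' m W' h)

/-- The ring `𝒪_{Σ̄^*}(W)` of functions on the punctured formal neighbourhood of `Σ`. -/
abbrev K (W : M.S.Opens) : Type := Localization (M.off W)

end MarkedCurve

namespace Collapse

variable {M M' M'' : MarkedCurve} (m : Collapse M' M) {W : M.S.Opens} {W' : M'.S.Opens}
  (h : W' ≤ m.f ⁻¹ᵁ W)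

theorem off_le : M.off W ≤ (M'.off W').comap (m.formal h) := by
  rintro s ⟨k, hk⟩
  refine ⟨k, fun M'' m' W'' h' => ?_⟩
  have := hk M'' (m.comp m') W'' (fun x hx => h (h' hx))
  rw [← formal_comp m m' h h' (fun x hx => h (h' hx))]
  exact this

/-- Pullback of functions on the punctured formal neighbourhood. -/
def punctured : M.K W →+* M'.K W' :=
  IsLocalization.map (M := M.off W) (T := M'.off W') (M'.K W') (m.formal h) (m.off_le h)

theorem punctured_algebraMap (a : M.R W) :
    m.punctured h (algebraMap _ _ a) = algebraMap _ _ (m.formal h a) :=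
  IsLocalization.map_eq _ _

theorem punctured_algebraMap_base (a : M.A W) :
    m.punctured h (algebraMap _ _ a) = algebraMap _ _ (m.base h a) := by
  rw [IsScalarTower.algebraMap_apply (M.A W) (M.R W) (M.K W), punctured_algebraMap,
    formal_algebraMap, ← IsScalarTower.algebraMap_apply]

theorem punctured_algebraMap_complex (a : ℂ) :
    m.punctured h (algebraMap ℂ _ a) = algebraMap ℂ _ a := by
  rw [IsScalarTower.algebraMap_apply ℂ (M.A W) (M.K W), punctured_algebraMap_base,
    base_algebraMap, ← IsScalarTower.algebraMap_apply]

theorem punctured_comp (m : Collapse M' M) (m' : Collapse M'' M') {W : M.S.Opens}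
    {W' : M'.S.Opens} {W'' : M''.S.Opens} (h : W' ≤ m.f ⁻¹ᵁ W) (h' : W'' ≤ m'.f ⁻¹ᵁ W')
    (h'' : W'' ≤ (m.comp m').f ⁻¹ᵁ W) (a : M.K W) :
    (m.comp m').punctured h'' a = m'.punctured h' (m.punctured h a) := by
  have : (m.comp m').punctured h'' = (m'.punctured h').comp (m.punctured h) := by
    refine IsLocalization.ringHom_ext (M.off W) (RingHom.ext fun x => ?_)
    simp only [RingHom.comp_apply, punctured_algebraMap, formal_comp m m' h h' h'']
  rw [this]; rfl

theorem punctured_refl {W : M.S.Opens} (h : W ≤ (refl M).f ⁻¹ᵁ W) (a : M.K W) :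
    (refl M).punctured h a = a := by
  have : (refl M).punctured h = RingHom.id _ := by
    refine IsLocalization.ringHom_ext (M.off W) (RingHom.ext fun x => ?_)
    simp only [RingHom.comp_apply, punctured_algebraMap, RingHom.id_apply, formal_refl]
  rw [this]; rfl

end Collapse

namespace MarkedCurve

open Polynomial

/-- A coordinate `t` along `Σ` over `W`, with the monic polynomial `F` such that `F t` is an
equation of `Σ`: the `n`-th neighbourhood of `Σ` is the spectrum of `𝒪_S(W)[t] / F^n`. -/
structure Coordinate (M : MarkedCurve) (W : M.S.Opens) where
  t : M.R W
  F : (M.A W)[X]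
  monic : F.Monic
  natDegree : F.natDegree = Fintype.card M.J
  lev_eq_zero_iff : ∀ (n : ℕ) (q : (M.A W)[X]), M.lev n W (aeval t q) = 0 ↔ F ^ n ∣ q
  lev_surjective : ∀ (n : ℕ) (y : M.thickRing n W), ∃ q : (M.A W)[X], M.lev n W (aeval t q) = y

variable {M : MarkedCurve} {W : M.S.Opens}

/-- The function `g` agrees with `p(t) / F(t)^n` modulo `F(t)^{n+1}`. -/
def Coordinate.IsApprox (x : M.Coordinate W) (n : ℕ) (p : (M.A W)[X]) (g : M.K W) : Prop :=
  ∃ a : M.R W, g * algebraMap (M.R W) (M.K W) (aeval x.t x.F ^ n) = algebraMap _ _ a ∧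
    a - aeval x.t p ∈ M.van (2 * n + 1) W

/-- For `f = p / F^n` and `g = q / F^n`, the sum over the roots of `F` of the residues of `f dg =
p (q' F - n q F') / F^{2n+1} dt`. The total residue of `h / F^m dt` is the coefficient of degree
`m * deg F - 1` of the remainder of `h` by `F^m`. -/
def ratResidue {A : Type} [CommRing A] (F : A[X]) (n : ℕ) (p q : A[X]) : A :=
  ((p * (derivative q * F - (n : A[X]) * q * derivative F)) %ₘ F ^ (2 * n + 1)).coeff
    ((2 * n + 1) * F.natDegree - 1)

/-- `IsResidue f g c` says that `c = Res_Σ (f dg)`. Residues are computed in coordinates, which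
exist locally on the base; hence the base changes. -/
def IsResidue (f g : M.K W) (c : M.A W) : Prop :=
  ∀ (M' : MarkedCurve) (m : Collapse M' M) (W' : M'.S.affineOpens) (h : W'.1 ≤ m.f ⁻¹ᵁ W)
    (x : M'.Coordinate W'.1) (n : ℕ) (p q : (M'.A W'.1)[X]),
    x.IsApprox n p (m.punctured h f) → x.IsApprox n q (m.punctured h g) →
      m.base h c = ratResidue x.F n p q

theorem IsResidue.map {M' : MarkedCurve} (m : Collapse M' M) {W' : M'.S.Opens}
    (h : W' ≤ m.f ⁻¹ᵁ W) {f g : M.K W} {c : M.A W} (H : IsResidue f g c) :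
    IsResidue (m.punctured h f) (m.punctured h g) (m.base h c) := by
  intro M'' m' W'' h' x n p q hp hq
  have h'' : W''.1 ≤ (m.comp m').f ⁻¹ᵁ W := fun x hx => h (h' hx)
  rw [← Collapse.base_comp m m' h h' h'']
  refine H M'' (m.comp m') W'' h'' x n p q ?_ ?_
  · rwa [Collapse.punctured_comp m m' h h' h'']
  · rwa [Collapse.punctured_comp m m' h h' h'']

theorem Coordinate.aeval_F_mem (x : M.Coordinate W) : aeval x.t x.F ∈ M.van 1 W :=
  (x.lev_eq_zero_iff 1 x.F).2 (by simp)

theorem Coordinate.eq_of_algebraMap_eq (x : M.Coordinate W) (hW : IsAffineOpen W) {a b : M.R W}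
    (h : algebraMap (M.R W) (M.K W) a = algebraMap _ _ b) : a = b := by
  obtain ⟨⟨s, k, hk⟩, hs⟩ := (IsLocalization.eq_iff_exists (M.off W) (M.K W)).1 h
  have hs : s * a = s * b := hs
  have h1 := hk M (Collapse.refl M) ⟨W, hW⟩ (Collapse.le_refl_preimage le_rfl)
  have h2 : aeval x.t x.F ^ k ∈ Ideal.span {s} := by
    have := h1 (Ideal.pow_mem_pow x.aeval_F_mem k)
    rwa [show (Collapse.refl M).formal _ s = s from Collapse.formal_refl _ s] at this
  obtain ⟨y, hy⟩ := Ideal.mem_span_singleton.1 h2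
  have h3 : aeval x.t x.F ^ k * (a - b) = 0 := by
    rw [hy]; linear_combination y * hs
  refine Subtype.ext (funext fun n => ?_)
  obtain ⟨q, hq⟩ := x.lev_surjective (n + k) (M.lev (n + k) W (a - b))
  have h4 : x.F ^ (n + k) ∣ x.F ^ k * q := by
    rw [← x.lev_eq_zero_iff, map_mul, map_mul, hq, ← map_mul, map_pow, h3, map_zero]
  rw [pow_add, mul_comm] at h4
  obtain ⟨r, hr⟩ := h4
  have h5 : q = x.F ^ n * r := by
    have := (x.monic.pow k).isRegular.left
    apply this
    simp only
    rw [hr]; ring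
  have h6 : M.lev n W (a - b) = M.lev n W (aeval x.t q) := by
    have hstep : ∀ (i : ℕ) (u v : M.R W), M.lev (n + i) W u = M.lev (n + i) W v →
        M.lev n W u = M.lev n W v := by
      intro i u v huv
      induction i with
      | zero => exact huv
      | succ i ih =>
        apply ih
        rw [show M.lev (n + i) W u = _ from (u.2 (n + i)).symm,
          show M.lev (n + i) W v = _ from (v.2 (n + i)).symm]
        exact congrArg _ huv
    exact hstep k _ _ hq.symm
  have h7 : M.lev n W (a - b) = 0 := by
    rw [h6, x.lev_eq_zero_iff]; exact ⟨r, h5⟩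
  rw [map_sub, sub_eq_zero] at h7
  exact h7

end MarkedCurve

namespace MarkedCurve

open Polynomial

theorem derivative_pow_mul_sub {A : Type} [CommRing A] (F u : A[X]) (n i : ℕ) :
    derivative (F ^ (n + i) * u) * F - (n : A[X]) * (F ^ (n + i) * u) * derivative F =
      F ^ (n + i) * ((i : A[X]) * derivative F * u + F * derivative u) := by
  have h : derivative (F ^ (n + i)) * F = ((n + i : ℕ) : A[X]) * F ^ (n + i) * derivative F := by
    rw [derivative_pow]
    rcases Nat.eq_zero_or_pos (n + i) with h0 | h0
    · simp [h0]
    · obtain ⟨j, hj⟩ := Nat.exists_eq_succ_of_ne_zero h0.ne'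
      rw [hj, Nat.succ_eq_add_one, Nat.add_sub_cancel, pow_succ, C_eq_natCast]; ring
  rw [derivative_mul, add_mul, mul_right_comm, h]
  push_cast
  ring

theorem ratResidue_eq_zero {A : Type} [CommRing A] {F : A[X]} (hF : F.Monic) {n k m : ℕ}
    {p q β γ ξ δ : A[X]} (hp : p * F ^ k = β * F ^ n + F ^ (2 * n + 1 + k) * γ)
    (hq : q = F ^ (n + m) * ξ + F ^ (2 * n + 1) * δ) (hm : k + 1 ≤ m) :
    ratResidue F n p q = 0 := by
  obtain ⟨l, rfl⟩ := Nat.exists_eq_add_of_le hm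
  suffices h : F ^ (2 * n + 1) ∣ p * (derivative q * F - (n : A[X]) * q * derivative F) by
    rw [ratResidue, (modByMonic_eq_zero_iff_dvd (hF.pow _)).2 h, coeff_zero]
  have e2 : F ^ (2 * n + 1) = F ^ (n + (n + 1)) := by congr 1; ring
  have e1 : derivative q * F - (n : A[X]) * q * derivative F =
      F ^ (n + (k + 1 + l)) * (((k + 1 + l : ℕ) : A[X]) * derivative F * ξ + F * derivative ξ) +
      F ^ (2 * n + 1) * (((n + 1 : ℕ) : A[X]) * derivative F * δ + F * derivative δ) := by
    rw [e2, ← derivative_pow_mul_sub, ← derivative_pow_mul_sub, hq, e2, derivative_add]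
    ring
  rw [e1, mul_add]
  generalize ((k + 1 + l : ℕ) : A[X]) * derivative F * ξ + F * derivative ξ = u
  generalize ((n + 1 : ℕ) : A[X]) * derivative F * δ + F * derivative δ = v
  refine dvd_add ?_ ⟨p * v, by ring⟩
  refine ⟨(β + F ^ (n + 1 + k) * γ) * F ^ l * u, ?_⟩
  have := (hF.pow k).isRegular.left
  apply this
  simp only
  calc F ^ k * (p * (F ^ (n + (k + 1 + l)) * u))
      = (p * F ^ k) * (F ^ (n + (k + 1 + l)) * u) := by ring
    _ = (β * F ^ n + F ^ (2 * n + 1 + k) * γ) * (F ^ (n + (k + 1 + l)) * u) := by rw [hp]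
    _ = _ := by ring

variable {M : MarkedCurve} {W : M.S.Opens}

theorem lev_eq_of_le {n N : ℕ} (h : n ≤ N) {u v : M.R W} (e : M.lev N W u = M.lev N W v) :
    M.lev n W u = M.lev n W v := by
  obtain ⟨i, rfl⟩ := Nat.exists_eq_add_of_le h
  clear h
  induction i with
  | zero => exact e
  | succ i ih =>
    apply ih
    rw [show M.lev (n + i) W u = _ from (u.2 (n + i)).symm,
      show M.lev (n + i) W v = _ from (v.2 (n + i)).symm]
    exact congrArg _ e

theorem isResidue_zero (g : M.K W) :
    ∃ k, ∀ m, k ≤ m → ∀ x ∈ M.van m W, IsResidue g (algebraMap (M.R W) (M.K W) x) 0 := by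
  obtain ⟨a₀, s, hs⟩ := IsLocalization.exists_mk'_eq (M.off W) g
  obtain ⟨s, k, hk⟩ := s
  refine ⟨k + 1, fun m hm x hx M' φ W' h X n p q hp hq => ?_⟩
  rw [map_zero]
  have hg : g * algebraMap (M.R W) (M.K W) s = algebraMap _ _ a₀ := by
    rw [← hs]; exact IsLocalization.mk'_spec _ _ _
  set T := aeval X.t X.F with hT
  obtain ⟨y, hy⟩ := Ideal.mem_span_singleton.1
    (hk M' φ W' h (Ideal.pow_mem_pow X.aeval_F_mem k))
  obtain ⟨a, ha, hap⟩ := hp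
  obtain ⟨a₂, ha₂, hap₂⟩ := hq
  have hg' : φ.punctured h g * algebraMap _ _ (φ.formal h s) =
      algebraMap _ _ (φ.formal h a₀) := by
    rw [← Collapse.punctured_algebraMap, ← map_mul, hg, Collapse.punctured_algebraMap]
  have e1 : a * T ^ k = φ.formal h a₀ * y * T ^ n := by
    apply X.eq_of_algebraMap_eq W'.2
    rw [map_mul, ← ha, hy]
    simp only [map_mul]
    rw [← hg']
    ring
  have e2 : a₂ = φ.formal h x * T ^ n := by
    apply X.eq_of_algebraMap_eq W'.2
    rw [← ha₂, Collapse.punctured_algebraMap, map_mul]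
  obtain ⟨α, hα⟩ := X.lev_surjective (2 * n + 1 + k) (M'.lev _ W'.1 a)
  obtain ⟨β, hβ⟩ := X.lev_surjective (2 * n + 1 + k) (M'.lev _ W'.1 (φ.formal h a₀ * y))
  obtain ⟨ξ, hξ⟩ := X.lev_surjective (m + (2 * n + 1)) (M'.lev _ W'.1 (φ.formal h x))
  have d1 : X.F ^ (2 * n + 1 + k) ∣ α * X.F ^ k - β * X.F ^ n := by
    have : M'.lev (2 * n + 1 + k) W'.1 (a * T ^ k - φ.formal h a₀ * y * T ^ n) = 0 := by
      rw [e1, sub_self, map_zero]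
    rw [← X.lev_eq_zero_iff, ← this, map_sub, map_mul, map_mul, map_sub, map_mul, hα, map_mul,
      hβ, map_sub (M'.lev _ _) (a * _), map_mul (M'.lev _ _) a,
      map_mul (M'.lev _ _) (φ.formal h a₀ * y)]
    simp only [map_pow, hT]
  have d2 : X.F ^ (2 * n + 1) ∣ α - p := by
    rw [← X.lev_eq_zero_iff, map_sub, map_sub, lev_eq_of_le (by omega) hα, ← map_sub]
    exact hap
  have d3 : X.F ^ m ∣ ξ := by
    rw [← X.lev_eq_zero_iff, lev_eq_of_le (by omega) hξ]
    exact φ.formal_mem_van h hx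
  have d4 : X.F ^ (2 * n + 1) ∣ ξ * X.F ^ n - q := by
    rw [← X.lev_eq_zero_iff]
    have := lev_eq_of_le (show 2 * n + 1 ≤ m + (2 * n + 1) by omega) hξ
    have h0 : M'.lev (2 * n + 1) W'.1 (φ.formal h x * T ^ n - aeval X.t q) = 0 := by
      rw [← e2]; exact hap₂
    rw [← h0, map_sub, map_mul, map_sub, map_mul, this, map_sub, map_mul]
    simp only [map_pow, hT]
  obtain ⟨γ₁, h1⟩ := d1
  obtain ⟨γ₂, h2⟩ := d2
  obtain ⟨ξ₁, h3⟩ := d3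
  obtain ⟨δ, h4⟩ := d4
  refine Eq.symm <| ratResidue_eq_zero X.monic (k := k) (m := m) (β := β) (γ := γ₁ - γ₂) (ξ := ξ₁)
    (δ := -δ) ?_ ?_ hm
  · have : p = α - X.F ^ (2 * n + 1) * γ₂ := by rw [← h2]; ring
    rw [this]
    linear_combination h1
  · rw [h3] at h4
    linear_combination -h4

end MarkedCurve

universe u

namespace MarkedCurve

/-- The affine opens over which all neighbourhoods of `Σ` are affine and `Σ` has a global
equation. They are a basis of the topology of `S`. -/
structure IsChart (M : MarkedCurve) (W : M.S.Opens) : Prop where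
  affine : IsAffineOpen W
  thick_affine : ∀ n, IsAffineOpen (M.thickProj n ⁻¹ᵁ W)
  principal : ∃ s ∈ M.off W, ∀ n, M.van n W = Ideal.span {s ^ n}

/-- The charts of `S`. -/
structure Chart (M : MarkedCurve) where
  W : M.S.Opens
  isChart : M.IsChart W

instance (M : MarkedCurve) : Preorder M.Chart := Preorder.lift Chart.W

end MarkedCurve

section Enveloping

variable (𝔤 : Type u) [LieRing 𝔤] [LieAlgebra ℂ 𝔤] (κ : LinearMap.BilinForm ℂ 𝔤)
  (M : MarkedCurve) (W : M.S.Opens)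

/-- The sections over `W` of the affine algebra `ĝ_Σ = 𝔤 ⊗_ℂ 𝒪_{Σ̄^*} ⊕ 𝒪_S 𝟏`. -/
def Affine : Type u := (M.K W ⊗[ℂ] 𝔤) × M.A W

instance : AddCommGroup (Affine 𝔤 M W) := inferInstanceAs (AddCommGroup ((M.K W ⊗[ℂ] 𝔤) × M.A W))

instance : Module (M.A W) (Affine 𝔤 M W) :=
  inferInstanceAs (Module (M.A W) ((M.K W ⊗[ℂ] 𝔤) × M.A W))

/-- The element `X ⊗ f` of the affine algebra. -/
def affine {𝔤 : Type u} [LieRing 𝔤] [LieAlgebra ℂ 𝔤] {M : MarkedCurve} {W : M.S.Opens}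
    (X : 𝔤) (f : M.K W) : Affine 𝔤 M W := (f ⊗ₜ[ℂ] X, 0)

/-- The element `a 𝟏` of the affine algebra. -/
def central (𝔤 : Type u) [LieRing 𝔤] [LieAlgebra ℂ 𝔤] {M : MarkedCurve} {W : M.S.Opens}
    (a : M.A W) : Affine 𝔤 M W := (0, a)

/-- The tensor algebra of the affine algebra. -/
abbrev Tensors : Type u := TensorAlgebra (M.A W) (Affine 𝔤 M W)

/-- The inclusion of the affine algebra into its tensor algebra. -/
abbrev tι : Affine 𝔤 M W →ₗ[M.A W] Tensors 𝔤 M W := TensorAlgebra.ι (M.A W)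

/-- The relations of `U¹`: the commutator of `X ⊗ f` and `Y ⊗ g` is `[X, Y] ⊗ f g + κ(X, Y) Res_Σ
(g df) 𝟏`, the element `𝟏` is central, and `𝟏` is identified with the unit. -/
inductive EnvRel : Tensors 𝔤 M W → Tensors 𝔤 M W → Prop
  | bracket (X Y : 𝔤) (f g : M.K W) (c : M.A W) (hc : MarkedCurve.IsResidue g f c) :
      EnvRel
        (tι 𝔤 M W (affine X f) * tι 𝔤 M W (affine Y g) -
          tι 𝔤 M W (affine Y g) * tι 𝔤 M W (affine X f))
        (tι 𝔤 M W (affine ⁅X, Y⁆ (f * g) + central 𝔤 (κ X Y • c)))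
  | central (x : Affine 𝔤 M W) :
      EnvRel
        (tι 𝔤 M W (central 𝔤 1) * tι 𝔤 M W x - tι 𝔤 M W x * tι 𝔤 M W (central 𝔤 1)) 0
  | level : EnvRel (tι 𝔤 M W (central 𝔤 1)) 1

/-- The quotient `U¹` of the universal enveloping algebra of `ĝ_Σ` by `1 - 𝟏`, over `W`. -/
def Env : Type u := RingQuot (EnvRel 𝔤 κ M W)

instance : Ring (Env 𝔤 κ M W) := inferInstanceAs (Ring (RingQuot (EnvRel 𝔤 κ M W)))

instance : Algebra (M.A W) (Env 𝔤 κ M W) :=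
  inferInstanceAs (Algebra (M.A W) (RingQuot (EnvRel 𝔤 κ M W)))

/-- The quotient map. -/
def envMk : Tensors 𝔤 M W →ₐ[M.A W] Env 𝔤 κ M W := RingQuot.mkAlgHom (M.A W) (EnvRel 𝔤 κ M W)

/-- The canonical map from the affine algebra. -/
def envι : Affine 𝔤 M W →ₗ[M.A W] Env 𝔤 κ M W :=
  (envMk 𝔤 κ M W).toLinearMap ∘ₗ tι 𝔤 M W

/-- The left ideal `U¹ ĝ^{≥ n}`, where `ĝ^{≥ n} = 𝔤 ⊗ 𝒪_{Σ̄}(-nΣ)`. -/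
def envNhd (n : ℕ) : Ideal (Env 𝔤 κ M W) :=
  Ideal.span {y | ∃ x ∈ M.van n W, ∃ X : 𝔤,
    y = envι 𝔤 κ M W (affine X (algebraMap (M.R W) (M.K W) x))}

variable {𝔤 κ M W}

theorem envMk_rel {x y : Tensors 𝔤 M W} (h : EnvRel 𝔤 κ M W x y) :
    envMk 𝔤 κ M W x = envMk 𝔤 κ M W y := RingQuot.mkAlgHom_rel (M.A W) h

theorem central_eq_smul (a : M.A W) :
    (central 𝔤 a : Affine 𝔤 M W) = a • (central 𝔤 1 : Affine 𝔤 M W) :=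
  Prod.ext (smul_zero a).symm (mul_one a).symm

theorem envι_level (a : M.A W) : envι 𝔤 κ M W (central 𝔤 a) = algebraMap _ _ a := by
  have h : envι 𝔤 κ M W (central 𝔤 1) = 1 := (envMk_rel EnvRel.level).trans (map_one _)
  rw [central_eq_smul, map_smul, h, Algebra.algebraMap_eq_smul_one]

theorem envι_bracket (X Y : 𝔤) (f g : M.K W) (c : M.A W) (hc : MarkedCurve.IsResidue g f c) :
    envι 𝔤 κ M W (affine X f) * envι 𝔤 κ M W (affine Y g) -
      envι 𝔤 κ M W (affine Y g) * envι 𝔤 κ M W (affine X f) =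
    envι 𝔤 κ M W (affine ⁅X, Y⁆ (f * g)) + algebraMap _ _ (κ X Y • c) := by
  have h := envMk_rel (EnvRel.bracket (κ := κ) X Y f g c hc)
  rw [map_sub, map_mul, map_mul] at h
  rw [← envι_level, ← map_add]
  exact h

theorem affine_induction {P : Affine 𝔤 M W → Prop} (hc : ∀ a, P (central 𝔤 a))
    (ha : ∀ X f, P (affine X f)) (hadd : ∀ x y, P x → P y → P (x + y)) (x : Affine 𝔤 M W) :
    P x := by
  obtain ⟨z, c⟩ := x
  have h0 : ∀ z : M.K W ⊗[ℂ] 𝔤, P (show Affine 𝔤 M W from (z, 0)) := by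
    intro z
    induction z using TensorProduct.induction_on with
    | zero => exact hc 0
    | tmul f X => exact ha X f
    | add x y hx hy =>
      have h := hadd _ _ hx hy
      have e : (show Affine 𝔤 M W from (x, 0)) + (show Affine 𝔤 M W from (y, 0)) =
        (show Affine 𝔤 M W from (x + y, 0)) := Prod.ext rfl (add_zero 0)
      rwa [e] at h
  have h := hadd _ _ (h0 z) (hc c)
  have e : (show Affine 𝔤 M W from (z, 0)) + central 𝔤 c = (show Affine 𝔤 M W from (z, c)) :=
    Prod.ext (add_zero z) (zero_add c)
  rwa [e] at h

theorem env_induction {P : Env 𝔤 κ M W → Prop} (halg : ∀ a, P (algebraMap (M.A W) _ a))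
    (hι : ∀ X f, P (envι 𝔤 κ M W (affine X f))) (hmul : ∀ a b, P a → P b → P (a * b))
    (hadd : ∀ a b, P a → P b → P (a + b)) (a : Env 𝔤 κ M W) : P a := by
  obtain ⟨a, rfl⟩ : ∃ b, envMk 𝔤 κ M W b = a := RingQuot.mkAlgHom_surjective _ _ a
  induction a using TensorAlgebra.induction with
  | algebraMap r => rw [AlgHom.commutes]; exact halg r
  | mul a b ha hb => rw [map_mul]; exact hmul _ _ ha hb
  | add a b ha hb => rw [map_add]; exact hadd _ _ ha hb
  | ι x =>
    change P (envι 𝔤 κ M W x)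
    induction x using affine_induction with
    | hc a => rw [envι_level]; exact halg a
    | ha X f => exact hι X f
    | hadd x y hx hy => rw [map_add]; exact hadd _ _ hx hy

theorem van_antitone {n N : ℕ} (h : n ≤ N) {x : M.R W} (hx : x ∈ M.van N W) :
    x ∈ M.van n W := by
  have h1 : M.lev N W x = M.lev N W 0 := (show M.lev N W x = 0 from hx).trans (map_zero _).symm
  exact (MarkedCurve.lev_eq_of_le h h1).trans (map_zero _)

theorem envNhd_antitone : Antitone (envNhd 𝔤 κ M W) := by
  refine antitone_nat_of_succ_le fun n => Ideal.span_mono ?_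
  rintro y ⟨x, hx, X, rfl⟩
  exact ⟨x, van_antitone (Nat.le_succ n) hx, X, rfl⟩

theorem envNhd_mul (C : M.Chart) (a : Env 𝔤 κ M C.W) (n : ℕ) :
    ∃ m, ∀ y ∈ envNhd 𝔤 κ M C.W m, y * a ∈ envNhd 𝔤 κ M C.W n := by
  induction a using env_induction generalizing n with
  | halg a =>
    refine ⟨n, fun y hy => ?_⟩
    rw [← Algebra.commutes]
    exact Ideal.mul_mem_left _ _ hy
  | hmul a b ha hb =>
    obtain ⟨m₁, h₁⟩ := hb n
    obtain ⟨m₂, h₂⟩ := ha m₁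
    refine ⟨m₂, fun y hy => ?_⟩
    rw [← mul_assoc]
    exact h₁ _ (h₂ _ hy)
  | hadd a b ha hb =>
    obtain ⟨m₁, h₁⟩ := ha n
    obtain ⟨m₂, h₂⟩ := hb n
    refine ⟨max m₁ m₂, fun y hy => ?_⟩
    rw [mul_add]
    exact add_mem (h₁ _ (envNhd_antitone (le_max_left _ _) hy))
      (h₂ _ (envNhd_antitone (le_max_right _ _) hy))
  | hι Y g =>
    obtain ⟨s₀, -, hs₀⟩ := C.isChart.principal
    obtain ⟨a₀, ⟨s, k, hk⟩, hg⟩ := IsLocalization.exists_mk'_eq (M.off C.W) g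
    have hg : g * algebraMap (M.R C.W) (M.K C.W) s = algebraMap _ _ a₀ := by
      rw [← hg]; exact IsLocalization.mk'_spec _ _ _
    obtain ⟨l, hl⟩ := MarkedCurve.isResidue_zero g
    have h1 : s₀ ∈ M.van 1 C.W := by
      rw [hs₀, pow_one]; exact Ideal.mem_span_singleton_self _
    have h2 := hk M (Collapse.refl M) ⟨C.W, C.isChart.affine⟩ (Collapse.le_refl_preimage le_rfl)
      (Ideal.pow_mem_pow h1 k)
    rw [Collapse.formal_refl] at h2
    obtain ⟨y₀, hy₀⟩ := Ideal.mem_span_singleton.1 h2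
    refine ⟨n + k + l, fun y hy => ?_⟩
    refine Submodule.span_induction (p := fun y _ => y * envι 𝔤 κ M C.W (affine Y g) ∈
      envNhd 𝔤 κ M C.W n) ?_ ?_ ?_ ?_ hy
    · rintro _ ⟨x, hx, X, rfl⟩
      have hb := envι_bracket (κ := κ) X Y (algebraMap _ _ x) g 0 (hl _ (by omega) x hx)
      rw [smul_zero, map_zero, add_zero, sub_eq_iff_eq_add] at hb
      rw [hb]
      have hxn : x ∈ M.van n C.W := van_antitone (by omega) hx
      refine add_mem ?_ (Ideal.mul_mem_left _ _ (Ideal.subset_span ⟨x, hxn, X, rfl⟩))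
      rw [hs₀] at hx
      obtain ⟨z, rfl⟩ := Ideal.mem_span_singleton.1 hx
      have e : algebraMap (M.R C.W) (M.K C.W) (s₀ ^ (n + k + l) * z) * g =
          algebraMap (M.R C.W) (M.K C.W) (s₀ ^ n * (s₀ ^ l * z * y₀ * a₀)) := by
        rw [pow_add, pow_add, hy₀]
        simp only [map_mul]
        rw [← hg]; ring
      rw [e]
      refine Ideal.subset_span ⟨s₀ ^ n * (s₀ ^ l * z * y₀ * a₀), ?_, ⁅X, Y⁆, rfl⟩
      rw [hs₀]; exact Ideal.mul_mem_right _ _ (Ideal.mem_span_singleton_self _)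
    · rw [zero_mul]; exact zero_mem _
    · intro a b _ _ ha hb; rw [add_mul]; exact add_mem ha hb
    · intro r a _ ha; rw [smul_eq_mul, mul_assoc]; exact Ideal.mul_mem_left _ _ ha

end Enveloping

section Completed

variable (𝔤 : Type u) [LieRing 𝔤] [LieAlgebra ℂ 𝔤] (κ : LinearMap.BilinForm ℂ 𝔤)
  {M : MarkedCurve}

/-- The algebra `U¹` over a chart, with the topology given by the left ideals `U¹ ĝ^{≥ n}`. -/
def ChartEnv (C : M.Chart) : Type u := Env 𝔤 κ M C.W

instance (C : M.Chart) : Ring (ChartEnv 𝔤 κ C) := inferInstanceAs (Ring (Env 𝔤 κ M C.W))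

instance (C : M.Chart) : Algebra (M.A C.W) (ChartEnv 𝔤 κ C) :=
  inferInstanceAs (Algebra (M.A C.W) (Env 𝔤 κ M C.W))

/-- The canonical map from the affine algebra. -/
def chartι (C : M.Chart) : Affine 𝔤 M C.W →ₗ[M.A C.W] ChartEnv 𝔤 κ C := envι 𝔤 κ M C.W

/-- The left ideals `U¹ ĝ^{≥ n}`. -/
def chartNhd (C : M.Chart) (n : ℕ) : Ideal (ChartEnv 𝔤 κ C) := envNhd 𝔤 κ M C.W n

theorem chartNhd_antitone (C : M.Chart) : Antitone (chartNhd 𝔤 κ C) := envNhd_antitone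

theorem chartNhd_basis (C : M.Chart) :
    RingSubgroupsBasis fun n => (chartNhd 𝔤 κ C n).toAddSubgroup where
  inter i j := ⟨max i j, le_inf (chartNhd_antitone 𝔤 κ C (le_max_left i j))
    (chartNhd_antitone 𝔤 κ C (le_max_right i j))⟩
  mul i := ⟨i, by
    rintro _ ⟨a, -, b, hb, rfl⟩
    exact Ideal.mul_mem_left _ a hb⟩
  leftMul x i := ⟨i, fun b hb => Ideal.mul_mem_left _ x hb⟩
  rightMul x i := envNhd_mul C x i

instance (C : M.Chart) : TopologicalSpace (ChartEnv 𝔤 κ C) := (chartNhd_basis 𝔤 κ C).topology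

instance (C : M.Chart) : IsTopologicalRing (ChartEnv 𝔤 κ C) :=
  (chartNhd_basis 𝔤 κ C).toRingFilterBasis.isTopologicalRing

instance (C : M.Chart) : UniformSpace (ChartEnv 𝔤 κ C) :=
  IsTopologicalAddGroup.rightUniformSpace _

instance (C : M.Chart) : IsUniformAddGroup (ChartEnv 𝔤 κ C) :=
  isUniformAddGroup_of_addCommGroup

instance (C : M.Chart) : UniformContinuousConstSMul (M.A C.W) (ChartEnv 𝔤 κ C) where
  uniformContinuous_const_smul a := by
    have h : ∀ x : ChartEnv 𝔤 κ C, a • x = AddMonoidHom.mulLeft (algebraMap _ _ a) x :=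
      fun x => Algebra.smul_def a x
    simp only [h]
    exact uniformContinuous_addMonoidHom_of_continuous (continuous_const_mul _)

/-- The completed enveloping algebra `𝒰_κ(ĝ_Σ) = lim U¹ / U¹ ĝ^{≥ n}` over a chart. -/
def Completed (C : M.Chart) : Type u := UniformSpace.Completion (ChartEnv 𝔤 κ C)

instance (C : M.Chart) : UniformSpace (Completed 𝔤 κ C) :=
  inferInstanceAs (UniformSpace (UniformSpace.Completion (ChartEnv 𝔤 κ C)))

instance (C : M.Chart) : Ring (Completed 𝔤 κ C) :=
  inferInstanceAs (Ring (UniformSpace.Completion (ChartEnv 𝔤 κ C)))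

instance (C : M.Chart) : IsTopologicalRing (Completed 𝔤 κ C) :=
  inferInstanceAs (IsTopologicalRing (UniformSpace.Completion (ChartEnv 𝔤 κ C)))

instance (C : M.Chart) : Algebra (M.A C.W) (Completed 𝔤 κ C) :=
  inferInstanceAs (Algebra (M.A C.W) (UniformSpace.Completion (ChartEnv 𝔤 κ C)))

/-- The completion map. -/
def toCompleted (C : M.Chart) : ChartEnv 𝔤 κ C →+* Completed 𝔤 κ C :=
  UniformSpace.Completion.coeRingHom

/-- The section `X ⊗ f` of `𝒰_κ(ĝ_Σ)`. -/
def gen (C : M.Chart) (X : 𝔤) (f : M.K C.W) : Completed 𝔤 κ C :=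
  toCompleted 𝔤 κ C (chartι 𝔤 κ C (affine X f))

end Completed

section Functoriality

variable (𝔤 : Type u) [LieRing 𝔤] [LieAlgebra ℂ 𝔤] (κ : LinearMap.BilinForm ℂ 𝔤)
  {M M' M'' : MarkedCurve} (m : Collapse M' M) {W : M.S.Opens} {W' : M'.S.Opens}
  (h : W' ≤ m.f ⁻¹ᵁ W)

/-- Pullback of functions, as a linear map. -/
def puncturedLinear : M.K W →ₗ[ℂ] M'.K W' where
  toFun := m.punctured h
  map_add' := map_add _
  map_smul' c f := by
    rw [Algebra.smul_def, map_mul, Collapse.punctured_algebraMap_complex, ← Algebra.smul_def]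
    rfl

/-- `X ⊗ f + a 𝟏 ↦ X ⊗ f' + a' 𝟏` with `f'`, `a'` the pullbacks of `f`, `a`. -/
def affineMap : Affine 𝔤 M W →+ Affine 𝔤 M' W' :=
  AddMonoidHom.prodMap (TensorProduct.map (puncturedLinear m h) LinearMap.id).toAddMonoidHom
    (m.base h).toAddMonoidHom

theorem affineMap_affine (X : 𝔤) (f : M.K W) :
    affineMap 𝔤 m h (affine X f) = affine X (m.punctured h f) :=
  Prod.ext rfl (map_zero (m.base h))

theorem affineMap_central (a : M.A W) :
    affineMap 𝔤 m h (central 𝔤 a) = central 𝔤 (m.base h a) :=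
  Prod.ext (map_zero (TensorProduct.map (puncturedLinear m h) LinearMap.id)) rfl

theorem affineMap_smul (a : M.A W) (x : Affine 𝔤 M W) :
    affineMap 𝔤 m h (a • x) = m.base h a • affineMap 𝔤 m h x := by
  induction x using affine_induction with
  | hc b =>
    have e : ∀ {N : MarkedCurve} {V : N.S.Opens} (a b : N.A V),
        a • (central 𝔤 b : Affine 𝔤 N V) = central 𝔤 (a * b) :=
      fun a b => Prod.ext (smul_zero a) rfl
    rw [e, affineMap_central, affineMap_central, e, map_mul]
  | ha X f =>
    have e : ∀ {N : MarkedCurve} {V : N.S.Opens} (a : N.A V) (f : N.K V),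
        a • (affine X f : Affine 𝔤 N V) = affine X (algebraMap _ _ a * f) := fun a f =>
      Prod.ext ((TensorProduct.smul_tmul' a f X).trans (by rw [Algebra.smul_def]; rfl))
        (smul_zero a)
    rw [e, affineMap_affine, affineMap_affine, e, map_mul, Collapse.punctured_algebraMap_base]
  | hadd x y hx hy => rw [smul_add, map_add, hx, hy, map_add, smul_add]

/-- The tensor algebra part of the functoriality. -/
def tensorsMap : Tensors 𝔤 M W →+* Env 𝔤 κ M' W' :=
  letI : Algebra (M.A W) (Env 𝔤 κ M' W') := Algebra.compHom _ (m.base h)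
  (TensorAlgebra.lift (M.A W)
    ({ toFun := fun x => envι 𝔤 κ M' W' (affineMap 𝔤 m h x)
       map_add' := fun x y => by rw [map_add, map_add]
       map_smul' := fun a x => by
        rw [affineMap_smul, map_smul]
        rfl } : Affine 𝔤 M W →ₗ[M.A W] Env 𝔤 κ M' W')).toRingHom

theorem tensorsMap_ι (x : Affine 𝔤 M W) :
    tensorsMap 𝔤 κ m h (tι 𝔤 M W x) = envι 𝔤 κ M' W' (affineMap 𝔤 m h x) :=
  letI : Algebra (M.A W) (Env 𝔤 κ M' W') := Algebra.compHom _ (m.base h)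
  TensorAlgebra.lift_ι_apply _ x

theorem tensorsMap_rel {x y : Tensors 𝔤 M W} (hxy : EnvRel 𝔤 κ M W x y) :
    tensorsMap 𝔤 κ m h x = tensorsMap 𝔤 κ m h y := by
  cases hxy with
  | bracket X Y f g c hc =>
    simp only [map_sub, map_mul, map_add, tensorsMap_ι, affineMap_affine, affineMap_central]
    rw [envι_bracket X Y _ _ _ (hc.map m h), envι_level]
    congr 2
    rw [Algebra.smul_def, Algebra.smul_def, map_mul, Collapse.base_algebraMap]
  | central x =>
    simp only [map_sub, map_mul, tensorsMap_ι, affineMap_central, map_zero]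
    rw [envι_level, sub_eq_zero]
    exact Algebra.commutes _ _
  | level =>
    rw [tensorsMap_ι, affineMap_central, envι_level, map_one, map_one, map_one]

/-- Pullback of sections of `U¹`. -/
def envMap : Env 𝔤 κ M W →+* Env 𝔤 κ M' W' :=
  RingQuot.lift ⟨tensorsMap 𝔤 κ m h, fun _ _ hxy => tensorsMap_rel 𝔤 κ m h hxy⟩

theorem envMap_ι (x : Affine 𝔤 M W) :
    envMap 𝔤 κ m h (envι 𝔤 κ M W x) = envι 𝔤 κ M' W' (affineMap 𝔤 m h x) := by
  have := RingQuot.lift_mkRingHom_apply (r := EnvRel 𝔤 κ M W) (tensorsMap 𝔤 κ m h)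
    (fun _ _ hxy => tensorsMap_rel 𝔤 κ m h hxy) (tι 𝔤 M W x)
  rw [← tensorsMap_ι, ← this, ← RingQuot.mkAlgHom_coe (M.A W)]
  rfl

theorem envMap_algebraMap (a : M.A W) :
    envMap 𝔤 κ m h (algebraMap _ _ a) = algebraMap _ _ (m.base h a) := by
  rw [← envι_level, envMap_ι, affineMap_central, envι_level]

theorem envMap_nhd {n : ℕ} {a : Env 𝔤 κ M W} (ha : a ∈ envNhd 𝔤 κ M W n) :
    envMap 𝔤 κ m h a ∈ envNhd 𝔤 κ M' W' n := by
  suffices envNhd 𝔤 κ M W n ≤ (envNhd 𝔤 κ M' W' n).comap (envMap 𝔤 κ m h) from this ha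
  refine Ideal.span_le.2 ?_
  rintro _ ⟨x, hx, X, rfl⟩
  refine Ideal.subset_span ⟨m.formal h x, m.formal_mem_van h hx, X, ?_⟩
  rw [envMap_ι, affineMap_affine, Collapse.punctured_algebraMap]

theorem envMap_refl (h : W ≤ (Collapse.refl M).f ⁻¹ᵁ W) (a : Env 𝔤 κ M W) :
    envMap 𝔤 κ (Collapse.refl M) h a = a := by
  induction a using env_induction with
  | halg a => rw [envMap_algebraMap, Collapse.base_refl]
  | hι X f => rw [envMap_ι, affineMap_affine, Collapse.punctured_refl]
  | hmul a b ha hb => rw [map_mul, ha, hb]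
  | hadd a b ha hb => rw [map_add, ha, hb]

theorem envMap_comp (m : Collapse M' M) (m' : Collapse M'' M') {W'' : M''.S.Opens}
    (h : W' ≤ m.f ⁻¹ᵁ W) (h' : W'' ≤ m'.f ⁻¹ᵁ W') (h'' : W'' ≤ (m.comp m').f ⁻¹ᵁ W)
    (a : Env 𝔤 κ M W) :
    envMap 𝔤 κ (m.comp m') h'' a = envMap 𝔤 κ m' h' (envMap 𝔤 κ m h a) := by
  induction a using env_induction with
  | halg a => rw [envMap_algebraMap, envMap_algebraMap, envMap_algebraMap, Collapse.base_comp]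
  | hι X f => 
    rw [envMap_ι, envMap_ι, envMap_ι, affineMap_affine, affineMap_affine, affineMap_affine,
      Collapse.punctured_comp]
  | hmul a b ha hb => rw [map_mul, ha, hb, map_mul, map_mul]
  | hadd a b ha hb => rw [map_add, ha, hb, map_add, map_add]

end Functoriality

/-- Restriction of functions on the base. -/
def MarkedCurve.restrict (M : MarkedCurve) {C C' : M.Chart} (h : C' ≤ C) :
    M.A C.W →+* M.A C'.W := (Collapse.refl M).base (W := C.W) (W' := C'.W) h

/-- A sheaf of topological `𝒪_S`-algebras, given by its sections over the charts. -/
structure ChartAlgebra (M : MarkedCurve) : Type (u + 1) where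
  obj : M.Chart → Type u
  [ring : ∀ C, Ring (obj C)]
  [algebra : ∀ C, Algebra (M.A C.W) (obj C)]
  [topology : ∀ C, TopologicalSpace (obj C)]
  [isTopologicalRing : ∀ C, IsTopologicalRing (obj C)]
  res : ∀ {C C' : M.Chart}, C' ≤ C → obj C →+* obj C'
  continuous_res : ∀ {C C' : M.Chart} (h : C' ≤ C), Continuous (res h)
  res_algebraMap : ∀ {C C' : M.Chart} (h : C' ≤ C) (a : M.A C.W),
    res h (algebraMap _ _ a) = algebraMap _ _ (M.restrict h a)
  res_refl : ∀ (C : M.Chart) (x : obj C), res (le_refl C) x = x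
  res_comp : ∀ {C C' C'' : M.Chart} (h : C' ≤ C) (h' : C'' ≤ C') (x : obj C),
    res (h'.trans h) x = res h' (res h x)

attribute [instance] ChartAlgebra.ring ChartAlgebra.algebra ChartAlgebra.topology
  ChartAlgebra.isTopologicalRing

section Enveloping

variable (𝔤 : Type u) [LieRing 𝔤] [LieAlgebra ℂ 𝔤] (κ : LinearMap.BilinForm ℂ 𝔤)
  {M M' M'' : MarkedCurve}

/-- Pullback of sections of `U¹`, over charts. -/
def chartEnvMap (m : Collapse M' M) {C : M.Chart} {C' : M'.Chart} (h : C'.W ≤ m.f ⁻¹ᵁ C.W) :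
    ChartEnv 𝔤 κ C →+* ChartEnv 𝔤 κ C' := envMap 𝔤 κ m h

theorem continuous_chartEnvMap (m : Collapse M' M) {C : M.Chart} {C' : M'.Chart}
    (h : C'.W ≤ m.f ⁻¹ᵁ C.W) : Continuous (chartEnvMap 𝔤 κ m h) := by
  refine continuous_of_continuousAt_zero (chartEnvMap 𝔤 κ m h) ?_
  rw [ContinuousAt, map_zero]
  refine ((chartNhd_basis 𝔤 κ C).hasBasis_nhds_zero.tendsto_iff
    (chartNhd_basis 𝔤 κ C').hasBasis_nhds_zero).2 fun n _ => ⟨n, trivial, fun x hx => ?_⟩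
  exact envMap_nhd 𝔤 κ m h hx

/-- Pullback of sections of the completed enveloping algebra. -/
def completedMap (m : Collapse M' M) {C : M.Chart} {C' : M'.Chart} (h : C'.W ≤ m.f ⁻¹ᵁ C.W) :
    Completed 𝔤 κ C →+* Completed 𝔤 κ C' :=
  UniformSpace.Completion.mapRingHom (chartEnvMap 𝔤 κ m h) (continuous_chartEnvMap 𝔤 κ m h)

theorem continuous_completedMap (m : Collapse M' M) {C : M.Chart} {C' : M'.Chart}
    (h : C'.W ≤ m.f ⁻¹ᵁ C.W) : Continuous (completedMap 𝔤 κ m h) :=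
  UniformSpace.Completion.continuous_map

theorem completedMap_toCompleted (m : Collapse M' M) {C : M.Chart} {C' : M'.Chart}
    (h : C'.W ≤ m.f ⁻¹ᵁ C.W) (a : ChartEnv 𝔤 κ C) :
    completedMap 𝔤 κ m h (toCompleted 𝔤 κ C a) = toCompleted 𝔤 κ C' (chartEnvMap 𝔤 κ m h a) :=
  UniformSpace.Completion.mapRingHom_coe (continuous_chartEnvMap 𝔤 κ m h) a

theorem completed_induction {C : M.Chart} {P : Completed 𝔤 κ C → Prop}
    (hP : IsClosed {x | P x}) (h : ∀ a, P (toCompleted 𝔤 κ C a)) (x : Completed 𝔤 κ C) : P x :=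
  UniformSpace.Completion.induction_on x hP h

instance (C : M.Chart) : T2Space (Completed 𝔤 κ C) :=
  inferInstanceAs (T2Space (UniformSpace.Completion (ChartEnv 𝔤 κ C)))

theorem completedMap_refl {C : M.Chart} (h : C.W ≤ (Collapse.refl M).f ⁻¹ᵁ C.W)
    (x : Completed 𝔤 κ C) : completedMap 𝔤 κ (Collapse.refl M) h x = x := by
  refine completed_induction 𝔤 κ (isClosed_eq (continuous_completedMap 𝔤 κ _ _) continuous_id)
    (fun a => ?_) x
  refine (completedMap_toCompleted 𝔤 κ _ _ _).trans ?_
  exact congrArg (toCompleted 𝔤 κ C) (envMap_refl 𝔤 κ _ a)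

theorem completedMap_comp (m : Collapse M' M) (m' : Collapse M'' M') {C : M.Chart} {C' : M'.Chart}
    {C'' : M''.Chart} (h : C'.W ≤ m.f ⁻¹ᵁ C.W) (h' : C''.W ≤ m'.f ⁻¹ᵁ C'.W)
    (h'' : C''.W ≤ (m.comp m').f ⁻¹ᵁ C.W) (x : Completed 𝔤 κ C) :
    completedMap 𝔤 κ (m.comp m') h'' x = completedMap 𝔤 κ m' h' (completedMap 𝔤 κ m h x) := by
  refine completed_induction 𝔤 κ (isClosed_eq (continuous_completedMap 𝔤 κ _ _)
    ((continuous_completedMap 𝔤 κ _ _).comp (continuous_completedMap 𝔤 κ _ _)))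
    (fun a => ?_) x
  simp only [Function.comp_apply, completedMap_toCompleted]
  exact congrArg (toCompleted 𝔤 κ C'') (envMap_comp 𝔤 κ m m' h h' h'' a)

/-- The sheaf `𝒰_κ(ĝ_Σ)`. -/
def envelope (M : MarkedCurve) : ChartAlgebra.{u} M where
  obj := Completed 𝔤 κ
  res {C C'} h := completedMap 𝔤 κ (Collapse.refl M) (C := C) (C' := C') h
  continuous_res h := continuous_completedMap 𝔤 κ (Collapse.refl M) h
  res_algebraMap {C C'} h a :=
    (completedMap_toCompleted 𝔤 κ (Collapse.refl M) (C := C) (C' := C') h _).trans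
      (congrArg (toCompleted 𝔤 κ C') (envMap_algebraMap 𝔤 κ (Collapse.refl M) h a))
  res_refl _ x := completedMap_refl 𝔤 κ _ x
  res_comp h h' x :=
    completedMap_comp 𝔤 κ (Collapse.refl M) (Collapse.refl M) h h' (h'.trans h) x

end Enveloping

namespace ChartAlgebra

variable {M : MarkedCurve} (𝒜 : ChartAlgebra.{u} M)

/-- The sections over a chart of the sheaf-theoretic center: the sections whose bracket with every
section over every smaller chart vanishes. -/
def centerSections (C : M.Chart) : Subalgebra (M.A C.W) (𝒜.obj C) where
  carrier := {z | ∀ (C' : M.Chart) (h : C' ≤ C) (a : 𝒜.obj C'), 𝒜.res h z * a = a * 𝒜.res h z}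
  mul_mem' {x y} hx hy C' h a := by
    rw [map_mul, mul_assoc, hy, ← mul_assoc, hx, mul_assoc]
  add_mem' {x y} hx hy C' h a := by rw [map_add, add_mul, mul_add, hx, hy]
  algebraMap_mem' r C' h a := by rw [𝒜.res_algebraMap, Algebra.commutes]

theorem res_mem_centerSections {C C' : M.Chart} (h : C' ≤ C) {z : 𝒜.obj C}
    (hz : z ∈ 𝒜.centerSections C) : 𝒜.res h z ∈ 𝒜.centerSections C' := by
  intro C'' h' a
  rw [← 𝒜.res_comp]
  exact hz C'' (h'.trans h) a

/-- The center of a sheaf of topological algebras, with the subspace topology. -/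
def center : ChartAlgebra.{u} M where
  obj C := 𝒜.centerSections C
  ring C := (𝒜.centerSections C).toRing
  algebra C := (𝒜.centerSections C).algebra
  topology _ := instTopologicalSpaceSubtype
  isTopologicalRing C := inferInstanceAs (IsTopologicalRing (𝒜.centerSections C).toSubring)
  res {C C'} h := ((𝒜.res h).comp (𝒜.centerSections C).val.toRingHom).codRestrict
    (𝒜.centerSections C').toSubring fun z => 𝒜.res_mem_centerSections h z.2
  continuous_res h := ((𝒜.continuous_res h).comp continuous_subtype_val).subtype_mk _
  res_algebraMap h a := Subtype.ext (𝒜.res_algebraMap h a)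
  res_refl C x := Subtype.ext (𝒜.res_refl C x.1)
  res_comp h h' x := Subtype.ext (𝒜.res_comp h h' x.1)

/-- The inclusion of the center. -/
def centerIncl (C : M.Chart) : 𝒜.center.obj C →ₐ[M.A C.W] 𝒜.obj C := (𝒜.centerSections C).val

/-- The sections over every chart are complete and separated, and have a neighbourhood basis of
zero consisting of left ideals (thus of `𝒪_S`-submodules). -/
def IsComplete : Prop :=
  ∀ C : M.Chart, T2Space (𝒜.obj C) ∧
    @CompleteSpace (𝒜.obj C) (IsTopologicalAddGroup.rightUniformSpace (𝒜.obj C)) ∧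
    IsLinearTopology (𝒜.obj C) (𝒜.obj C)

end ChartAlgebra

/-- A surjection `J ↠ I`, presented by its fibres `J_i = part i`. -/
structure Partition (J I : Type) where
  part : I → Type
  [fintype : ∀ i, Fintype (part i)]
  [nonempty : ∀ i, Nonempty (part i)]
  incl : ∀ i, part i → J
  bijective : Function.Bijective fun x : (Σ i, part i) => incl x.1 x.2

attribute [instance] Partition.fintype Partition.nonempty

namespace Partition

variable {J I : Type}

theorem incl_injective (P : Partition J I) (i : I) : Function.Injective (P.incl i) :=
  fun a b hab => by
    have := P.bijective.1 (a₁ := ⟨i, a⟩) (a₂ := ⟨i, b⟩) hab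
    simpa using this

/-- The surjection `K ↠ J` obtained from `K ↠ I` and from surjections `K_i ↠ J_i`, where `J` is the
disjoint union of the `J_i`. -/
abbrev refine (P : Partition J I) {L : I → Type} (Q : ∀ i, Partition (P.part i) (L i)) :
    Partition J (Σ i, L i) where
  part l := (Q l.1).part l.2
  incl l a := P.incl l.1 ((Q l.1).incl l.2 a)
  bijective := by
    constructor
    · rintro ⟨⟨i, l⟩, a⟩ ⟨⟨i', l'⟩, a'⟩ h
      have h1 := P.bijective.1 (a₁ := ⟨i, (Q i).incl l a⟩) (a₂ := ⟨i', (Q i').incl l' a'⟩) h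
      obtain ⟨rfl, h2⟩ := Sigma.mk.inj h1
      have h3 := (Q i).bijective.1 (a₁ := ⟨l, a⟩) (a₂ := ⟨l', a'⟩) (eq_of_heq h2)
      obtain ⟨rfl, h4⟩ := Sigma.mk.inj h3
      obtain rfl := eq_of_heq h4
      rfl
    · intro j
      obtain ⟨⟨i, b⟩, rfl⟩ := P.bijective.2 j
      obtain ⟨⟨l, a⟩, rfl⟩ := (Q i).bijective.2 b
      exact ⟨⟨⟨i, l⟩, a⟩, rfl⟩

/-- `W` is a chart for the whole family and for each subfamily `Σ_{J_i}`, and is contained in the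
open subset `U_{J/I}` where sections in different blocks are disjoint. -/
structure IsSeparating {M : MarkedCurve} (P : Partition M.J I) (W : M.S.Opens) : Prop where
  whole : M.IsChart W
  part : ∀ i, (M.sub (P.incl i)).IsChart W
  separated : ∀ i i', i ≠ i' → ∀ (a : P.part i) (a' : P.part i'), ∀ x ∈ W,
    M.σ (P.incl i a) x ≠ M.σ (P.incl i' a') x

end Partition

/-- Given `K ↠ J ↠ I` and a family of `K` sections collapsing to a family of `J` sections, the
subfamily of `K_i` sections collapses to the subfamily of `J_i` sections. -/
def Collapse.part {M' M : MarkedCurve} (m : Collapse M' M) {I : Type} (P : Partition M.J I)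
    (P' : Partition M'.J I) (c : ∀ i, P.part i → P'.part i)
    (hc : ∀ i a, m.π (P.incl i a) = P'.incl i (c i a)) (i : I) :
    Collapse (M'.sub (P'.incl i)) (M.sub (P.incl i)) where
  f := m.f
  F := m.F
  isPullback := m.isPullback
  str := m.str
  π := c i
  π_surj b := by
    obtain ⟨j, hj⟩ := m.π_surj (P'.incl i b)
    obtain ⟨⟨k, a⟩, rfl⟩ := P.bijective.2 j
    have h : P'.incl k (c k a) = P'.incl i b := (hc k a).symm.trans hj
    have h1 := P'.bijective.1 (a₁ := ⟨k, c k a⟩) (a₂ := ⟨i, b⟩) h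
    obtain ⟨rfl, h2⟩ := Sigma.mk.inj h1
    exact ⟨a, eq_of_heq h2⟩
  comm a := by
    have h := m.comm (P.incl i a)
    rw [hc] at h
    exact h

/-- The topology of `⨂^!` before completion: neighbourhoods of zero are spanned by the pure tensors
having some factor in a given open submodule. -/
@[reducible]
def bangTopology {I : Type} (R : Type) [CommRing R] (B : I → Type u) [∀ i, Ring (B i)]
    [∀ i, Algebra R (B i)] [∀ i, TopologicalSpace (B i)] : TopologicalSpace (⨂[R] i, B i) :=
  ⨅ (N : ∀ i, Submodule R (B i)) (_ : ∀ i, IsOpen (N i : Set (B i))),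
    TopologicalSpace.induced
      (Submodule.mkQ (Submodule.span R
        {z : ⨂[R] i, B i | ∃ b : ∀ i, B i, (∃ i, b i ∈ N i) ∧ z = PiTensorProduct.tprod R b})) ⊥

instance {M : MarkedCurve} {J' : Type} [Fintype J'] {e : J' → M.J}
    (ℬ : ChartAlgebra.{u} (M.sub e)) {W : M.S.Opens} (h : (M.sub e).IsChart W) :
    Algebra (M.A W) (ℬ.obj ⟨W, h⟩) := ℬ.algebra ⟨W, h⟩

/-- The `!`-tensor product of the sections over `W` of the algebras of the subfamilies `Σ_{J_i}`,
before completion. -/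
abbrev BangTensor (𝒜 : ∀ M : MarkedCurve, ChartAlgebra.{u} M) {M : MarkedCurve} {I : Type}
    {P : Partition M.J I} {W : M.S.Opens} (hW : P.IsSeparating W) : Type u :=
  ⨂[M.A W] i, (𝒜 (M.sub (P.incl i))).obj ⟨W, hW.part i⟩

/-- The structure of a pseudo-factorization algebra on a family of sheaves of topological
algebras: the morphisms `Ran` and `fact`, continuous and linear over `𝒪`, natural in the base, and
the three compatibility conditions `Ran ∘ Ran`, `fact ∘ fact` and `Ran ∘ fact`. For a surjection
`J ↠ I` with fibres `J_i`, the morphism `Ran` goes from the pullback of `𝒜(Σ_J)` to `V_{J/I}` to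
`𝒜(Σ_I)`, and it is given on all schemes over `V_{J/I}`, that is on all collapses; `fact` goes
from the `!`-tensor product of the `𝒜(Σ_{J_i})` to `𝒜(Σ_J)` over `U_{J/I}`. -/
structure PseudoFactorization (𝒜 : ∀ M : MarkedCurve, ChartAlgebra.{u} M) : Type (u + 1) where
  ran : ∀ {M' M : MarkedCurve} (m : Collapse M' M) {C : M.Chart} {C' : M'.Chart},
    C'.W ≤ m.f ⁻¹ᵁ C.W → (𝒜 M).obj C →+* (𝒜 M').obj C'
  continuous_ran : ∀ {M' M : MarkedCurve} (m : Collapse M' M) {C : M.Chart} {C' : M'.Chart}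
    (h : C'.W ≤ m.f ⁻¹ᵁ C.W), Continuous (ran m h)
  ran_algebraMap : ∀ {M' M : MarkedCurve} (m : Collapse M' M) {C : M.Chart} {C' : M'.Chart}
    (h : C'.W ≤ m.f ⁻¹ᵁ C.W) (a : M.A C.W),
    ran m h (algebraMap _ _ a) = algebraMap (M'.A C'.W) _ (m.base h a)
  ran_refl : ∀ {M : MarkedCurve} {C C' : M.Chart} (h : C' ≤ C) (x : (𝒜 M).obj C),
    ran (Collapse.refl M) h x = (𝒜 M).res h x
  ran_comp : ∀ {M'' M' M : MarkedCurve} (m : Collapse M' M) (m' : Collapse M'' M')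
    {C : M.Chart} {C' : M'.Chart} {C'' : M''.Chart} (h : C'.W ≤ m.f ⁻¹ᵁ C.W)
    (h' : C''.W ≤ m'.f ⁻¹ᵁ C'.W) (h'' : C''.W ≤ (m.comp m').f ⁻¹ᵁ C.W) (x : (𝒜 M).obj C),
    ran (m.comp m') h'' x = ran m' h' (ran m h x)
  fact : ∀ {M : MarkedCurve} {I : Type} [Fintype I] (P : Partition M.J I) {W : M.S.Opens}
    (hW : P.IsSeparating W), BangTensor 𝒜 hW →ₐ[M.A W] (𝒜 M).obj ⟨W, hW.whole⟩
  continuous_fact : ∀ {M : MarkedCurve} {I : Type} [Fintype I] (P : Partition M.J I)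
    {W : M.S.Opens} (hW : P.IsSeparating W),
    @Continuous (BangTensor 𝒜 hW) ((𝒜 M).obj ⟨W, hW.whole⟩)
      (bangTopology (M.A W) fun i => (𝒜 (M.sub (P.incl i))).obj ⟨W, hW.part i⟩) _ (fact P hW)
  fact_refine : ∀ {M : MarkedCurve} {I : Type} [Fintype I] {L : I → Type} [∀ i, Fintype (L i)]
    (P : Partition M.J I) (Q : ∀ i, Partition (P.part i) (L i)) {W : M.S.Opens}
    (hP : P.IsSeparating W)
    (hQ : ∀ i, Partition.IsSeparating (M := M.sub (P.incl i)) (Q i) W)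
    (hPQ : (P.refine Q).IsSeparating W)
    (a : ∀ l : (Σ i, L i), (𝒜 (M.sub ((P.refine Q).incl l))).obj ⟨W, hPQ.part l⟩),
    fact (P.refine Q) hPQ (PiTensorProduct.tprod (M.A W) a) =
      fact P hP (PiTensorProduct.tprod (M.A W) fun i =>
        fact (M := M.sub (P.incl i)) (Q i) (hQ i)
          (PiTensorProduct.tprod (M.A W) fun l => a ⟨i, l⟩))
  ran_fact : ∀ {M' M : MarkedCurve} (m : Collapse M' M) {I : Type} [Fintype I]
    (P : Partition M.J I) (P' : Partition M'.J I) (c : ∀ i, P.part i → P'.part i)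
    (hc : ∀ i a, m.π (P.incl i a) = P'.incl i (c i a)) {W : M.S.Opens} {W' : M'.S.Opens}
    (hW : P.IsSeparating W) (hW' : P'.IsSeparating W') (h : W' ≤ m.f ⁻¹ᵁ W)
    (a : ∀ i, (𝒜 (M.sub (P.incl i))).obj ⟨W, hW.part i⟩),
    ran m (C := ⟨W, hW.whole⟩) (C' := ⟨W', hW'.whole⟩) h
        (fact P hW (PiTensorProduct.tprod (M.A W) a)) =
      fact P' hW' (PiTensorProduct.tprod (M'.A W') fun i =>
        ran (m.part P P' c hc i) (C := ⟨W, hW.part i⟩) (C' := ⟨W', hW'.part i⟩) h (a i))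

/-- The identity of the curve, as a morphism from the subfamily `Σ_{J_i}` to the family `Σ_J`. -/
def Partition.toMap {M : MarkedCurve} {I : Type} (P : Partition M.J I) (i : I) :
    MarkedMap (M.sub (P.incl i)) M where
  f := 𝟙 _
  F := 𝟙 _
  comm := by simp
  str := by simp
  sel := ⟨P.incl i, P.incl_injective i, fun j => by simp⟩

/-- The map from functions on the formal neighbourhood of `Σ_J` to those on that of `Σ_{J_i}`. -/
def Partition.toPart {M : MarkedCurve} {I : Type} (P : Partition M.J I) (i : I) (W : M.S.Opens) :
    M.R W →+* (M.sub (P.incl i)).R W :=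
  (P.toMap i).formal (W := W) (W' := W) (le_refl W)

/-- The function `g` on the punctured formal neighbourhood of `Σ_J`, written `a / s`, is the
extension by zero of the function `f` on that of `Σ_{J_i}`. -/
def Partition.IsExtension {M : MarkedCurve} {I : Type} (P : Partition M.J I) (i : I)
    {W : M.S.Opens} (f : (M.sub (P.incl i)).K W) (g : M.K W) : Prop :=
  ∃ a : M.R W, ∃ s ∈ M.off W,
    g * algebraMap (M.R W) (M.K W) s = algebraMap (M.R W) (M.K W) a ∧
    f * algebraMap _ ((M.sub (P.incl i)).K W) (P.toPart i W s) =
      algebraMap _ ((M.sub (P.incl i)).K W) (P.toPart i W a) ∧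
    ∀ k, k ≠ i → P.toPart k W a = 0

section Main

variable {𝔤 : Type u} [LieRing 𝔤] [LieAlgebra ℂ 𝔤] {κ : LinearMap.BilinForm ℂ 𝔤}

/-- The natural factorization structure of `𝒰_κ(ĝ_Σ)`: `Ran` sends `X ⊗ f` to `X ⊗ f'` where `f'`
is the pullback of `f`, and `fact` sends the tensor product of `X ⊗ f` in the factor `i` with the
units of the other factors to `X ⊗ g` where `g` is the extension by zero of `f`. -/
structure IsNatural (F : PseudoFactorization (envelope 𝔤 κ)) : Prop where
  ran : ∀ {M' M : MarkedCurve} (m : Collapse M' M) {C : M.Chart} {C' : M'.Chart}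
    (h : C'.W ≤ m.f ⁻¹ᵁ C.W) (X : 𝔤) (f : M.K C.W),
    F.ran m h (gen 𝔤 κ C X f) = gen 𝔤 κ C' X (m.punctured h f)
  fact : ∀ {M : MarkedCurve} {I : Type} [Fintype I] (P : Partition M.J I) {W : M.S.Opens}
    (hW : P.IsSeparating W) (i : I) (X : 𝔤) (f : (M.sub (P.incl i)).K W) (g : M.K W)
    (_ : P.IsExtension i f g)
    (a : ∀ k, (envelope 𝔤 κ (M.sub (P.incl k))).obj ⟨W, hW.part k⟩),
    a i = gen 𝔤 κ (M := M.sub (P.incl i)) ⟨W, hW.part i⟩ X f → (∀ k, k ≠ i → a k = 1) →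
    F.fact P hW (PiTensorProduct.tprod (M.A W) a) = gen 𝔤 κ ⟨W, hW.whole⟩ X g

variable (𝔤 κ) in
/-- The center `Z_κ(ĝ_Σ)`. -/
def envelopeCenter (M : MarkedCurve) : ChartAlgebra.{u} M := (envelope 𝔤 κ M).center

/-- The structure `G` on the centers is induced by the structure `F` on `𝒰_κ(ĝ_Σ)`: the inclusion
of the centers intertwines the morphisms `Ran` and `fact` of `G` and `F`. -/
structure Induces (F : PseudoFactorization (envelope 𝔤 κ))
    (G : PseudoFactorization (envelopeCenter 𝔤 κ)) : Prop where
  ran : ∀ {M' M : MarkedCurve} (m : Collapse M' M) {C : M.Chart} {C' : M'.Chart}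
    (h : C'.W ≤ m.f ⁻¹ᵁ C.W) (z : (envelopeCenter 𝔤 κ M).obj C),
    (envelope 𝔤 κ M').centerIncl C' (G.ran m h z) =
      F.ran m h ((envelope 𝔤 κ M).centerIncl C z)
  fact : ∀ {M : MarkedCurve} {I : Type} [Fintype I] (P : Partition M.J I) {W : M.S.Opens}
    (hW : P.IsSeparating W)
    (z : ∀ i, (envelopeCenter 𝔤 κ (M.sub (P.incl i))).obj ⟨W, hW.part i⟩),
    (envelope 𝔤 κ M).centerIncl ⟨W, hW.whole⟩
        (G.fact P hW (PiTensorProduct.tprod (M.A W) z)) =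
      F.fact P hW (PiTensorProduct.tprod (M.A W) fun i =>
        (envelope 𝔤 κ (M.sub (P.incl i))).centerIncl ⟨W, hW.part i⟩ (z i))

end Main

end FactorizableCenter

end

open AlgebraicGeometry CategoryTheory TensorProduct TopologicalSpace

noncomputable section

namespace FactorizableCenter

/-! A continuous morphism from `𝒰_κ(ĝ_Σ)` to a Hausdorff algebra is determined by its values on
`𝒪_S` and on the elements `X ⊗ f`, because these generate a dense subalgebra (`completed_hom_ext`).
This gives the uniqueness of `Ran`, and that of `fact` after restriction to the single factors of
the tensor product. As for existence, `Ran` is pullback of functions, and the substance lies in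
`fact`.

Where the blocks of sections are disjoint, their ideals are pairwise comaximal. By the Chinese
remainder theorem the formal neighbourhood of `Σ_J` is then the disjoint union of those of the
`Σ_{J_i}` (`Splits.toPart_injective`, `Splits.exists_toPart_eq`). Extension by zero is therefore
well defined, additive and multiplicative, it keeps orders of vanishing, and extensions from
distinct blocks multiply to zero.

The cocycle must be respected as well. In a coordinate, the equation `F` of `Σ` is a product `E *
H`, where the roots of `E` lie in the block and those of `H` outside it. The extension by zero of `p
/ E^n` has the form `H^n p / F^n`, and the residues agree (`ratResidue_mul`). For two distinct
blocks, the idempotents separating them force the residue to vanish (`ratResidue_eq_zero_of_dvd`).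
Extension by zero thus induces morphisms of completed enveloping algebras, and their images commute
for distinct blocks. The product of these morphisms is `fact`. It is continuous because a factor
lying in a small left ideal can be moved to the right end of the product. The compatibilities are
equalities of homomorphisms, so they are tested on single factors and then on generators.

For the center, density is needed again: up to functions vanishing to high order, a function on the
punctured neighbourhood after a base change is a combination of pullbacks with coefficients in the
new base ring (`Collapse.exists_punctured_approx`). Hence a section commuting with all `X ⊗ f` over
its own chart still commutes with them after restriction and base change (`mem_centerSections_iff`),
and `Ran` preserves the center. Every function is a sum of extensions by zero
(`sum_extend_surjective`), so `fact` preserves the center too. All identities for the center follow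
from injectivity of its inclusion. Finally, the center is cut out by equations between continuous
maps, so it is closed in a complete algebra, and open left ideals restrict to it. -/

theorem id_appLE {X : Scheme.{0}} {U V : X.Opens} (h : V ≤ U) :
    (𝟙 X : X ⟶ X).appLE U V h = X.presheaf.map (homOfLE h).op :=
  Category.id_comp _

/-! ### Local representatives of functions on the infinitesimal neighbourhoods. -/

namespace MarkedCurve

variable (M : MarkedCurve) {W : M.S.Opens}

theorem ideal_finset_prod {X : Scheme.{0}} {ι : Type} (s : Finset ι) (I : ι → X.IdealSheafData)
    (V : X.affineOpens) : (∏ i ∈ s, I i).ideal V = ∏ i ∈ s, (I i).ideal V := by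
  classical
  induction s using Finset.induction_on with
  | empty => simp
  | insert a s ha ih => rw [Finset.prod_insert ha, Finset.prod_insert ha, ← ih]; rfl

theorem idealSheaf_pow_ideal (n : ℕ) (V : M.X.affineOpens) :
    (M.idealSheaf ^ n).ideal V = (∏ j, (M.σ j).ker.ideal V) ^ n := by
  rw [Scheme.IdealSheafData.ideal_pow, Pi.pow_apply, idealSheaf, ideal_finset_prod]

/-- The affine opens of `X` over `W`. -/
abbrev Over (W : M.S.Opens) : Type := {V : M.X.affineOpens // V.1 ≤ M.p ⁻¹ᵁ W}

variable {M}

theorem Over.le (n : ℕ) (V : M.Over W) : M.thickι n ⁻¹ᵁ V.1.1 ≤ M.thickProj n ⁻¹ᵁ W :=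
  fun _ hx => V.2 hx

theorem Over.exists_mem {x : M.X} (hx : M.p x ∈ W) {U : M.X.Opens} (hU : x ∈ U) :
    ∃ V : M.Over W, x ∈ V.1.1 ∧ V.1.1 ≤ U := by
  obtain ⟨_, ⟨V, hV, rfl⟩, hxV, hVU⟩ := M.X.isBasis_affineOpens.exists_subset_of_mem_open
    (show x ∈ (M.p ⁻¹ᵁ W ⊓ U : M.X.Opens) from ⟨hx, hU⟩) (M.p ⁻¹ᵁ W ⊓ U).2
  exact ⟨⟨⟨V, hV⟩, fun y hy => (hVU hy).1⟩, hxV, fun y hy => (hVU hy).2⟩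

/-- Restriction of a function on the `n`-th neighbourhood over `W` to an affine open of `X`. -/
def localRes (n : ℕ) (V : M.Over W) : M.thickRing n W →+* Γ(M.thick n, M.thickι n ⁻¹ᵁ V.1.1) :=
  ((𝟙 (M.thick n) : M.thick n ⟶ M.thick n).appLE _ _ (V.le n)).hom

/-- Restriction of a function on an affine open of `X` to the `n`-th neighbourhood. -/
def localMk (n : ℕ) (V : M.Over W) : Γ(M.X, V.1.1) →+* Γ(M.thick n, M.thickι n ⁻¹ᵁ V.1.1) :=
  ((M.thickι n).appLE V.1.1 _ le_rfl).hom

/-- The function `u` on the affine open `V` of `X` represents `y` there. -/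
def Represents (n : ℕ) (V : M.Over W) (y : M.thickRing n W) (u : Γ(M.X, V.1.1)) : Prop :=
  localRes n V y = localMk n V u

theorem localMk_surjective (n : ℕ) (V : M.Over W) : Function.Surjective (localMk n V) := by
  have := (M.thickι n).app_surjective V.1.1 V.1.2
  rwa [localMk, ← Scheme.Hom.app_eq_appLE]

theorem localMk_eq_zero_iff {n : ℕ} {V : M.Over W} {u : Γ(M.X, V.1.1)} :
    localMk n V u = 0 ↔ u ∈ (M.idealSheaf ^ n).ideal V.1 := by
  rw [← (M.idealSheaf ^ n).ker_subschemeι_app, RingHom.mem_ker, localMk, ← Scheme.Hom.app_eq_appLE]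
  rfl

theorem exists_represents {n : ℕ} (V : M.Over W) (y : M.thickRing n W) :
    ∃ u, Represents n V y u := by
  obtain ⟨u, hu⟩ := localMk_surjective n V (localRes n V y)
  exact ⟨u, hu.symm⟩

/-- The affine opens of `X` over `W` cover the part of the neighbourhood lying over `W`. -/
theorem localRes_jointly_injective {n : ℕ} {y z : M.thickRing n W}
    (h : ∀ V : M.Over W, localRes n V y = localRes n V z) : y = z := by
  apply (M.thick n).sheaf.eq_of_locally_eq' (fun V : M.Over W => M.thickι n ⁻¹ᵁ V.1.1)
    (M.thickProj n ⁻¹ᵁ W) (fun V => homOfLE (V.le n))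
  · intro x hx
    obtain ⟨V, hV, -⟩ := Over.exists_mem (W := W) (x := M.thickι n x) hx (U := ⊤) trivial
    exact TopologicalSpace.Opens.mem_iSup.2 ⟨V, hV⟩
  · intro V
    have := h V
    rw [localRes, id_appLE] at this
    exact this

/-- On an affine open of `X` the `n`-th neighbourhood is the quotient by the `n`-th power of the
ideal of `Σ`, so equality becomes a membership of representatives. Later comparisons on
neighbourhoods are made through this criterion. -/
theorem Represents.eq {n : ℕ} {y z : M.thickRing n W} 
    (h : ∀ V : M.Over W, ∃ u v, Represents n V y u ∧ Represents n V z v ∧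
      u - v ∈ (M.idealSheaf ^ n).ideal V.1) : y = z := by
  refine localRes_jointly_injective fun V => ?_
  obtain ⟨u, v, hu, hv, huv⟩ := h V
  rw [hu, hv, ← sub_eq_zero, ← map_sub]
  exact localMk_eq_zero_iff.2 huv

theorem Represents.sub_mem {n : ℕ} {V : M.Over W} {y : M.thickRing n W} {u v : Γ(M.X, V.1.1)}
    (hu : Represents n V y u) (hv : Represents n V y v) : u - v ∈ (M.idealSheaf ^ n).ideal V.1 := by
  rw [← localMk_eq_zero_iff, map_sub, sub_eq_zero, ← hu, ← hv]

theorem Represents.mem_of_eq_zero {n : ℕ} {V : M.Over W} {u : Γ(M.X, V.1.1)}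
    (hu : Represents n V 0 u) : u ∈ (M.idealSheaf ^ n).ideal V.1 := by
  rw [← localMk_eq_zero_iff, ← hu, map_zero]

theorem represents_zero (n : ℕ) (V : M.Over W) : Represents n V 0 0 := by
  rw [Represents, map_zero, map_zero]

theorem Represents.mul {n : ℕ} {V : M.Over W} {y z : M.thickRing n W} {u v : Γ(M.X, V.1.1)}
    (hu : Represents n V y u) (hv : Represents n V z v) : Represents n V (y * z) (u * v) := by
  rw [Represents, map_mul, map_mul, hu, hv]

theorem Represents.pow {n : ℕ} {V : M.Over W} {y : M.thickRing n W} {u : Γ(M.X, V.1.1)}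
    (hu : Represents n V y u) (k : ℕ) : Represents n V (y ^ k) (u ^ k) := by
  rw [Represents, map_pow, map_pow, hu]

theorem Represents.prod {n : ℕ} {V : M.Over W} {ι : Type} (s : Finset ι)
    {y : ι → M.thickRing n W} {u : ι → Γ(M.X, V.1.1)}
    (h : ∀ i, Represents n V (y i) (u i)) : Represents n V (∏ i ∈ s, y i) (∏ i ∈ s, u i) := by
  rw [Represents, map_prod, map_prod]
  exact Finset.prod_congr rfl fun i _ => h i

theorem Represents.res {n : ℕ} {V : M.Over W} {y : M.thickRing (n + 1) W} {u : Γ(M.X, V.1.1)}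
    (hu : Represents (n + 1) V y u) : Represents n V (M.thickRes n W y) u := by
  have hle : M.thickι n ⁻¹ᵁ V.1.1 ≤ M.thickTrans n ⁻¹ᵁ (M.thickι (n + 1) ⁻¹ᵁ V.1.1) :=
    le_preimage_of_comp_eq (M.thickTrans_ι n) _
  have h1 : localRes n V (M.thickRes n W y) =
      ((M.thickTrans n).appLE _ _ hle).hom (localRes (n + 1) V y) :=
    appLE_square (by simp) _ _ _ _ y
  rw [Represents, h1, hu]
  exact appLE_triangle (M.thickTrans_ι n) _ _ _ u

theorem Represents.restrict {n : ℕ} {V V' : M.Over W} (h : V'.1.1 ≤ V.1.1) {y : M.thickRing n W}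
    {u : Γ(M.X, V.1.1)} (hu : Represents n V y u) :
    Represents n V' y (M.X.presheaf.map (homOfLE h).op u) := by
  have hle : M.thickι n ⁻¹ᵁ V'.1.1 ≤ M.thickι n ⁻¹ᵁ V.1.1 := fun _ hx => h hx
  have h1 : localRes n V' y = ((𝟙 (M.thick n) : M.thick n ⟶ M.thick n).appLE _ _ hle).hom
      (localRes n V y) := (appLE_triangle (by simp) _ _ _ y).symm
  have h2 : M.X.presheaf.map (homOfLE h).op u =
      ((𝟙 M.X : M.X ⟶ M.X).appLE V.1.1 V'.1.1 h).hom u := by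
    rw [id_appLE]
  rw [Represents, h1, hu, h2]
  exact appLE_square (by simp) _ _ _ _ u

theorem lev_res (n : ℕ) (y : M.R W) : M.thickRes n W (M.lev (n + 1) W y) = M.lev n W y := y.2 n

theorem Represents.lev_of_le {n N : ℕ} (h : n ≤ N) {V : M.Over W} {y : M.R W} {u : Γ(M.X, V.1.1)}
    (hu : Represents N V (M.lev N W y) u) : Represents n V (M.lev n W y) u := by
  obtain ⟨i, rfl⟩ := Nat.exists_eq_add_of_le h
  clear h
  induction i with
  | zero => exact hu
  | succ i ih =>
    apply ih
    rw [← lev_res]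
    exact hu.res

/-- `van n` is defined as a kernel and not as a power of `van 1`. The inclusion is seen on
representatives: one lying in the ideal of `Σ` has its `n`-th power in the `n`-th power of that
ideal. -/
theorem van_one_pow_le (n : ℕ) {x : M.R W} (hx : x ∈ M.van 1 W) : x ^ n ∈ M.van n W := by
  rw [van, RingHom.mem_ker, map_pow]
  -- Passing from level `n` down to level `1` needs `1 ≤ n`. At level `0` the ideal is the unit
  -- ideal and everything is zero.
  rcases Nat.eq_zero_or_pos n with rfl | hn
  · refine Represents.eq fun V => ?_
    obtain ⟨u, hu⟩ := exists_represents V (M.lev 0 W x ^ 0)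
    exact ⟨u, 0, hu, represents_zero _ _, by simp⟩
  refine Represents.eq fun V => ?_
  obtain ⟨u, hu⟩ := exists_represents V (M.lev n W x)
  refine ⟨u ^ n, 0, hu.pow n, represents_zero _ _, ?_⟩
  rw [sub_zero, idealSheaf_pow_ideal]
  have h1 : Represents 1 V (M.lev 1 W x) u := hu.lev_of_le hn
  rw [show M.lev 1 W x = 0 from hx] at h1
  have := h1.mem_of_eq_zero
  rw [idealSheaf_pow_ideal, pow_one] at this
  exact Ideal.pow_mem_pow this n

end MarkedCurve

theorem MarkedMap.represents {M' M : MarkedCurve} (m : MarkedMap M' M) {W : M.S.Opens}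
    {W' : M'.S.Opens} (hW : W' ≤ m.f ⁻¹ᵁ W) {n : ℕ} {V : M.Over W} {V' : M'.Over W'}
    (hV : V'.1.1 ≤ m.F ⁻¹ᵁ V.1.1) {y : M.thickRing n W} {u : Γ(M.X, V.1.1)}
    (hu : MarkedCurve.Represents n V y u) :
    MarkedCurve.Represents n V' (m.level hW n y) ((m.F.appLE _ _ hV).hom u) := by
  have hle : M'.thickι n ⁻¹ᵁ V'.1.1 ≤ m.thick n ⁻¹ᵁ (M.thickι n ⁻¹ᵁ V.1.1) :=
    fun x hx => le_preimage_of_comp_eq (m.thick_ι n) V.1.1 (hV hx)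
  have h1 : MarkedCurve.localRes n V' (m.level hW n y) =
      ((m.thick n).appLE _ _ hle).hom (MarkedCurve.localRes n V y) :=
    appLE_square (by simp) _ _ _ _ y
  rw [MarkedCurve.Represents, h1, hu]
  exact appLE_square (m.thick_ι n) _ _ _ _ u

theorem map_map_apply {X : Scheme.{0}} {U V W : X.Opens} (f : V ⟶ U) (g : W ⟶ V) (h : W ⟶ U)
    (a : Γ(X, U)) : (X.presheaf.map g.op).hom ((X.presheaf.map f.op).hom a) =
      (X.presheaf.map h.op).hom a := by
  rw [Subsingleton.elim h (g ≫ f), op_comp, Functor.map_comp]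
  rfl

/-! ### Disjoint sections have comaximal ideals. -/

namespace MarkedCurve

variable {M : MarkedCurve} {W : M.S.Opens}

theorem map_localMk (n : ℕ) {V V' : M.Over W} (h : V'.1.1 ≤ V.1.1) (u : Γ(M.X, V.1.1)) :
    (M.thick n).presheaf.map (homOfLE (show M.thickι n ⁻¹ᵁ V'.1.1 ≤ M.thickι n ⁻¹ᵁ V.1.1 from
      fun _ hx => h hx)).op (localMk n V u) =
      localMk n V' (M.X.presheaf.map (homOfLE h).op u) := by
  rw [← id_appLE, ← id_appLE]
  exact appLE_square (by simp) _ _ _ _ u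

/-- A section of a separated morphism is a closed immersion. Its image is therefore closed, and it
is the support of its ideal. -/
instance (j : M.J) : IsClosedImmersion (M.σ j) := by
  have : IsClosedImmersion (M.σ j ≫ M.p) := by rw [M.σ_p]; infer_instance
  exact IsClosedImmersion.of_comp (M.σ j) M.p

theorem σ_p_apply (j : M.J) (x : M.S) : M.p (M.σ j x) = x := by
  rw [← Scheme.Hom.comp_apply, M.σ_p]; rfl

theorem mem_support_ker {j : M.J} {x : M.X} (hx : x ∈ (M.σ j).ker.support) :
    M.σ j (M.p x) = x := by
  have h : x ∈ closure (Set.range (M.σ j)) := by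
    rw [← (M.σ j).support_ker]; exact hx
  rw [(M.σ j).isClosedEmbedding.isClosed_range.closure_eq] at h
  obtain ⟨s, rfl⟩ := h
  rw [σ_p_apply]

/-- A common zero `x` of the two ideals would be the value of both sections at `p x`, a point of
`W`. So the sum of the ideals has empty zero locus on the affine open `V`. -/
theorem isCoprime_ker_ideal {j j' : M.J} (h : ∀ x ∈ W, M.σ j x ≠ M.σ j' x) (V : M.Over W) :
    IsCoprime ((M.σ j).ker.ideal V.1) ((M.σ j').ker.ideal V.1) := by
  rw [Ideal.isCoprime_iff_sup_eq]
  have h1 : (((M.σ j).ker ⊔ (M.σ j').ker).ideal V.1) = ⊤ := by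
    rw [← PrimeSpectrum.zeroLocus_empty_iff_eq_top]
    refine Set.image_eq_empty.1 ((V.1.2.fromSpec_image_zeroLocus _).trans ?_)
    rw [← Set.not_nonempty_iff_eq_empty]
    rintro ⟨x, hx, hxV⟩
    have hx' := (Scheme.IdealSheafData.mem_support_iff_of_mem hxV).2 hx
    rw [Scheme.IdealSheafData.support_sup] at hx'
    exact h (M.p x) (V.2 hxV) ((mem_support_ker hx'.1).trans (mem_support_ker hx'.2).symm)
  exact h1

end MarkedCurve

/-! ### The Chinese remainder theorem for blocks of sections. -/

namespace Partition

variable {M : MarkedCurve} {I : Type} (P : Partition M.J I) {W : M.S.Opens}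

/-- Over `W`, sections in different blocks are disjoint. -/
def Splits (W : M.S.Opens) : Prop :=
  ∀ i i', i ≠ i' → ∀ (a : P.part i) (a' : P.part i'), ∀ x ∈ W,
    M.σ (P.incl i a) x ≠ M.σ (P.incl i' a') x

/-- The ideal of the block `i`, over an affine open of the curve. -/
def blockIdeal (i : I) (V : M.X.affineOpens) : Ideal Γ(M.X, V.1) :=
  ∏ a, (M.σ (P.incl i a)).ker.ideal V

theorem blockIdeal_pow (i : I) (n : ℕ) (V : M.X.affineOpens) :
    ((M.sub (P.incl i)).idealSheaf ^ n).ideal V = P.blockIdeal i V ^ n :=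
  (M.sub (P.incl i)).idealSheaf_pow_ideal n V

theorem prod_blockIdeal [Fintype I] (n : ℕ) (V : M.X.affineOpens) :
    (M.idealSheaf ^ n).ideal V = ∏ i, P.blockIdeal i V ^ n := by
  rw [M.idealSheaf_pow_ideal, Finset.prod_pow]
  congr 1
  rw [← (Equiv.ofBijective _ P.bijective).prod_comp, Fintype.prod_sigma]
  rfl

variable {P}

theorem Splits.isCoprime (h : P.Splits W) {i i' : I} (hi : i ≠ i') (n : ℕ) (V : M.Over W) :
    IsCoprime (P.blockIdeal i V.1 ^ n) (P.blockIdeal i' V.1 ^ n) :=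
  IsCoprime.pow (IsCoprime.prod_left fun a _ => IsCoprime.prod_right fun a' _ =>
    MarkedCurve.isCoprime_ker_ideal (h i i' hi a a') V)

theorem Splits.prod_eq_iInf [Fintype I] (h : P.Splits W) (n : ℕ) (V : M.Over W) :
    (M.idealSheaf ^ n).ideal V.1 = ⨅ i, P.blockIdeal i V.1 ^ n := by
  rw [P.prod_blockIdeal, Ideal.prod_eq_iInf_of_pairwise_isCoprime]
  · simp
  · exact fun i _ i' _ hi => h.isCoprime hi n V

theorem Splits.exists_sub_mem [Finite I] (h : P.Splits W) (n : ℕ) (V : M.Over W)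
    (u : I → Γ(M.X, V.1.1)) : ∃ v, ∀ i, v - u i ∈ P.blockIdeal i V.1 ^ n := by
  obtain ⟨v, hv⟩ := Ideal.exists_forall_sub_mem_ideal
    (fun i i' (hi : i ≠ i') => h.isCoprime hi n V) u
  exact ⟨v, hv⟩

variable (P) in
/-- Restriction from the `n`-th neighbourhood of `Σ` to that of a block. -/
def toPartLevel (i : I) (n : ℕ) (W : M.S.Opens) :
    M.thickRing n W →+* (M.sub (P.incl i)).thickRing n W :=
  (P.toMap i).level (W := W) (W' := W) (le_refl W) n

theorem lev_toPart (i : I) (n : ℕ) (a : M.R W) :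
    (M.sub (P.incl i)).lev n W (P.toPart i W a) = P.toPartLevel i n W (M.lev n W a) := rfl

theorem represents_toPartLevel (i : I) {n : ℕ} {V : M.Over W} {y : M.thickRing n W}
    {u : Γ(M.X, V.1.1)} (hu : MarkedCurve.Represents n V y u) :
    MarkedCurve.Represents (M := M.sub (P.incl i)) n V (P.toPartLevel i n W y) u := by
  have := (P.toMap i).represents (W := W) (W' := W) (le_refl W) (V := V) (V' := V) (le_refl _) hu
  have h2 := appLE_eq_self (g := (P.toMap i).F) rfl (U := V.1.1) (le_refl _) u
  exact this.trans (congrArg _ h2)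

/-- For comaximal ideals the product is the intersection, so a difference of representatives that
vanishes on every block vanishes on the whole neighbourhood. -/
theorem Splits.toPartLevel_injective [Fintype I] (h : P.Splits W) {n : ℕ} {y z : M.thickRing n W}
    (e : ∀ i, P.toPartLevel i n W y = P.toPartLevel i n W z) : y = z := by
  refine MarkedCurve.Represents.eq fun V => ?_
  obtain ⟨u, hu⟩ := MarkedCurve.exists_represents V y
  obtain ⟨v, hv⟩ := MarkedCurve.exists_represents V z
  refine ⟨u, v, hu, hv, ?_⟩
  rw [h.prod_eq_iInf, Submodule.mem_iInf]
  intro i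
  rw [← blockIdeal_pow]
  refine MarkedCurve.Represents.sub_mem (represents_toPartLevel i hu) ?_
  rw [e]
  exact represents_toPartLevel i hv

/-- On each affine open the Chinese remainder theorem gives a common representative of all the `y
i`. It is unique modulo the `n`-th power of the ideal of `Σ`, so the local solutions glue. -/
theorem Splits.toPartLevel_surjective [Fintype I] (h : P.Splits W) {n : ℕ}
    (y : ∀ i, (M.sub (P.incl i)).thickRing n W) : ∃ z, ∀ i, P.toPartLevel i n W z = y i := by
  have h1 : ∀ V : M.Over W, ∃ u : Γ(M.X, V.1.1), ∀ i,
      MarkedCurve.Represents (M := M.sub (P.incl i)) n V (y i) u := by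
    intro V
    have := fun i => MarkedCurve.exists_represents (M := M.sub (P.incl i)) V (y i)
    choose u hu using this
    obtain ⟨v, hv⟩ := h.exists_sub_mem n V u
    refine ⟨v, fun i => ?_⟩
    have h2 := hv i
    rw [← blockIdeal_pow] at h2
    have h3 := (MarkedCurve.localMk_eq_zero_iff (M := M.sub (P.incl i)) (V := V)).2 h2
    rw [map_sub, sub_eq_zero] at h3
    rw [MarkedCurve.Represents, h3]
    exact hu i
  choose u hu using h1
  have hcov : M.thickProj n ⁻¹ᵁ W ≤ ⨆ V : M.Over W, M.thickι n ⁻¹ᵁ V.1.1 := by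
    intro x hx
    obtain ⟨V, hV, -⟩ := MarkedCurve.Over.exists_mem (W := W) (x := M.thickι n x) hx (U := ⊤) trivial
    exact TopologicalSpace.Opens.mem_iSup.2 ⟨V, hV⟩
  obtain ⟨z, hz, -⟩ := (M.thick n).sheaf.existsUnique_gluing'
    (fun V : M.Over W => M.thickι n ⁻¹ᵁ V.1.1) (M.thickProj n ⁻¹ᵁ W) (fun V => homOfLE (V.le n))
    hcov (fun V => MarkedCurve.localMk n V (u V)) (by
      intro V V'
      -- The overlap is covered by affine opens contained in it; on these, equality is again a
      -- membership in an ideal, tested block by block.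
      apply (M.thick n).sheaf.eq_of_locally_eq'
        (fun V'' : {V'' : M.Over W // V''.1.1 ≤ V.1.1 ⊓ V'.1.1} => M.thickι n ⁻¹ᵁ V''.1.1.1)
        _ (fun V'' => homOfLE (fun x hx => V''.2 hx))
      · intro x hx
        obtain ⟨V'', hV'', hle⟩ := MarkedCurve.Over.exists_mem (W := W) (x := M.thickι n x)
          (V.2 hx.1) (U := V.1.1 ⊓ V'.1.1) hx
        exact TopologicalSpace.Opens.mem_iSup.2 ⟨⟨V'', hle⟩, hV''⟩
      · rintro ⟨V'', hle⟩
        have hV : V''.1.1 ≤ V.1.1 := fun x hx => (hle hx).1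
        have hV' : V''.1.1 ≤ V'.1.1 := fun x hx => (hle hx).2
        refine (map_map_apply _ _ _ _).trans ((MarkedCurve.map_localMk n hV (u V)).trans
          (Eq.trans ?_ ((map_map_apply _ _ _ _).trans
            (MarkedCurve.map_localMk n hV' (u V'))).symm))
        rw [← sub_eq_zero, ← map_sub, MarkedCurve.localMk_eq_zero_iff, h.prod_eq_iInf,
          Submodule.mem_iInf]
        intro i
        rw [← blockIdeal_pow]
        exact MarkedCurve.Represents.sub_mem (M := M.sub (P.incl i))
          (MarkedCurve.Represents.restrict (M := M.sub (P.incl i)) hV (hu V i))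
          (MarkedCurve.Represents.restrict (M := M.sub (P.incl i)) hV' (hu V' i)))
  have hz' : ∀ V, MarkedCurve.Represents n V z (u V) := by
    intro V
    have h2 := hz V
    change ((M.thick n).presheaf.map (homOfLE (V.le n)).op).hom z = _ at h2
    rw [← id_appLE] at h2
    exact h2
  refine ⟨z, fun i => MarkedCurve.Represents.eq (M := M.sub (P.incl i)) fun V =>
    ⟨u V, u V, represents_toPartLevel i (hz' V), hu V i, by rw [sub_self]; exact zero_mem _⟩⟩

end Partition

/-! ### Lifting to the formal neighbourhood, and approximation by pullbacks. -/

theorem appLE_surjective_of_eq {X Y : Scheme.{0}} {f : X ⟶ Y} {U : Y.Opens} {V : X.Opens}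
    (e : f ⁻¹ᵁ U = V) (h : Function.Surjective (f.app U).hom) :
    Function.Surjective (f.appLE U V e.ge).hom := by
  subst e
  rwa [← Scheme.Hom.app_eq_appLE]

/-- Above level `k` lifts are chosen one after the other; below it the entries are forced by the
transition maps. The induction drops the bottom level of the tower. -/
theorem exists_compatible_of_surjective (k : ℕ) {T : ℕ → Type} (r : ∀ n, T (n + 1) → T n)
    (hr : ∀ n, Function.Surjective (r n)) (y : T k) :
    ∃ s : ∀ n, T n, (∀ n, r n (s (n + 1)) = s n) ∧ s k = y := by
  induction k generalizing T with
  | zero =>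
    choose g hg using hr
    exact ⟨fun n => Nat.rec (motive := T) y (fun i x => g i x) n, fun n => hg _ _, rfl⟩
  | succ k ih =>
    obtain ⟨s, hs, hk⟩ := ih (T := fun n => T (n + 1)) (fun n => r (n + 1)) (fun n => hr _) y
    refine ⟨fun n => Nat.rec (motive := T) (r 0 (s 0)) (fun i _ => s i) n, fun n => ?_, hk⟩
    cases n with
    | zero => rfl
    | succ n => exact hs n

namespace MarkedCurve

variable {M : MarkedCurve}

theorem thickRes_surjective (C : M.Chart) (n : ℕ) : Function.Surjective (M.thickRes n C.W) := by
  have : IsClosedImmersion (M.thickTrans n) :=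
    inferInstanceAs (IsClosedImmersion (Scheme.IdealSheafData.inclusion _))
  have e : M.thickTrans n ⁻¹ᵁ (M.thickProj (n + 1) ⁻¹ᵁ C.W) = M.thickProj n ⁻¹ᵁ C.W := by
    rw [← M.thickTrans_proj n]; rfl
  exact appLE_surjective_of_eq e
    ((M.thickTrans n).app_surjective _ (C.isChart.thick_affine (n + 1)))

theorem lev_surjective (C : M.Chart) (n : ℕ) : Function.Surjective (M.lev n C.W) := by
  intro y
  obtain ⟨s, hs, hk⟩ := exists_compatible_of_surjective n (T := fun n => M.thickRing n C.W)
    (fun n => M.thickRes n C.W) (fun n => thickRes_surjective C n) y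
  exact ⟨⟨s, hs⟩, hk⟩

end MarkedCurve

/-- A pushout of commutative rings is a tensor product, so its elements are sums of products of
elements coming from the two factors. -/
theorem pushout_induction {R A B C : CommRingCat.{0}} {i : R ⟶ A} {f : R ⟶ B} {g : A ⟶ C}
    {k : B ⟶ C} (H : IsPushout i f g k) (P : C → Prop) (hadd : ∀ y z, P y → P z → P (y + z))
    (hmul : ∀ b a, P (k.hom b * g.hom a)) (y : C) : P y := by
  algebraize [i.hom, f.hom, g.hom, k.hom, g.hom.comp i.hom]
  have : IsScalarTower R B C := IsScalarTower.of_algebraMap_eq' (congrArg CommRingCat.Hom.hom H.w)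
  have h2 : Algebra.IsPushout R B A C := CommRingCat.isPushout_iff_isPushout.1 H.flip
  have hsmul : y ∈ AddSubmonoid.closure {z | ∃ b a, z = k.hom b * g.hom a} := by
    refine h2.out.inductionOn y (fun y => y ∈ AddSubmonoid.closure {z | ∃ b a, z = k.hom b * g.hom a})
      (zero_mem _) ?_ ?_ (fun _ _ => add_mem)
    · exact fun a => AddSubmonoid.subset_closure ⟨1, a, by rw [map_one, one_mul]; rfl⟩
    · intro b z hz
      induction hz using AddSubmonoid.closure_induction with
      | mem z hz =>
        obtain ⟨b', a, rfl⟩ := hz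
        refine AddSubmonoid.subset_closure ⟨b * b', a, ?_⟩
        rw [Algebra.smul_def, map_mul, mul_assoc]; rfl
      | zero => rw [smul_zero]; exact zero_mem _
      | add x y _ _ hx hy => rw [smul_add]; exact add_mem hx hy
  induction hsmul using AddSubmonoid.closure_induction with
  | mem z hz => obtain ⟨b, a, rfl⟩ := hz; exact hmul b a
  | zero =>
    -- `P 0` is not assumed; it is the case of the product of two zeros.
    have := hmul 0 0
    rwa [map_zero, zero_mul] at this
  | add x y _ _ hx hy => exact hadd _ _ hx hy

/-- Over affine opens, the sections of a fibre product are the pushout of the sections of its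
factors. -/
theorem appLE_induction {X Y S T : Scheme.{0}} {f : T ⟶ S} {g : Y ⟶ X} {iX : X ⟶ S} {iY : Y ⟶ T}
    (H : IsPullback g iY iX f) {US : S.Opens} {UT : T.Opens} {UX : X.Opens} (hUST : UT ≤ f ⁻¹ᵁ US)
    (hUSX : UX ≤ iX ⁻¹ᵁ US) (hUS : IsAffineOpen US) (hUT : IsAffineOpen UT)
    (hUX : IsAffineOpen UX) (P : Γ(Y, g ⁻¹ᵁ UX ⊓ iY ⁻¹ᵁ UT) → Prop)
    (hadd : ∀ y z, P y → P z → P (y + z))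
    (hmul : ∀ a b, P ((iY.appLE UT _ inf_le_right).hom a * (g.appLE UX _ inf_le_left).hom b))
    (y : Γ(Y, g ⁻¹ᵁ UX ⊓ iY ⁻¹ᵁ UT)) : P y :=
  pushout_induction ((isIso_pushoutSection_iff H hUST hUSX rfl).1
    (isIso_pushoutSection_of_isAffineOpen H hUST hUSX rfl hUS hUT hUX)) P hadd hmul y

theorem isAffineOpen_of_isPullback {X Y S T : Scheme.{0}} {f : T ⟶ S} {g : Y ⟶ X} {iX : X ⟶ S}
    {iY : Y ⟶ T} (H : IsPullback g iY iX f) {US : S.Opens} {UT : T.Opens} {UX : X.Opens}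
    (hUST : UT ≤ f ⁻¹ᵁ US) (hUSX : UX ≤ iX ⁻¹ᵁ US) (hUS : IsAffineOpen US)
    (hUT : IsAffineOpen UT) (hUX : IsAffineOpen UX) :
    IsAffineOpen (g ⁻¹ᵁ UX ⊓ iY ⁻¹ᵁ UT) := by
  have : IsAffine _ := hUS
  have : IsAffine _ := hUT
  have : IsAffine _ := hUX
  exact .of_isIso (Scheme.Hom.isPullback_resLE H hUST hUSX rfl).isoPullback.hom

namespace Collapse

variable {M' M : MarkedCurve} (m : Collapse M' M)

/-- Functions on the `n`-th neighbourhood of `Σ'` are combinations of pullbacks. -/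
theorem level_induction {C : M.Chart} {W' : M'.S.Opens} (hW' : IsAffineOpen W')
    (h : W' ≤ m.f ⁻¹ᵁ C.W) (n : ℕ)
    (P : M'.thickRing n W' → Prop) (hadd : ∀ y z, P y → P z → P (y + z))
    (hmul : ∀ a b, P (M'.thickStr n W' a * m.toMap.level h n b)) (y : M'.thickRing n W') : P y := by
  -- The `n`-th neighbourhood of `Σ'` maps to the base change of that of `Σ`. When sections merge
  -- this need not be an isomorphism, but a closed immersion is enough: functions lift along it on
  -- affine opens, and on the fibre product they are sums of products.
  let φ : M'.thick n ⟶ Limits.pullback (M.thickProj n) m.f :=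
    Limits.pullback.lift (m.toMap.thick n) (M'.thickProj n) (m.toMap.thick_proj n)
  let q : Limits.pullback (M.thickProj n) m.f ⟶ M'.X :=
    m.isPullback.lift (Limits.pullback.fst _ _ ≫ M.thickι n) (Limits.pullback.snd _ _) (by
      rw [Category.assoc]; exact Limits.pullback.condition)
  have e1 : φ ≫ Limits.pullback.fst (M.thickProj n) m.f = m.toMap.thick n :=
    Limits.pullback.lift_fst _ _ _
  have e2 : φ ≫ Limits.pullback.snd (M.thickProj n) m.f = M'.thickProj n :=
    Limits.pullback.lift_snd _ _ _
  have hφ : φ ≫ q = M'.thickι n := by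
    apply m.isPullback.hom_ext
    · rw [Category.assoc, IsPullback.lift_fst, ← Category.assoc, e1]
      exact m.toMap.thick_ι n
    · rw [Category.assoc, IsPullback.lift_snd, e2]
      rfl
  have hsep : IsSeparated (M.thickProj n) := inferInstanceAs (IsSeparated (M.thickι n ≫ M.p))
  -- `q ≫ M'.p` is a base change of a separated morphism, so `q` is separated. Since `φ ≫ q` is a
  -- closed immersion, `φ` is one as well.
  have hq : IsSeparated (q ≫ M'.p) := by
    rw [IsPullback.lift_snd]; infer_instance
  have : IsSeparated q := IsSeparated.of_comp q M'.p
  have : IsClosedImmersion (φ ≫ q) := by rw [hφ]; infer_instance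
  have : IsClosedImmersion φ := IsClosedImmersion.of_comp φ q
  have H := IsPullback.of_hasPullback (M.thickProj n) m.f
  have e : φ ⁻¹ᵁ (Limits.pullback.fst (M.thickProj n) m.f ⁻¹ᵁ (M.thickProj n ⁻¹ᵁ C.W) ⊓
      Limits.pullback.snd (M.thickProj n) m.f ⁻¹ᵁ W') = M'.thickProj n ⁻¹ᵁ W' := by
    have h1 : φ ⁻¹ᵁ (Limits.pullback.fst (M.thickProj n) m.f ⁻¹ᵁ (M.thickProj n ⁻¹ᵁ C.W)) =
        m.toMap.thick n ⁻¹ᵁ (M.thickProj n ⁻¹ᵁ C.W) := by rw [← e1]; rfl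
    have h2 : φ ⁻¹ᵁ (Limits.pullback.snd (M.thickProj n) m.f ⁻¹ᵁ W') =
        M'.thickProj n ⁻¹ᵁ W' := by rw [← Scheme.Hom.comp_preimage, e2]
    rw [Scheme.Hom.preimage_inf, h1, h2]
    exact inf_eq_right.2 (m.toMap.preimage_le h n)
  obtain ⟨z, rfl⟩ := appLE_surjective_of_eq e (φ.app_surjective _
    (isAffineOpen_of_isPullback H h le_rfl C.isChart.affine hW' (C.isChart.thick_affine n))) y
  refine appLE_induction H h le_rfl C.isChart.affine hW' (C.isChart.thick_affine n)
    (fun z => P ((φ.appLE _ _ e.ge).hom z)) ?_ ?_ z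
  · intro y z hy hz
    rw [map_add]; exact hadd _ _ hy hz
  · intro a b
    rw [map_mul]
    convert hmul a b using 2
    · exact appLE_triangle e2 _ _ _ a
    · exact appLE_triangle e1 _ _ _ b

/-- At level `n` functions are sums of products of pullbacks, and over a chart each function of
level `n` on the source of the pullback lifts to the formal neighbourhood. -/
theorem exists_formal_approx {C : M.Chart} {W' : M'.S.Opens} (hW' : IsAffineOpen W')
    (h : W' ≤ m.f ⁻¹ᵁ C.W) (n : ℕ) (r : M'.R W') :
    ∃ z ∈ AddSubmonoid.closure {z : M'.R W' | ∃ (a : M'.A W') (b : M.R C.W),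
      z = algebraMap _ _ a * m.formal h b}, r - z ∈ M'.van n W' := by
  suffices ∃ z ∈ AddSubmonoid.closure {z : M'.R W' | ∃ (a : M'.A W') (b : M.R C.W),
      z = algebraMap _ _ a * m.formal h b}, M'.lev n W' z = M'.lev n W' r by
    obtain ⟨z, hz, e⟩ := this
    refine ⟨z, hz, ?_⟩
    rw [MarkedCurve.van, RingHom.mem_ker, map_sub, e, sub_self]
  refine m.level_induction hW' h n (fun y => ∃ z ∈ AddSubmonoid.closure {z : M'.R W' |
      ∃ (a : M'.A W') (b : M.R C.W), z = algebraMap _ _ a * m.formal h b}, M'.lev n W' z = y)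
    ?_ ?_ (M'.lev n W' r)
  · rintro _ _ ⟨y, hy, rfl⟩ ⟨z, hz, rfl⟩
    exact ⟨y + z, add_mem hy hz, map_add _ _ _⟩
  · intro a b
    obtain ⟨b, rfl⟩ := MarkedCurve.lev_surjective C n b
    exact ⟨_, AddSubmonoid.subset_closure ⟨a, b, rfl⟩, map_mul _ _ _⟩

end Collapse

namespace MarkedCurve

variable {M : MarkedCurve} {W : M.S.Opens}

theorem exists_dvd_pow_of_mem_off (hW : IsAffineOpen W) {s : M.R W} (hs : s ∈ M.off W) :
    ∃ k, ∀ x ∈ M.van 1 W, s ∣ x ^ k := by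
  obtain ⟨k, hk⟩ := hs
  refine ⟨k, fun x hx => ?_⟩
  have := hk M (Collapse.refl M) ⟨W, hW⟩ (Collapse.le_refl_preimage le_rfl) (Ideal.pow_mem_pow hx k)
  rwa [Collapse.formal_refl, Ideal.mem_span_singleton] at this

theorem Chart.exists_equation (C : M.Chart) : ∃ t ∈ M.off C.W, t ∈ M.van 1 C.W ∧
    ∀ n, M.van n C.W = Ideal.span {t ^ n} := by
  obtain ⟨t, ht, hv⟩ := C.isChart.principal
  refine ⟨t, ht, ?_, hv⟩
  rw [hv, pow_one]
  exact Ideal.mem_span_singleton_self t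

theorem K.exists_mul_eq (g : M.K W) : ∃ r : M.R W, ∃ s ∈ M.off W,
    g * algebraMap _ _ s = algebraMap _ _ r := by
  obtain ⟨r, ⟨s, hs⟩, rfl⟩ := IsLocalization.exists_mk'_eq (M.off W) g
  exact ⟨r, s, hs, IsLocalization.mk'_spec _ _ _⟩

theorem isUnit_algebraMap_off {s : M.R W} (hs : s ∈ M.off W) : IsUnit (algebraMap (M.R W) (M.K W) s) :=
  IsLocalization.map_units (M.K W) (⟨s, hs⟩ : M.off W)

/-- Every admissible denominator divides a power of any `t` vanishing on `Σ`, so the powers of one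
such `t` suffice as denominators. -/
theorem exists_mul_pow_eq (hW : IsAffineOpen W) {t : M.R W} (ht : t ∈ M.van 1 W) (g : M.K W) :
    ∃ (k : ℕ) (r : M.R W), g * algebraMap _ _ (t ^ k) = algebraMap _ _ r := by
  obtain ⟨r, s, hs, e⟩ := K.exists_mul_eq g
  obtain ⟨k, hk⟩ := exists_dvd_pow_of_mem_off hW hs
  obtain ⟨y, hy⟩ := hk t ht
  exact ⟨k, r * y, by rw [hy, map_mul, map_mul, ← e]; ring⟩

end MarkedCurve

theorem eq_add_of_mul_eq {R K : Type*} [CommRing R] [CommRing K] [Algebra R K] {g i : K}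
    {r z s x : R} (hr : g * algebraMap R K s = algebraMap R K r) (e : r = z + s * x)
    (hi : i * algebraMap R K s = 1) : g = algebraMap R K z * i + algebraMap R K x := by
  rw [e, map_add, map_mul] at hr
  linear_combination i * hr + (algebraMap R K x - g) * hi

/-- The pullback of an equation of `Σ` is an admissible denominator on the target and is inverted by
a pulled-back function. After clearing denominators with its powers, only the numerator has to be
approximated. This density makes the center stable under restriction and base change. -/
theorem Collapse.exists_punctured_approx {M' M : MarkedCurve} (m : Collapse M' M) {C : M.Chart}
    {C' : M'.Chart} (h : C'.W ≤ m.f ⁻¹ᵁ C.W) (n : ℕ) (g : M'.K C'.W) :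
    ∃ z ∈ AddSubmonoid.closure {z : M'.K C'.W | ∃ (a : M'.A C'.W) (f : M.K C.W),
      z = algebraMap _ _ a * m.punctured h f}, ∃ x ∈ M'.van n C'.W,
        g = z + algebraMap _ _ x := by
  obtain ⟨t, ht, htv, -⟩ := C.exists_equation
  obtain ⟨t', ht', htv', hv'⟩ := C'.exists_equation
  have hft : m.formal h t ∈ M'.off C'.W := m.off_le h ht
  obtain ⟨k, hk⟩ := MarkedCurve.exists_dvd_pow_of_mem_off C'.isChart.affine hft
  obtain ⟨l, r, hr⟩ := MarkedCurve.exists_mul_pow_eq C'.isChart.affine (m.formal_mem_van h htv) g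
  -- The pullback of `t` divides `t' ^ k`, so dividing the error by its `l`-th power loses `k * l`
  -- orders of vanishing, and order `n` remains.
  obtain ⟨z, hz, hzr⟩ := m.exists_formal_approx C'.isChart.affine h (n + k * l) r
  obtain ⟨u, hu⟩ := MarkedCurve.isUnit_algebraMap_off (pow_mem ht l)
  rw [hv', Ideal.mem_span_singleton] at hzr
  obtain ⟨w, hw⟩ := hzr
  obtain ⟨y, hy⟩ := hk t' htv'
  have hinv : m.punctured h ↑u⁻¹ * algebraMap (M'.R C'.W) (M'.K C'.W) (m.formal h t ^ l) = 1 := by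
    rw [← map_pow, ← m.punctured_algebraMap, ← map_mul, ← hu, Units.inv_mul, map_one]
  refine ⟨algebraMap _ _ z * m.punctured h ↑u⁻¹, ?_, t' ^ n * (y ^ l * w), ?_, ?_⟩
  · clear hw
    induction hz using AddSubmonoid.closure_induction with
    | mem z hz =>
      obtain ⟨a, b, rfl⟩ := hz
      refine AddSubmonoid.subset_closure ⟨a, algebraMap _ _ b * ↑u⁻¹, ?_⟩
      rw [map_mul, map_mul, m.punctured_algebraMap, mul_assoc,
        ← IsScalarTower.algebraMap_apply]
    | zero => rw [map_zero, zero_mul]; exact zero_mem _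
    | add x y _ _ hx hy => rw [map_add, add_mul]; exact add_mem hx hy
  · rw [hv']; exact Ideal.mul_mem_right _ _ (Ideal.mem_span_singleton_self _)
  · refine eq_add_of_mul_eq hr ?_ hinv
    rw [← sub_eq_iff_eq_add', hw, pow_add, pow_mul, hy]; ring

/-! ### Splitting of functions on the formal neighbourhood. -/

namespace Partition

variable {M : MarkedCurve} {I : Type} {P : Partition M.J I} {W : M.S.Opens}

theorem toPart_mem_van (i : I) {n : ℕ} {a : M.R W} (ha : a ∈ M.van n W) :
    P.toPart i W a ∈ (M.sub (P.incl i)).van n W :=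
  (P.toMap i).formal_mem_van (W := W) (W' := W) (le_refl W) ha

variable [Fintype I]

theorem Splits.toPart_injective (h : P.Splits W) {a b : M.R W}
    (e : ∀ i, P.toPart i W a = P.toPart i W b) : a = b :=
  Subtype.ext (funext fun n => h.toPartLevel_injective fun i =>
    congrArg ((M.sub (P.incl i)).lev n W) (e i))

/-- The lifts at the various levels are unique by `toPartLevel_injective`, hence compatible with
restriction, and define an element of the limit. -/
theorem Splits.exists_toPart_eq (h : P.Splits W) (r : ∀ i, (M.sub (P.incl i)).R W) :
    ∃ a : M.R W, ∀ i, P.toPart i W a = r i := by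
  choose z hz using fun n => h.toPartLevel_surjective (n := n)
    fun i => (M.sub (P.incl i)).lev n W (r i)
  refine ⟨⟨z, fun n => h.toPartLevel_injective fun i => ?_⟩, fun i =>
    Subtype.ext (funext fun n => hz n i)⟩
  refine ((P.toMap i).level_res (W := W) (W' := W) (le_refl W) n (z (n + 1))).symm.trans ?_
  exact (congrArg _ (hz (n + 1) i)).trans
    ((MarkedCurve.lev_res n (r i)).trans (hz n i).symm)

theorem Splits.mem_van (h : P.Splits W) {n : ℕ} {a : M.R W}
    (ha : ∀ i, P.toPart i W a ∈ (M.sub (P.incl i)).van n W) : a ∈ M.van n W :=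
  h.toPartLevel_injective fun i =>
    (show P.toPartLevel i n W (M.lev n W a) = 0 from ha i).trans (map_zero _).symm

end Partition

/-! ### Residues of rational expressions and factorizations of the denominator. -/

namespace MarkedCurve

open Polynomial

/-- Here `ε` and `δ` stand for polynomial lifts of orthogonal idempotents. The operators `q ↦ q' F`
and `q ↦ q' F - n q F'` preserve multiples of `F^(2n+1)`. After replacing `q` by `δ q` and `p` by `ε
p`, every term contains `ε δ` except one in `δ' F`. Replacing `p` by `ε p` a second time there gives
`ε² δ' F = ε (ε δ)' F - (ε δ) ε' F`, which is again a multiple of `F^(2n+1)`. -/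
theorem ratResidue_eq_zero_of_dvd {A : Type} [CommRing A] {F : A[X]} (hF : F.Monic) {n : ℕ}
    {p q ε δ : A[X]} (hεδ : F ^ (2 * n + 1) ∣ ε * δ) (hp : F ^ (2 * n + 1) ∣ p - ε * p)
    (hq : F ^ (2 * n + 1) ∣ q - δ * q) : ratResidue F n p q = 0 := by
  suffices h : F ^ (2 * n + 1) ∣ p * (derivative q * F - (n : A[X]) * q * derivative F) by
    rw [ratResidue, (modByMonic_eq_zero_iff_dvd (hF.pow _)).2 h, coeff_zero]
  obtain ⟨μ, hμ⟩ := hεδ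
  obtain ⟨α, hα⟩ := hp
  obtain ⟨γ, hγ⟩ := hq
  have e2 : F ^ (2 * n + 1) = F ^ (n + (n + 1)) := by congr 1; ring
  have h1 := derivative_pow_mul_sub F γ n (n + 1)
  rw [← e2, ← hγ, derivative_sub, derivative_mul] at h1
  have h2 := derivative_pow_mul_sub F μ 0 (2 * n + 1)
  rw [Nat.zero_add, ← hμ, derivative_mul] at h2
  push_cast at h2
  generalize ((n + 1 : ℕ) : A[X]) * derivative F * γ + F * derivative γ = u at h1
  generalize (2 * (n : A[X]) + 1) * derivative F * μ + F * derivative μ = v at h2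
  generalize F ^ (2 * n + 1) = T at *
  refine ⟨p * u + α * (derivative δ * q * F + δ * (derivative q * F - n * q * derivative F)) +
    α * ε * derivative δ * q * F + p * q * ε * v +
    μ * p * (derivative q * F - n * q * derivative F) - p * q * F * μ * derivative ε, ?_⟩
  linear_combination p * h1 + (derivative δ * q * F +
    δ * (derivative q * F - n * q * derivative F)) * hα + ε * derivative δ * q * F * hα + p * q * ε * h2 + 
    (p * (derivative q * F - n * q * derivative F) - p * q * F * derivative ε) * hμ

/-- The fractions `H^n p / (E H)^n` and `p / E^n` are the same, and so are the resulting forms, with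
numerator and denominator both multiplied by `H^(2n+1)`. As `H` is monic, this shifts the relevant
coefficient of the remainder without changing it. -/
theorem ratResidue_mul {A : Type} [CommRing A] [Nontrivial A] {E H : A[X]} (hE : E.Monic) (hH : H.Monic)
    (hdeg : 0 < E.natDegree) (n : ℕ) (p q : A[X]) :
    ratResidue (E * H) n (H ^ n * p) (H ^ n * q) = ratResidue E n p q := by
  have h0 : H ^ n * p * (derivative (H ^ n * q) * (E * H) -
      (n : A[X]) * (H ^ n * q) * derivative (E * H)) =
      H ^ (2 * n + 1) * (p * (derivative q * E - (n : A[X]) * q * derivative E)) := by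
    have h1 := derivative_pow_mul_sub H q n 0
    simp only [Nat.add_zero, Nat.cast_zero, zero_mul, zero_add] at h1
    rw [derivative_mul (f := E)]
    linear_combination H ^ n * p * E * h1
  rw [ratResidue, ratResidue, h0]
  generalize p * (derivative q * E - (n : A[X]) * q * derivative E) = u
  -- The division of `u` by `E^(2n+1)`, multiplied by `H^(2n+1)`, still satisfies the degree bound;
  -- uniqueness of Euclidean division applies.
  have hmod : (H ^ (2 * n + 1) * u) %ₘ (E * H) ^ (2 * n + 1) =
      H ^ (2 * n + 1) * (u %ₘ E ^ (2 * n + 1)) := by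
    refine (div_modByMonic_unique (u /ₘ E ^ (2 * n + 1)) _ ((hE.mul hH).pow _) ⟨?_, ?_⟩).2
    · have := modByMonic_add_div u (E ^ (2 * n + 1))
      rw [mul_pow]
      linear_combination H ^ (2 * n + 1) * this
    · rw [mul_pow, mul_comm, (hH.pow _).degree_mul, (hH.pow _).degree_mul]
      have := degree_modByMonic_lt u (hE.pow (2 * n + 1))
      rw [degree_eq_natDegree (hH.pow _).ne_zero]
      exact WithBot.add_lt_add_right WithBot.coe_ne_bot this
  rw [hmod, (hE.natDegree_mul hH)]
  -- Positive degree of `E` lets the truncated subtraction commute with the addition.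
  have e : (2 * n + 1) * (E.natDegree + H.natDegree) - 1 =
      (2 * n + 1) * H.natDegree + ((2 * n + 1) * E.natDegree - 1) := by
    have := Nat.mul_le_mul_left (2 * n + 1) hdeg
    rw [mul_add]; omega
  rw [e, coeff_mul_add_eq_of_natDegree_le (by rw [hH.natDegree_pow]) ?_, ← hH.natDegree_pow,
    (hH.pow _).coeff_natDegree, one_mul]
  have := natDegree_modByMonic_lt u (hE.pow (2 * n + 1)) (by
    intro h
    have := congrArg natDegree h
    rw [hE.natDegree_pow, natDegree_one] at this
    have := Nat.mul_le_mul_left (2 * n + 1) hdeg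
    omega)
  rw [hE.natDegree_pow] at this
  omega


/-! ### Values at the sections and roots of the equation of `Σ`. -/

variable {M : MarkedCurve} {W : M.S.Opens}

/-- A section of the curve, as a section of the first neighbourhood of `Σ`. -/
def thickSection (j : M.J) : M.S ⟶ M.thick 1 :=
  IsClosedImmersion.lift (M.thickι 1) (M.σ j) (by
    classical
    rw [ker_thickι, pow_one, idealSheaf, ← Finset.mul_prod_erase _ _ (Finset.mem_univ j)]
    exact fun U => Ideal.mul_le_left (I := (M.σ j).ker.ideal U))

theorem thickSection_ι (j : M.J) : thickSection j ≫ M.thickι 1 = M.σ j :=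
  IsClosedImmersion.lift_fac _ _ _

theorem thickSection_proj (j : M.J) : thickSection j ≫ M.thickProj 1 = 𝟙 _ := by
  rw [thickProj, ← Category.assoc, thickSection_ι, M.σ_p]

theorem le_thickSection_preimage (j : M.J) (W : M.S.Opens) :
    W ≤ thickSection j ⁻¹ᵁ (M.thickProj 1 ⁻¹ᵁ W) :=
  le_preimage_of_comp_eq (thickSection_proj j) W

/-- The value at the section `j` of a function on the first neighbourhood of `Σ`. -/
def thickValue (j : M.J) (W : M.S.Opens) : M.thickRing 1 W →+* M.A W :=
  ((thickSection j).appLE _ W (le_thickSection_preimage j W)).hom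

/-- The value of a function on the formal neighbourhood at the section `j`. -/
def value (j : M.J) (W : M.S.Opens) : M.R W →ₐ[M.A W] M.A W where
  __ := (thickValue j W).comp (M.lev 1 W)
  commutes' a := by
    refine (appLE_triangle (thickSection_proj j) _ _ (le_refl W) a).trans ?_
    exact appLE_eq_self rfl _ a

theorem value_apply (j : M.J) (a : M.R W) : value j W a = thickValue j W (M.lev 1 W a) := rfl

theorem Represents.mem_ker {j : M.J} {V : M.Over W} {y : M.thickRing 1 W} {u : Γ(M.X, V.1.1)}
    (hu : Represents 1 V y u) (hy : thickValue j W y = 0) : u ∈ (M.σ j).ker.ideal V.1 := by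
  rw [Scheme.Hom.ker_apply, RingHom.mem_ker, Scheme.Hom.app_eq_appLE]
  have hle : M.σ j ⁻¹ᵁ V.1.1 ≤ W := fun x hx => by
    have : M.p (M.σ j x) ∈ W := V.2 hx
    rwa [σ_p_apply] at this
  have hle' : M.σ j ⁻¹ᵁ V.1.1 ≤ thickSection j ⁻¹ᵁ (M.thickι 1 ⁻¹ᵁ V.1.1) :=
    le_preimage_of_comp_eq (thickSection_ι j) _
  have h1 : ((M.σ j).appLE V.1.1 _ le_rfl).hom u =
      ((thickSection j).appLE _ _ hle').hom (localMk 1 V u) :=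
    (appLE_triangle (thickSection_ι j) _ _ _ u).symm
  have h2 : ((thickSection j).appLE _ _ hle').hom (localRes 1 V y) =
      ((𝟙 M.S : M.S ⟶ M.S).appLE W _ hle).hom (thickValue j W y) :=
    appLE_square (by simp) _ _ _ _ y
  rw [h1, ← hu, h2, hy, map_zero]

/-- The `j`-th factor vanishes at `σ j`, so it is represented in the ideal of `σ j`, and the product
is represented in the product of these ideals. -/
theorem prod_sub_value_mem_van (t : M.R W) :
    ∏ j, (t - algebraMap (M.A W) _ (value j W t)) ∈ M.van 1 W := by
  rw [van, RingHom.mem_ker, map_prod]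
  refine Represents.eq fun V => ?_
  choose u hu using fun j => exists_represents V
    (M.lev 1 W (t - algebraMap (M.A W) _ (value j W t)))
  refine ⟨_, 0, Represents.prod Finset.univ hu, represents_zero _ _, ?_⟩
  rw [sub_zero, idealSheaf_pow_ideal, pow_one]
  refine Ideal.prod_mem_prod fun j _ => (hu j).mem_ker ?_
  rw [← value_apply, map_sub, AlgHom.commutes, Algebra.algebraMap_self_apply, sub_self]

/-- The product on the right, evaluated at `t`, vanishes on the first neighbourhood, so `F` divides
it. Both are monic of degree the number of sections. -/
theorem Coordinate.F_eq_prod (x : M.Coordinate W) : x.F = ∏ j, (Polynomial.X - C (value j W x.t)) := by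
  nontriviality (M.A W)
  refine (eq_of_monic_of_dvd_of_natDegree_le x.monic
    (monic_prod_of_monic _ _ fun j _ => monic_X_sub_C _) ?_ ?_).symm
  · rw [← pow_one x.F, ← x.lev_eq_zero_iff 1, map_prod]
    simp only [map_sub, aeval_X, aeval_C]
    exact prod_sub_value_mem_van x.t
  · rw [natDegree_prod_of_monic _ _ fun j _ => monic_X_sub_C _, x.natDegree]
    simp

end MarkedCurve

instance {M : MarkedCurve} {J' : Type} [Fintype J'] (e : J' → M.J) (W : M.S.Opens) :
    Algebra (M.A W) ((M.sub e).R W) :=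
  inferInstanceAs (Algebra ((M.sub e).A W) ((M.sub e).R W))

/-! ### Coordinates along a block. -/

namespace Partition

open Polynomial MarkedCurve

variable {M : MarkedCurve} {I : Type} {P : Partition M.J I} {W : M.S.Opens}

variable (P) in
/-- The map from functions on the formal neighbourhood of `Σ_J` to those on that of `Σ_{J_i}`. -/
def toPartAlg (i : I) (W : M.S.Opens) : M.R W →ₐ[M.A W] (M.sub (P.incl i)).R W where
  __ := P.toPart i W
  commutes' a := ((P.toMap i).formal_algebraMap (W := W) (W' := W) (le_refl W) a).trans
    (congrArg (algebraMap ((M.sub (P.incl i)).A W) ((M.sub (P.incl i)).R W))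
      (appLE_eq_self rfl (le_refl W) a))

theorem value_toPart (i : I) (a : P.part i) (r : M.R W) :
    value (M := M.sub (P.incl i)) a W (P.toPart i W r) = value (P.incl i a) W r := by
  refine appLE_triangle ?_ _ _ _ _
  rw [← cancel_mono (M.thickι 1), Category.assoc, MarkedMap.thick_ι, thickSection_ι,
    ← Category.assoc, thickSection_ι]
  exact Category.comp_id _

variable (P) in
/-- The polynomial whose roots are the values of `t` at the sections of the block `i`. -/
def blockPoly (i : I) (t : M.R W) : (M.A W)[X] :=
  ∏ a, (Polynomial.X - C (value (P.incl i a) W t))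

theorem monic_blockPoly (i : I) (t : M.R W) : (P.blockPoly i t).Monic :=
  monic_prod_of_monic _ _ fun _ _ => monic_X_sub_C _

theorem natDegree_blockPoly [Nontrivial (M.A W)] (i : I) (t : M.R W) :
    (P.blockPoly i t).natDegree = Fintype.card (P.part i) := by
  rw [blockPoly, natDegree_prod_of_monic _ _ fun _ _ => monic_X_sub_C _]
  simp

theorem aeval_blockPoly_pow_mem (i : I) (t : M.R W) (n : ℕ) :
    aeval (P.toPart i W t) (P.blockPoly i t ^ n) ∈ (M.sub (P.incl i)).van n W := by
  rw [map_pow]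
  refine van_one_pow_le n ?_
  have := prod_sub_value_mem_van (M := M.sub (P.incl i)) (P.toPart i W t)
  simp only [value_toPart] at this
  rw [blockPoly, map_prod]
  simp only [map_sub, aeval_X, aeval_C]
  exact this

theorem toPart_aeval (i : I) (t : M.R W) (q : (M.A W)[X]) :
    P.toPart i W (aeval t q) = aeval (P.toPart i W t) q :=
  (aeval_algHom_apply (P.toPartAlg i W) t q).symm

variable [Fintype I]

theorem prod_blockPoly (x : M.Coordinate W) : ∏ i, P.blockPoly i x.t = x.F := by
  rw [x.F_eq_prod, ← (Equiv.ofBijective _ P.bijective).prod_comp, Fintype.prod_sigma]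
  rfl

/-- Modulo the equation of `Σ`, the function equal to `1` on block `i` and `0` on the other blocks
is a polynomial `ε` in `t`. The difference of the two values of `t` divides the difference of the
values of `ε` there, which is `1`. -/
theorem Splits.isUnit_value_sub (h : P.Splits W) (x : M.Coordinate W) {i i' : I} (hi : i ≠ i')
    (a : P.part i) (a' : P.part i') :
    IsUnit (value (P.incl i a) W x.t - value (P.incl i' a') W x.t) := by
  classical
  obtain ⟨e, he⟩ := h.exists_toPart_eq fun k => if k = i then 1 else 0
  obtain ⟨ε, hε⟩ := x.lev_surjective 1 (M.lev 1 W e)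
  have hv : ∀ j, ε.eval (value j W x.t) = value j W e := by
    intro j
    have := congrArg (thickValue j W) hε
    rw [← value_apply, ← value_apply, ← aeval_algHom_apply] at this
    simpa using this
  have h1 : value (P.incl i a) W e = 1 := by
    rw [← value_toPart, he, if_pos rfl, map_one]
  have h2 : value (P.incl i' a') W e = 0 := by
    rw [← value_toPart, he, if_neg hi.symm, map_zero]
  have h3 := sub_dvd_eval_sub (value (P.incl i a) W x.t) (value (P.incl i' a') W x.t) ε
  rw [hv, hv, h1, h2, sub_zero] at h3
  exact isUnit_of_dvd_one h3

theorem Splits.isCoprime_blockPoly (h : P.Splits W) (x : M.Coordinate W) {i i' : I} (hi : i ≠ i') :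
    IsCoprime (P.blockPoly i x.t) (P.blockPoly i' x.t) :=
  IsCoprime.prod_left fun a _ => IsCoprime.prod_right fun a' _ =>
    isCoprime_X_sub_C_of_isUnit_sub (h.isUnit_value_sub x hi a a')

open Classical in
variable (P) in
/-- The polynomial whose roots are the values of `t` at the sections outside the block `i`. -/
def coblockPoly (i : I) (t : M.R W) : (M.A W)[X] :=
  ∏ k ∈ Finset.univ.erase i, P.blockPoly k t

theorem monic_coblockPoly (i : I) (t : M.R W) : (P.coblockPoly i t).Monic :=
  monic_prod_of_monic _ _ fun k _ => monic_blockPoly k t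

theorem blockPoly_dvd_coblockPoly {i k : I} (hk : k ≠ i) (t : M.R W) :
    P.blockPoly k t ∣ P.coblockPoly i t := by
  classical
  exact Finset.dvd_prod_of_mem (fun k => P.blockPoly k t) (Finset.mem_erase.2 ⟨hk, Finset.mem_univ k⟩)

theorem blockPoly_mul_coblockPoly (x : M.Coordinate W) (i : I) :
    P.blockPoly i x.t * P.coblockPoly i x.t = x.F := by
  classical
  rw [← prod_blockPoly (P := P) x]
  exact Finset.mul_prod_erase _ (fun k => P.blockPoly k x.t) (Finset.mem_univ i)

/-- The coordinate along a block. -/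
def Splits.coordinate (h : P.Splits W) [Nontrivial (M.A W)] (x : M.Coordinate W) (i : I) :
    (M.sub (P.incl i)).Coordinate W where
  t := P.toPart i W x.t
  F := P.blockPoly i x.t
  monic := monic_blockPoly i x.t
  natDegree := natDegree_blockPoly i x.t
  lev_eq_zero_iff n q := by
    classical
    have key : ∀ k (q : (M.A W)[X]), P.blockPoly k x.t ^ n ∣ q →
        P.toPart k W (aeval x.t q) ∈ (M.sub (P.incl k)).van n W := by
      rintro k _ ⟨r, rfl⟩
      rw [toPart_aeval, map_mul]
      exact Ideal.mul_mem_right _ _ (aeval_blockPoly_pow_mem k x.t n)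
    constructor
    · intro hq
      have hF := blockPoly_mul_coblockPoly (P := P) x i
      -- Multiplication by this power makes the function vanish on the other blocks, so that the
      -- criterion for the whole family applies. The monic factor is cancelled afterwards.
      have h1 : aeval x.t (P.coblockPoly i x.t ^ n * q) ∈ M.van n W := by
        refine h.mem_van fun k => ?_
        by_cases hk : k = i
        · subst hk
          rw [toPart_aeval, map_mul]
          exact Ideal.mul_mem_left _ _ hq
        · exact key k _ (Dvd.dvd.mul_right (pow_dvd_pow_of_dvd
            (blockPoly_dvd_coblockPoly hk x.t) n) _)
      have h2 := (x.lev_eq_zero_iff n _).1 h1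
      rw [← hF, mul_pow, mul_comm] at h2
      obtain ⟨r, hr⟩ := h2
      refine ⟨r, ((monic_coblockPoly (P := P) i x.t).pow n).isRegular.left ?_⟩
      simp only
      linear_combination hr
    · intro hq
      have := key i q hq
      rwa [toPart_aeval] at this
  lev_surjective n y := by
    classical
    -- `y` is extended by zero to the other blocks before being written as a polynomial in `t`.
    obtain ⟨z, hz⟩ := h.toPartLevel_surjective (n := n) (Function.update 0 i y)
    obtain ⟨q, hq⟩ := x.lev_surjective n z
    refine ⟨q, ?_⟩
    rw [← toPart_aeval]
    refine (lev_toPart i n _).trans ?_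
    rw [hq, hz, Function.update_self]

end Partition

/-! ### Cancellation on formal and punctured neighbourhoods. -/

namespace MarkedCurve

open Polynomial

variable {M : MarkedCurve} {W : M.S.Opens}

/-- The monic polynomial `F` can be cancelled among polynomials. This costs `k` orders of precision,
so level `n` is deduced from level `n + k`. -/
theorem Coordinate.eq_zero_of_pow_mul (x : M.Coordinate W) {k : ℕ} {z : M.R W}
    (hz : aeval x.t x.F ^ k * z = 0) : z = 0 := by
  refine Subtype.ext (funext fun n => ?_)
  obtain ⟨q, hq⟩ := x.lev_surjective (n + k) (M.lev (n + k) W z)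
  have h4 : x.F ^ (n + k) ∣ x.F ^ k * q := by
    rw [← x.lev_eq_zero_iff, map_mul, map_mul, hq, ← map_mul, map_pow, hz, map_zero]
  rw [pow_add, mul_comm] at h4
  obtain ⟨r, hr⟩ := h4
  have h5 : q = x.F ^ n * r := (x.monic.pow k).isRegular.left (by simp only; rw [hr]; ring)
  have h6 : M.lev n W z = M.lev n W (aeval x.t q) := lev_eq_of_le (Nat.le_add_right n k) hq.symm
  exact h6.trans ((x.lev_eq_zero_iff n q).2 ⟨r, h5⟩)

/-- Denominators are units and formal functions embed in the localization, so a nonzerodivisor on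
formal functions stays one on punctured functions. -/
theorem Coordinate.eq_zero_of_mul (x : M.Coordinate W) (hW : IsAffineOpen W) {r : M.R W}
    (hr : ∀ z, r * z = 0 → z = 0) {g : M.K W} (hg : algebraMap _ _ r * g = 0) : g = 0 := by
  obtain ⟨b, s, hs, hb⟩ := K.exists_mul_eq g
  have h1 : r * b = 0 := by
    apply x.eq_of_algebraMap_eq hW
    rw [map_mul, ← hb, ← mul_assoc, hg, zero_mul, map_zero]
  rw [hr b h1, map_zero] at hb
  exact (isUnit_algebraMap_off hs).mul_left_eq_zero.1 hb

/-- Inverses are unique, so the inverses at the various levels are compatible. -/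
theorem isUnit_of_isUnit_lev {b : M.R W} (h : ∀ n, IsUnit (M.lev n W b)) : IsUnit b := by
  choose v hv using fun n => (h n).exists_right_inv
  refine IsUnit.of_mul_eq_one ⟨v, fun n => ?_⟩ (Subtype.ext (funext hv))
  have h1 := congrArg (M.thickRes n W) (hv (n + 1))
  rw [map_mul, map_one, lev_res] at h1
  apply (h n).mul_left_cancel
  rw [h1, hv n]

end MarkedCurve

/-- Both sides are pullback along the single morphism of curves `m.F`, from the block of `Σ'` to the
family `Σ`. -/
theorem Collapse.formal_toPart {M' M : MarkedCurve} (m : Collapse M' M) {I : Type}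
    (P : Partition M.J I) (P' : Partition M'.J I) (c : ∀ i, P.part i → P'.part i)
    (hc : ∀ i a, m.π (P.incl i a) = P'.incl i (c i a)) (i : I) {W : M.S.Opens} {W' : M'.S.Opens}
    (h : W' ≤ m.f ⁻¹ᵁ W) (a : M.R W) :
    P'.toPart i W' (m.formal h a) = (m.part P P' c hc i).formal h (P.toPart i W a) := by
  let m'' : MarkedMap (M'.sub (P'.incl i)) M :=
    { f := m.f
      F := m.F
      comm := m.isPullback.w
      str := m.str
      sel := by
        obtain ⟨e, he, h⟩ := (m.part P P' c hc i).toMap.sel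
        exact ⟨P.incl i ∘ e, (P.incl_injective i).comp he, h⟩ }
  exact (MarkedMap.formal_comp (m := m.toMap) (m' := P'.toMap i) (m'' := m'')
    (Category.id_comp _).symm h (le_refl W') h a).symm.trans
    (MarkedMap.formal_comp (m := P.toMap i) (m' := (m.part P P' c hc i).toMap) (m'' := m'')
    (Category.comp_id _).symm (le_refl W) h h a)

/-! ### Rational approximations of extensions by zero. -/

namespace Partition

theorem IsExtension.map {M' M : MarkedCurve} (m : Collapse M' M) {I : Type}
    {P : Partition M.J I} {P' : Partition M'.J I} {c : ∀ i, P.part i → P'.part i}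
    (hc : ∀ i a, m.π (P.incl i a) = P'.incl i (c i a)) {i : I} {W : M.S.Opens} {W' : M'.S.Opens}
    (h : W' ≤ m.f ⁻¹ᵁ W) {f : (M.sub (P.incl i)).K W} {g : M.K W} (e : P.IsExtension i f g) :
    P'.IsExtension i ((m.part P P' c hc i).punctured h f) (m.punctured h g) := by
  obtain ⟨a, s, hs, h1, h2, h3⟩ := e
  refine ⟨m.formal h a, m.formal h s, m.off_le h hs, ?_, ?_, fun k hk => ?_⟩
  · rw [← m.punctured_algebraMap, ← map_mul, h1, m.punctured_algebraMap]
  · rw [m.formal_toPart P P' c hc, m.formal_toPart P P' c hc]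
    have h4 := congrArg ((m.part P P' c hc i).punctured (W := W) h) h2
    rw [map_mul] at h4
    refine Eq.trans ?_ (h4.trans ?_)
    · exact congrArg _ ((m.part P P' c hc i).punctured_algebraMap (W := W) h _).symm
    · exact (m.part P P' c hc i).punctured_algebraMap (W := W) h _
  · rw [m.formal_toPart P P' c hc, h3 k hk]
    exact map_zero _

open Polynomial MarkedCurve

variable {M : MarkedCurve} {I : Type} [Fintype I] {P : Partition M.J I} {W : M.S.Opens}

/-- The polynomial of the other blocks is coprime to every power of the polynomial of block `i`; a
Bézout relation inverts it at each level. -/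
theorem Splits.isUnit_coblockPoly (h : P.Splits W) [Nontrivial (M.A W)] (x : M.Coordinate W)
    (i : I) : IsUnit (aeval (P.toPart i W x.t) (P.coblockPoly i x.t)) := by
  classical
  refine isUnit_of_isUnit_lev fun n => ?_
  have h1 : IsCoprime (P.coblockPoly i x.t) (P.blockPoly i x.t ^ n) :=
    (IsCoprime.prod_left fun k hk =>
      h.isCoprime_blockPoly x (Finset.ne_of_mem_erase hk)).pow_right
  obtain ⟨u, v, huv⟩ := h1
  have h2 := congrArg (fun q => (M.sub (P.incl i)).lev n W (aeval (P.toPart i W x.t) q)) huv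
  simp only [map_add, map_mul, map_one] at h2
  rw [show (M.sub (P.incl i)).lev n W (aeval (P.toPart i W x.t) (P.blockPoly i x.t ^ n)) = 0 from
    aeval_blockPoly_pow_mem i x.t n, mul_zero, add_zero, mul_comm] at h2
  exact IsUnit.of_mul_eq_one _ h2

/-- Gluing the equations of all blocks gives a function vanishing on `Σ`, and `s` divides a power of
it. On block `k`, then, `s` divides a power of the equation of that block, which is a
nonzerodivisor. -/
theorem Splits.eq_zero_of_toPart_off_mul (h : P.Splits W) (hW : IsAffineOpen W)
    [Nontrivial (M.A W)] (x : M.Coordinate W) {s : M.R W} (hs : s ∈ M.off W) (k : I)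
    (z : (M.sub (P.incl k)).R W) (hz : P.toPart k W s * z = 0) : z = 0 := by
  obtain ⟨u, hu⟩ := h.exists_toPart_eq fun k => aeval (P.toPart k W x.t) (P.blockPoly k x.t)
  obtain ⟨c, hc⟩ := exists_dvd_pow_of_mem_off hW hs
  obtain ⟨w, hw⟩ := hc u (h.mem_van fun k => by
    rw [hu, ← pow_one (P.blockPoly k x.t)]
    exact aeval_blockPoly_pow_mem k x.t 1)
  refine (h.coordinate x k).eq_zero_of_pow_mul (k := c) (z := z) ?_
  have h1 := congrArg (P.toPart k W) hw
  rw [map_pow, hu, map_mul] at h1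
  change aeval (P.toPart k W x.t) (P.blockPoly k x.t) ^ c * z = 0
  rw [h1, mul_right_comm, hz, zero_mul]

/-- `IsExtension` provides only one presentation `b / s` of `g`. Any other presentation has the same
properties: cross-multiply, restrict to a block and cancel `s`. Here `r` may be any formal function,
in particular a power of the equation. -/
theorem IsExtension.of_mul_eq (h : P.Splits W) (hW : IsAffineOpen W) [Nontrivial (M.A W)]
    (x : M.Coordinate W) {i : I} {f : (M.sub (P.incl i)).K W} {g : M.K W}
    (e : P.IsExtension i f g) {r a : M.R W} (hr : g * algebraMap _ _ r = algebraMap _ _ a) :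
    f * algebraMap _ _ (P.toPart i W r) = algebraMap _ _ (P.toPart i W a) ∧
      ∀ k, k ≠ i → P.toPart k W a = 0 := by
  obtain ⟨b, s, hs, h1, h2, h3⟩ := e
  have h4 : b * r = a * s := by
    apply x.eq_of_algebraMap_eq hW
    rw [map_mul, map_mul, ← hr, ← h1]; ring
  constructor
  · rw [← sub_eq_zero]
    refine (h.coordinate x i).eq_zero_of_mul hW (h.eq_zero_of_toPart_off_mul hW x hs i) ?_
    have h5 := congrArg (P.toPart i W) h4
    rw [map_mul, map_mul] at h5
    have h6 := congrArg (algebraMap _ ((M.sub (P.incl i)).K W)) h5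
    rw [map_mul, map_mul, ← h2] at h6
    linear_combination h6
  · intro k hk
    refine h.eq_zero_of_toPart_off_mul hW x hs k _ ?_
    rw [← map_mul, mul_comm, ← h4, map_mul, h3 k hk, zero_mul]

/-- The numerator of an extension by zero vanishes on the other blocks, so `p` is divisible there by
their equations to the order of the approximation. The factor of `F^n` coming from those blocks is a
unit on block `i` and cancels against the same factor of `p`. -/
theorem IsExtension.isApprox (h : P.Splits W) (hW : IsAffineOpen W) [Nontrivial (M.A W)]
    (x : M.Coordinate W) {i : I} {f : (M.sub (P.incl i)).K W} {g : M.K W}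
    (e : P.IsExtension i f g) {n : ℕ} {p : (M.A W)[X]} (hp : x.IsApprox n p g) :
    ∃ p', p = P.coblockPoly i x.t ^ n * p' ∧ (h.coordinate x i).IsApprox n p' f := by
  classical
  obtain ⟨a, ha, hap⟩ := hp
  obtain ⟨h1, h2⟩ := e.of_mul_eq h hW x (r := aeval x.t x.F ^ n) (by rw [← ha])
  have h3 : P.coblockPoly i x.t ^ (2 * n + 1) ∣ p := by
    rw [coblockPoly, ← Finset.prod_pow]
    refine Finset.prod_dvd_of_coprime (fun k _ k' _ hk => (h.isCoprime_blockPoly x hk).pow)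
      fun k hk => ?_
    refine ((h.coordinate x k).lev_eq_zero_iff (2 * n + 1) p).1 ?_
    have h4 := toPart_mem_van (P := P) k hap
    rw [map_sub, h2 k (Finset.ne_of_mem_erase hk), zero_sub, neg_mem_iff, toPart_aeval] at h4
    exact h4
  -- Only `n` of the `2 * n + 1` available factors are extracted: these match the denominator `F^n`.
  obtain ⟨p', rfl⟩ := (pow_dvd_pow _ (by omega : n ≤ 2 * n + 1)).trans h3
  obtain ⟨v, hv⟩ := ((h.isUnit_coblockPoly x i).pow n).exists_right_inv
  refine ⟨p', rfl, P.toPart i W a * v, ?_, ?_⟩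
  · have h5 : P.toPart i W (aeval x.t x.F ^ n) = aeval (P.toPart i W x.t) (P.blockPoly i x.t) ^ n *
        aeval (P.toPart i W x.t) (P.coblockPoly i x.t) ^ n := by
      rw [map_pow, toPart_aeval, ← blockPoly_mul_coblockPoly (P := P) x i, map_mul, mul_pow]
    change f * algebraMap _ _ (aeval (P.toPart i W x.t) (P.blockPoly i x.t) ^ n) = _
    rw [map_mul, ← h1, h5, mul_assoc, ← map_mul, mul_assoc, hv, mul_one]
  · have h4 := Ideal.mul_mem_left _ v (toPart_mem_van (P := P) i hap)
    rw [map_sub, toPart_aeval, map_mul, map_pow] at h4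
    convert h4 using 1
    change _ - aeval (P.toPart i W x.t) p' = _
    linear_combination aeval (P.toPart i W x.t) p' * hv

end Partition

/-! ### Residues of extensions by zero. -/

namespace Collapse

variable {M' M : MarkedCurve} (m : Collapse M' M) {I : Type} (P : Partition M.J I)

/-- The images of the blocks of a partition under a collapse that does not merge blocks. -/
def image (hP : ∀ i i' (a : P.part i) (a' : P.part i'),
    m.π (P.incl i a) = m.π (P.incl i' a') → i = i') : Partition M'.J I where
  part i := {j // ∃ a, m.π (P.incl i a) = j}
  fintype i := Fintype.ofFinite _
  nonempty i := ⟨⟨_, Classical.arbitrary (P.part i), rfl⟩⟩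
  incl i := Subtype.val
  bijective := by
    constructor
    · rintro ⟨i, j, a, rfl⟩ ⟨i', j', a', rfl⟩ h
      obtain rfl := hP i i' a a' h
      simp only at h
      simp only [h]
    · intro j
      obtain ⟨j, rfl⟩ := m.π_surj j
      obtain ⟨⟨i, a⟩, rfl⟩ := P.bijective.2 j
      exact ⟨⟨i, ⟨_, a, rfl⟩⟩, rfl⟩

theorem apply_section (j : M.J) (x : M'.S) : m.F (M'.σ (m.π j) x) = M.σ j (m.f x) := by
  rw [← Scheme.Hom.comp_apply, m.comm, Scheme.Hom.comp_apply]

end Collapse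

namespace Partition

open Polynomial MarkedCurve

variable {M : MarkedCurve} {I : Type} [Fintype I] {P : Partition M.J I} {W : M.S.Opens}

/-- Residues are tested after arbitrary base changes in coordinates of the whole family. Such a
coordinate restricts to one of the block, `isApprox` gives both numerators the common factor `H^n`,
and `ratResidue_mul` removes the roots outside the block. -/
theorem Splits.isResidue_of_isExtension (h : P.Splits W) {i : I} {f g : (M.sub (P.incl i)).K W}
    {f' g' : M.K W} (hf : P.IsExtension i f f') (hg : P.IsExtension i g g') {c : M.A W}
    (H : IsResidue (M := M.sub (P.incl i)) f g c) : IsResidue f' g' c := by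
  intro M' m W' hW' x n p q hp hq
  rcases subsingleton_or_nontrivial (M'.A W'.1) with h0 | h0
  · exact Subsingleton.elim _ _
  -- A nonzero ring of functions gives a point of `W'`. Sections of distinct blocks differ at its
  -- image, so `π` cannot identify them, and the blocks have images forming a partition of `M'.J`.
  obtain ⟨y, hy⟩ : (W'.1 : Set M'.S).Nonempty := by
    by_contra hne
    have : W'.1 = ⊥ := TopologicalSpace.Opens.ext (Set.not_nonempty_iff_eq_empty.1 hne)
    have h0 : Subsingleton (M'.A W'.1) := by rw [this]; infer_instance
    exact not_subsingleton _ h0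
  let P' : Partition M'.J I := m.image P fun i i' a a' e => by
    by_contra hi
    refine h i i' hi a a' (m.f y) (hW' hy) ?_
    rw [← m.apply_section, ← m.apply_section, e]
  have hc : ∀ i a, m.π (P.incl i a) = P'.incl i ⟨_, a, rfl⟩ := fun i a => rfl
  have hP' : P'.Splits W'.1 := by
    rintro k k' hk ⟨_, b, rfl⟩ ⟨_, b', rfl⟩ z hz e
    refine h k k' hk b b' (m.f z) (hW' hz) ?_
    rw [← m.apply_section, ← m.apply_section]
    exact congrArg _ e
  obtain ⟨p', rfl, hp'⟩ := (hf.map m (P' := P') hc hW').isApprox hP' W'.2 x hp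
  obtain ⟨q', rfl, hq'⟩ := (hg.map m (P' := P') hc hW').isApprox hP' W'.2 x hq
  rw [← blockPoly_mul_coblockPoly (P := P') x i, ratResidue_mul (monic_blockPoly i x.t)
    (monic_coblockPoly i x.t)]
  · exact H _ (m.part P P' _ hc i) W' hW' (hP'.coordinate x i) n p' q' hp' hq'
  · rw [natDegree_blockPoly]; exact Fintype.card_pos

theorem Splits.exists_idempotent (h : P.Splits W) :
    ∃ e : I → M.R W, (∀ i, P.toPart i W (e i) = 1) ∧ (∀ i k, k ≠ i → P.toPart k W (e i) = 0) := by
  classical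
  choose e he using fun i => h.exists_toPart_eq (fun k => if k = i then 1 else 0)
  exact ⟨e, fun i => by rw [he, if_pos rfl], fun i k hk => by rw [he, if_neg hk]⟩

theorem IsExtension.idempotent_mul (h : P.Splits W) {e : M.R W} {i : I} (he : P.toPart i W e = 1)
    {f : (M.sub (P.incl i)).K W} {g : M.K W} (hf : P.IsExtension i f g) :
    algebraMap _ _ e * g = g := by
  obtain ⟨a, s, hs, h1, -, h3⟩ := hf
  have h4 : e * a = a := by
    refine h.toPart_injective fun k => ?_
    rw [map_mul]
    by_cases hk : k = i
    · subst hk; rw [he, one_mul]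
    · rw [h3 k hk, mul_zero]
  apply (isUnit_algebraMap_off hs).mul_right_cancel
  rw [mul_assoc, h1, ← map_mul, h4]

/-- The two functions are fixed by the orthogonal idempotents of their blocks. Polynomial lifts of
these idempotents satisfy the hypotheses of `ratResidue_eq_zero_of_dvd`. -/
theorem IsExtension.isResidue_zero (h : P.Splits W) {i k : I} (hik : i ≠ k)
    {f : (M.sub (P.incl i)).K W} {g : (M.sub (P.incl k)).K W} {f' g' : M.K W}
    (hf : P.IsExtension i f f') (hg : P.IsExtension k g g') : IsResidue f' g' 0 := by
  intro M' m W' hW' x n p q hp hq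
  obtain ⟨e, he, he'⟩ := h.exists_idempotent
  -- If a function is fixed by `e`, its numerator is fixed by a polynomial lift of `e`, up to the
  -- precision of the approximation.
  have key : ∀ (e : M.R W) (f' : M.K W) (p : (M'.A W'.1)[X]), algebraMap _ _ e * f' = f' →
      x.IsApprox n p (m.punctured hW' f') → ∀ ε : (M'.A W'.1)[X],
      M'.lev (2 * n + 1) W'.1 (aeval x.t ε) = M'.lev (2 * n + 1) W'.1 (m.formal hW' e) →
      x.F ^ (2 * n + 1) ∣ p - ε * p := by
    rintro e f' p he ⟨a, ha, hap⟩ ε hε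
    have h1 : m.formal hW' e * a = a := by
      apply x.eq_of_algebraMap_eq W'.2
      rw [map_mul, ← ha, ← mul_assoc, ← m.punctured_algebraMap, ← map_mul, he]
    have h2 : M'.lev (2 * n + 1) W'.1 a = M'.lev (2 * n + 1) W'.1 (aeval x.t p) := by
      rw [← sub_eq_zero, ← map_sub]; exact hap
    rw [← x.lev_eq_zero_iff, map_sub, map_sub, map_mul, map_mul, hε, ← h2, ← map_mul, h1, sub_self]
  obtain ⟨ε, hε⟩ := x.lev_surjective (2 * n + 1) (M'.lev _ W'.1 (m.formal hW' (e i)))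
  obtain ⟨δ, hδ⟩ := x.lev_surjective (2 * n + 1) (M'.lev _ W'.1 (m.formal hW' (e k)))
  rw [map_zero]
  refine (ratResidue_eq_zero_of_dvd x.monic ?_
    (key _ _ p (hf.idempotent_mul h (he i)) hp ε hε)
    (key _ _ q (hg.idempotent_mul h (he k)) hq δ hδ)).symm
  have h0 : e i * e k = 0 := h.toPart_injective fun l => by
    rw [map_mul, map_zero]
    by_cases hl : l = i
    · subst hl; rw [he' k l hik, mul_zero]
    · rw [he' i l hl, zero_mul]
  rw [← x.lev_eq_zero_iff, map_mul, map_mul, hε, hδ, ← map_mul, ← map_mul, h0, map_zero, map_zero]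

end Partition

theorem MarkedCurve.complex_smul {M : MarkedCurve} {W : M.S.Opens} (c : ℂ) (f : M.K W) :
    c • f = algebraMap (M.A W) (M.K W) (algebraMap ℂ (M.A W) c) * f := by
  rw [Algebra.smul_def, IsScalarTower.algebraMap_apply ℂ (M.A W) (M.K W)]

theorem MarkedCurve.mem_off_of_dvd {M : MarkedCurve} {W : M.S.Opens} {a b : M.R W} (h : a ∣ b)
    (hb : b ∈ M.off W) : a ∈ M.off W := by
  obtain ⟨k, hk⟩ := hb
  refine ⟨k, fun M' m W' hW => (hk M' m W' hW).trans ?_⟩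
  rw [Ideal.span_singleton_le_span_singleton]
  exact map_dvd _ h

/-! ### Existence, uniqueness and algebra of extension by zero. -/

section Fractions

variable {A B : Type*} [CommRing A] [CommRing B] (φ : A →+* B) {a a' s s' : A} {g g' : B}

theorem mul_left_fraction (b : A) (h : g * φ s = φ a) : φ b * g * φ s = φ (b * a) := by
  rw [mul_assoc, h, map_mul]

theorem add_fraction (h : g * φ s = φ a) (h' : g' * φ s' = φ a') :
    (g + g') * φ (s * s') = φ (a * s' + a' * s) := by
  rw [map_add, map_mul, map_mul, map_mul, ← h, ← h']; ring

theorem mul_fraction (h : g * φ s = φ a) (h' : g' * φ s' = φ a') :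
    g * g' * φ (s * s') = φ (a * a') := by
  rw [map_mul, map_mul, ← h, ← h']; ring

theorem cross_fraction (h : g * φ s = φ a) (h' : g * φ s' = φ a') : φ (a * s') = φ (a' * s) := by
  rw [map_mul, map_mul, ← h, ← h']; ring

theorem eq_of_cross_fraction (h : g * φ s = φ a) (h' : g' * φ s' = φ a') (hs : IsUnit (φ s))
    (hs' : IsUnit (φ s')) {t : A} (ht : IsUnit (φ t)) (e : t * (a * s') = t * (a' * s)) :
    g = g' := by
  have e := congrArg φ e
  rw [map_mul, map_mul, map_mul, map_mul, ← h, ← h'] at e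
  apply (hs.mul hs').mul_right_cancel
  apply ht.mul_left_cancel
  linear_combination e

end Fractions

theorem exists_mul_eq_of_isUnit {A : Type*} [CommRing A] {u : A} (hu : IsUnit u) (b : A) :
    ∃ g, g * u = b := by
  obtain ⟨v, rfl⟩ := hu
  exact ⟨b * ↑v⁻¹, by rw [mul_assoc, Units.inv_mul, mul_one]⟩

namespace Partition

open MarkedCurve

variable {M : MarkedCurve} {I : Type} {P : Partition M.J I} {W : M.S.Opens}

theorem IsSeparating.splits (hW : P.IsSeparating W) : P.Splits W := hW.separated

theorem IsExtension.mul_left {i : I} {f : (M.sub (P.incl i)).K W} {g : M.K W}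
    (h : P.IsExtension i f g) (b : M.R W) :
    P.IsExtension i (algebraMap _ _ (P.toPart i W b) * f) (algebraMap _ _ b * g) := by
  obtain ⟨a, s, hs, h1, h2, h3⟩ := h
  refine ⟨b * a, s, hs, mul_left_fraction _ b h1, ?_, fun k hk => ?_⟩
  · rw [map_mul (P.toPart i W)]; exact mul_left_fraction _ _ h2
  · rw [map_mul, h3 k hk, mul_zero]

theorem IsExtension.add {i : I} {f f' : (M.sub (P.incl i)).K W} {g g' : M.K W}
    (h : P.IsExtension i f g) (h' : P.IsExtension i f' g') :
    P.IsExtension i (f + f') (g + g') := by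
  obtain ⟨a, s, hs, h1, h2, h3⟩ := h
  obtain ⟨a', s', hs', h1', h2', h3'⟩ := h'
  refine ⟨a * s' + a' * s, s * s', mul_mem hs hs', add_fraction _ h1 h1', ?_, fun k hk => ?_⟩
  · rw [map_mul (P.toPart i W), map_add (P.toPart i W), map_mul (P.toPart i W),
      map_mul (P.toPart i W)]
    exact add_fraction _ h2 h2'
  · rw [map_add, map_mul, map_mul, h3 k hk, h3' k hk, zero_mul, zero_mul, add_zero]

theorem IsExtension.mul {i : I} {f f' : (M.sub (P.incl i)).K W} {g g' : M.K W}
    (h : P.IsExtension i f g) (h' : P.IsExtension i f' g') :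
    P.IsExtension i (f * f') (g * g') := by
  obtain ⟨a, s, hs, h1, h2, h3⟩ := h
  obtain ⟨a', s', hs', h1', h2', h3'⟩ := h'
  refine ⟨a * a', s * s', mul_mem hs hs', mul_fraction _ h1 h1', ?_, fun k hk => ?_⟩
  · rw [map_mul (P.toPart i W), map_mul (P.toPart i W)]
    exact mul_fraction _ h2 h2'
  · rw [map_mul, h3 k hk, zero_mul]

theorem isExtension_algebraMap {i : I} {b : M.R W} (hb : ∀ k, k ≠ i → P.toPart k W b = 0) :
    P.IsExtension i (algebraMap _ ((M.sub (P.incl i)).K W) (P.toPart i W b))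
      (algebraMap (M.R W) (M.K W) b) :=
  ⟨b, 1, one_mem _, by rw [map_one, mul_one], by rw [map_one, map_one, mul_one], hb⟩

theorem toPart_algebraMap (i : I) (a : M.A W) :
    P.toPart i W (algebraMap (M.A W) (M.R W) a) =
      algebraMap ((M.sub (P.incl i)).A W) ((M.sub (P.incl i)).R W) a :=
  (P.toPartAlg i W).commutes a

theorem IsExtension.smul {i : I} {f : (M.sub (P.incl i)).K W} {g : M.K W}
    (h : P.IsExtension i f g) (a : M.A W) :
    P.IsExtension i (algebraMap ((M.sub (P.incl i)).A W) _ a * f) (algebraMap _ _ a * g) := by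
  have := h.mul_left (algebraMap _ _ a)
  rw [toPart_algebraMap, ← IsScalarTower.algebraMap_apply, ← IsScalarTower.algebraMap_apply] at this
  exact this

theorem IsExtension.smul_complex {i : I} {f : (M.sub (P.incl i)).K W} {g : M.K W}
    (h : P.IsExtension i f g) (c : ℂ) : P.IsExtension i (c • f) (c • g) := by
  have := h.smul (algebraMap ℂ (M.A W) c)
  rw [MarkedCurve.complex_smul, MarkedCurve.complex_smul]
  exact this

/-- Uniqueness of the extension. On block `i` the cross products agree after multiplication by some
`u`, and on the other blocks both numerators vanish. As `u` lives only on the block, it is replaced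
by a power of the equation `t` of the whole family, whose restriction is a multiple of `u`. -/
theorem IsExtension.of_eq [Fintype I] {i : I} {f f' : (M.sub (P.incl i)).K W} {g g' : M.K W}
    (hW : P.IsSeparating W) (h : P.IsExtension i f g) (h' : P.IsExtension i f' g') (e : f = f') :
    g = g' := by
  subst e
  obtain ⟨a, s, hs, h1, h2, h3⟩ := h
  obtain ⟨a', s', hs', h1', h2', h3'⟩ := h'
  obtain ⟨t, ht, htv, -⟩ := Chart.exists_equation ⟨W, hW.whole⟩
  have e1 := cross_fraction _ h2 h2'
  obtain ⟨⟨u, hu⟩, hue⟩ := (IsLocalization.eq_iff_exists ((M.sub (P.incl i)).off W) _).1 e1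
  obtain ⟨k, hk⟩ := exists_dvd_pow_of_mem_off (M := M.sub (P.incl i)) (hW.part i).affine hu
  obtain ⟨y, hy⟩ := hk _ (toPart_mem_van (P := P) i htv)
  have e2 : t ^ k * (a * s') = t ^ k * (a' * s) := by
    refine hW.splits.toPart_injective fun l => ?_
    by_cases hl : l = i
    · subst hl
      have hue' : u * (P.toPart l W a * P.toPart l W s') = u * (P.toPart l W a' * P.toPart l W s) :=
        hue
      simp only [map_mul, map_pow, hy]
      linear_combination y * hue'
    · simp only [map_mul, h3 l hl, h3' l hl, zero_mul]
  exact eq_of_cross_fraction _ h1 h1' (isUnit_algebraMap_off hs) (isUnit_algebraMap_off hs')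
    (isUnit_algebraMap_off (pow_mem ht k)) e2

/-- An equation of block `i`, extended by zero, vanishes on `Σ`, so `t` divides a power of it.
Restricting to the block, `toPart t` divides a power of an admissible denominator. -/
theorem toPart_mem_off [Fintype I] (hW : P.IsSeparating W) {t : M.R W}
    (ht : t ∈ M.off W) (i : I) : P.toPart i W t ∈ (M.sub (P.incl i)).off W := by
  classical
  obtain ⟨s, hs, hsv, -⟩ := Chart.exists_equation (M := M.sub (P.incl i)) ⟨W, hW.part i⟩
  obtain ⟨u, hu⟩ := hW.splits.exists_toPart_eq (Function.update 0 i s)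
  have huv : u ∈ M.van 1 W := hW.splits.mem_van fun l => by
    rw [hu]
    by_cases hl : l = i
    · subst hl; rw [Function.update_self]; exact hsv
    · rw [Function.update_of_ne hl]; exact zero_mem _
  obtain ⟨c, hc⟩ := exists_dvd_pow_of_mem_off (M := M) hW.whole.affine ht
  have h1 := map_dvd (P.toPart i W) (hc u huv)
  rw [map_pow, hu, Function.update_self] at h1
  exact mem_off_of_dvd (M := M.sub (P.incl i)) h1 (pow_mem hs c)

theorem isUnit_algebraMap_toPart [Fintype I] (hW : P.IsSeparating W) {t : M.R W}
    (ht : t ∈ M.off W) (i : I) :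
    IsUnit (algebraMap _ ((M.sub (P.incl i)).K W) (P.toPart i W t)) :=
  isUnit_algebraMap_off (M := M.sub (P.incl i)) (toPart_mem_off hW ht i)

/-- A power of an equation of the whole family serves as denominator, and the numerator is lifted by
zero on the other blocks. -/
theorem exists_isExtension [Fintype I] (hW : P.IsSeparating W) (i : I)
    (f : (M.sub (P.incl i)).K W) : ∃ g, P.IsExtension i f g := by
  classical
  obtain ⟨t, ht, htv, -⟩ := Chart.exists_equation ⟨W, hW.whole⟩
  obtain ⟨k, r, hr⟩ := exists_mul_pow_eq (M := M.sub (P.incl i)) (hW.part i).affine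
    (toPart_mem_van (P := P) i htv) f
  obtain ⟨a, ha⟩ := hW.splits.exists_toPart_eq (Function.update 0 i r)
  obtain ⟨g, hg⟩ := exists_mul_eq_of_isUnit (A := M.K W)
    (isUnit_algebraMap_off (M := M) (pow_mem ht k)) (algebraMap (M.R W) (M.K W) a)
  refine ⟨g, a, t ^ k, pow_mem ht k, hg, ?_, fun l hl => ?_⟩
  · rw [map_pow, hr, ha, Function.update_self]
  · rw [ha, Function.update_of_ne hl, Pi.zero_apply]

/-- Extension by zero of functions on punctured formal neighbourhoods. -/
def extend [Fintype I] (hW : P.IsSeparating W) (i : I) : (M.sub (P.incl i)).K W →ₗ[ℂ] M.K W where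
  toFun f := (exists_isExtension hW i f).choose
  map_add' f g := (exists_isExtension hW i _).choose_spec.of_eq hW
    ((exists_isExtension hW i f).choose_spec.add (exists_isExtension hW i g).choose_spec) rfl
  map_smul' c f := (exists_isExtension hW i _).choose_spec.of_eq hW
    ((exists_isExtension hW i f).choose_spec.smul_complex c) rfl

theorem isExtension_extend [Fintype I] (hW : P.IsSeparating W) (i : I)
    (f : (M.sub (P.incl i)).K W) : P.IsExtension i f (extend hW i f) :=
  (exists_isExtension hW i f).choose_spec

theorem IsExtension.extend_eq [Fintype I] (hW : P.IsSeparating W) {i : I}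
    {f : (M.sub (P.incl i)).K W} {g : M.K W} (h : P.IsExtension i f g) : extend hW i f = g :=
  (isExtension_extend hW i f).of_eq hW h rfl

theorem extend_smul [Fintype I] (hW : P.IsSeparating W) (i : I) (a : M.A W)
    (f : (M.sub (P.incl i)).K W) :
    extend hW i (algebraMap ((M.sub (P.incl i)).A W) _ a * f) = algebraMap _ _ a * extend hW i f :=
  IsExtension.extend_eq hW ((isExtension_extend hW i f).smul a)

theorem extend_mul [Fintype I] (hW : P.IsSeparating W) (i : I) (f g : (M.sub (P.incl i)).K W) :
    extend hW i (f * g) = extend hW i f * extend hW i g :=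
  IsExtension.extend_eq hW ((isExtension_extend hW i f).mul (isExtension_extend hW i g))

theorem extend_mul_extend [Fintype I] (hW : P.IsSeparating W) {i k : I} (hik : i ≠ k)
    (f : (M.sub (P.incl i)).K W) (g : (M.sub (P.incl k)).K W) :
    extend hW i f * extend hW k g = 0 := by
  obtain ⟨e, he, he'⟩ := hW.splits.exists_idempotent
  rw [← (isExtension_extend hW i f).idempotent_mul hW.splits (he i),
    ← (isExtension_extend hW k g).idempotent_mul hW.splits (he k)]
  have h0 : e i * e k = 0 := hW.splits.toPart_injective fun l => by
    rw [map_mul, map_zero]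
    by_cases hl : l = i
    · subst hl; rw [he' k l hik, mul_zero]
    · rw [he' i l hl, zero_mul]
  rw [mul_mul_mul_comm, ← map_mul, h0, map_zero, zero_mul]

theorem toPart_refine {L : I → Type} (Q : ∀ i, Partition (P.part i) (L i)) (l : Σ i, L i)
    (a : M.R W) : (P.refine Q).toPart l W a =
      (Q l.1).toPart (M := M.sub (P.incl l.1)) l.2 W (P.toPart l.1 W a) :=
  MarkedMap.formal_comp (m := P.toMap l.1) (m' := (Q l.1).toMap (M := M.sub (P.incl l.1)) l.2)
    (m'' := (P.refine Q).toMap l) (Category.comp_id _).symm (le_refl W) (le_refl W) (le_refl W) a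

/-- The extension `h'` of `f` in one step restricts to block `i` as a fraction `g'`, which extends
`f` and is extended by `h'`. Uniqueness identifies `g'` with `g` and `h'` with `h`. -/
theorem IsExtension.trans [Fintype I] {L : I → Type} [∀ i, Fintype (L i)]
    {Q : ∀ i, Partition (P.part i) (L i)} (hP : P.IsSeparating W)
    (hQ : ∀ i, Partition.IsSeparating (M := M.sub (P.incl i)) (Q i) W)
    (hPQ : (P.refine Q).IsSeparating W) {i : I} {l : L i}
    {f : ((M.sub (P.incl i)).sub ((Q i).incl l)).K W} {g : (M.sub (P.incl i)).K W} {h : M.K W}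
    (hfg : Partition.IsExtension (M := M.sub (P.incl i)) (Q i) l f g) (hgh : P.IsExtension i g h) :
    Partition.IsExtension (M := M) (P.refine Q) ⟨i, l⟩ f h := by
  obtain ⟨h', a, s, hs, h1, h2, h3⟩ := exists_isExtension (M := M) hPQ ⟨i, l⟩ f
  obtain ⟨g', hg'⟩ := exists_mul_eq_of_isUnit (A := (M.sub (P.incl i)).K W)
    (isUnit_algebraMap_toPart hP hs i)
    (algebraMap ((M.sub (P.incl i)).R W) _ (P.toPart i W a))
  have e1 : Partition.IsExtension (M := M.sub (P.incl i)) (Q i) l f g' := by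
    refine ⟨P.toPart i W a, P.toPart i W s, toPart_mem_off hP hs i, hg', ?_, fun k hk => ?_⟩
    · rw [toPart_refine, toPart_refine] at h2; exact h2
    · rw [← toPart_refine Q ⟨i, k⟩]
      exact h3 ⟨i, k⟩ fun e => hk (eq_of_heq (Sigma.mk.inj e).2)
  have e2 : P.IsExtension i g' h' := by
    refine ⟨a, s, hs, h1, hg', fun k hk => ?_⟩
    refine (hQ k).splits.toPart_injective fun l' => ?_
    rw [map_zero, ← toPart_refine Q ⟨k, l'⟩]
    exact h3 ⟨k, l'⟩ fun e => hk (Sigma.mk.inj e).1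
  obtain rfl := IsExtension.of_eq (M := M.sub (P.incl i)) (hQ i) hfg e1 rfl
  obtain rfl := IsExtension.of_eq hP hgh e2 rfl
  exact ⟨a, s, hs, h1, h2, h3⟩

/-- The block idempotents sum to `1`, and each product `e i * g` is the extension by zero of the
restriction of `g` to block `i`. -/
theorem sum_extend_surjective [Fintype I] (hW : P.IsSeparating W) (g : M.K W) :
    ∃ f : ∀ i, (M.sub (P.incl i)).K W, g = ∑ i, extend hW i (f i) := by
  obtain ⟨e, he, he'⟩ := hW.splits.exists_idempotent
  obtain ⟨t, ht, htv, -⟩ := Chart.exists_equation ⟨W, hW.whole⟩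
  obtain ⟨k, r, hr⟩ := exists_mul_pow_eq (M := M) hW.whole.affine htv g
  have key : ∀ i, ∃ f : (M.sub (P.incl i)).K W, extend hW i f = algebraMap _ _ (e i) * g := by
    intro i
    obtain ⟨f, hf⟩ := exists_mul_eq_of_isUnit (A := (M.sub (P.incl i)).K W)
      (isUnit_algebraMap_toPart hW (pow_mem ht k) i)
      (algebraMap ((M.sub (P.incl i)).R W) _ (P.toPart i W r))
    refine ⟨f, IsExtension.extend_eq hW ⟨e i * r, t ^ k, pow_mem ht k, ?_, ?_, fun l hl => ?_⟩⟩
    · rw [mul_assoc, hr, map_mul]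
    · rw [hf, map_mul, he, one_mul]
    · rw [map_mul, he' i l hl, zero_mul]
  choose f hf using key
  refine ⟨f, ?_⟩
  simp only [hf]
  rw [← Finset.sum_mul, ← map_sum]
  have h1 : ∑ i, e i = 1 := hW.splits.toPart_injective fun l => by
    rw [map_sum, map_one, Finset.sum_eq_single l (fun i _ hi => he' i l hi.symm)
      (fun h => absurd (Finset.mem_univ l) h), he]
  rw [h1, map_one, one_mul]

end Partition

/-! ### Functoriality of enveloping algebras for non-unital maps of functions. -/

/-- A map between functions on punctured formal neighbourhoods, not necessarily unital, which
induces a morphism of enveloping algebras. -/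
structure PuncturedHom (N : MarkedCurve) (V : N.S.Opens) (M : MarkedCurve) (W : M.S.Opens) where
  base : N.A V →+* M.A W
  map : N.K V →ₗ[ℂ] M.K W
  base_algebraMap : ∀ c : ℂ, base (algebraMap ℂ (N.A V) c) = algebraMap ℂ (M.A W) c
  map_base_mul : ∀ (a : N.A V) (f : N.K V),
    map (algebraMap (N.A V) (N.K V) a * f) = algebraMap (M.A W) (M.K W) (base a) * map f
  map_mul : ∀ f g : N.K V, map (f * g) = map f * map g
  isResidue : ∀ {f g : N.K V} {c : N.A V}, MarkedCurve.IsResidue f g c →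
    MarkedCurve.IsResidue (map f) (map g) (base c)
  van : ∀ {n : ℕ} {x : N.R V}, x ∈ N.van n V → ∃ y ∈ M.van n W,
    map (algebraMap (N.R V) (N.K V) x) = algebraMap (M.R W) (M.K W) y

theorem smul_central {𝔤 : Type u} [LieRing 𝔤] [LieAlgebra ℂ 𝔤] {N : MarkedCurve} {V : N.S.Opens}
    (a b : N.A V) : a • (central 𝔤 b : Affine 𝔤 N V) = central 𝔤 (a * b) :=
  Prod.ext (smul_zero a) rfl

theorem smul_affine {𝔤 : Type u} [LieRing 𝔤] [LieAlgebra ℂ 𝔤] {N : MarkedCurve} {V : N.S.Opens}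
    (a : N.A V) (X : 𝔤) (f : N.K V) :
    a • (affine X f : Affine 𝔤 N V) = affine X (algebraMap (N.A V) (N.K V) a * f) :=
  Prod.ext ((TensorProduct.smul_tmul' a f X).trans (by rw [Algebra.smul_def]; rfl)) (smul_zero a)

theorem affine_add {𝔤 : Type u} [LieRing 𝔤] [LieAlgebra ℂ 𝔤] {N : MarkedCurve} {V : N.S.Opens}
    (X : 𝔤) (f g : N.K V) : (affine X (f + g) : Affine 𝔤 N V) = affine X f + affine X g :=
  Prod.ext (TensorProduct.add_tmul f g X) (add_zero 0).symm

theorem affine_zero {𝔤 : Type u} [LieRing 𝔤] [LieAlgebra ℂ 𝔤] {N : MarkedCurve} {V : N.S.Opens}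
    (X : 𝔤) : (affine X 0 : Affine 𝔤 N V) = 0 :=
  Prod.ext (TensorProduct.zero_tmul _ X) rfl

namespace PuncturedHom

variable (𝔤 : Type u) [LieRing 𝔤] [LieAlgebra ℂ 𝔤] (κ : LinearMap.BilinForm ℂ 𝔤)
  {N M : MarkedCurve} {V : N.S.Opens} {W : M.S.Opens} (ε : PuncturedHom N V M W)

/-- The induced map of affine algebras. -/
def affineHom : Affine 𝔤 N V →+ Affine 𝔤 M W :=
  AddMonoidHom.prodMap (TensorProduct.map ε.map LinearMap.id).toAddMonoidHom
    ε.base.toAddMonoidHom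

theorem affineHom_affine (X : 𝔤) (f : N.K V) :
    ε.affineHom 𝔤 (affine X f) = affine X (ε.map f) :=
  Prod.ext rfl (map_zero ε.base)

theorem affineHom_central (a : N.A V) :
    ε.affineHom 𝔤 (central 𝔤 a) = central 𝔤 (ε.base a) :=
  Prod.ext (map_zero (TensorProduct.map ε.map LinearMap.id)) rfl

theorem affineHom_smul (a : N.A V) (x : Affine 𝔤 N V) :
    ε.affineHom 𝔤 (a • x) = ε.base a • ε.affineHom 𝔤 x := by
  induction x using affine_induction with
  | hc b => rw [smul_central, affineHom_central, affineHom_central, smul_central, RingHom.map_mul]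
  | ha X f => rw [smul_affine, affineHom_affine, affineHom_affine, smul_affine, map_base_mul]
  | hadd x y hx hy => rw [smul_add, map_add, hx, hy, map_add, smul_add]

/-- The induced morphism from the tensor algebra. -/
def tensors : Tensors 𝔤 N V →+* Env 𝔤 κ M W :=
  letI : Algebra (N.A V) (Env 𝔤 κ M W) := Algebra.compHom _ ε.base
  (TensorAlgebra.lift (N.A V)
    ({ toFun := fun x => envι 𝔤 κ M W (ε.affineHom 𝔤 x)
       map_add' := fun x y => by rw [map_add, map_add]
       map_smul' := fun a x => by
        rw [affineHom_smul, map_smul]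
        rfl } : Affine 𝔤 N V →ₗ[N.A V] Env 𝔤 κ M W)).toRingHom

theorem tensors_ι (x : Affine 𝔤 N V) :
    ε.tensors 𝔤 κ (tι 𝔤 N V x) = envι 𝔤 κ M W (ε.affineHom 𝔤 x) :=
  letI : Algebra (N.A V) (Env 𝔤 κ M W) := Algebra.compHom _ ε.base
  TensorAlgebra.lift_ι_apply _ x

/-- The residue enters the relations only through `IsResidue`. A map preserving this predicate,
products of functions and scalars therefore respects them. -/
theorem tensors_rel {x y : Tensors 𝔤 N V} (hxy : EnvRel 𝔤 κ N V x y) :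
    ε.tensors 𝔤 κ x = ε.tensors 𝔤 κ y := by
  cases hxy with
  | bracket X Y f g c hc =>
    simp only [map_sub, RingHom.map_mul, map_add, tensors_ι, affineHom_affine, affineHom_central]
    rw [envι_bracket X Y _ _ _ (ε.isResidue hc), envι_level, ε.map_mul]
    congr 2
    rw [Algebra.smul_def, Algebra.smul_def, RingHom.map_mul, ε.base_algebraMap]
  | central x =>
    simp only [map_sub, RingHom.map_mul, tensors_ι, affineHom_central, map_zero]
    rw [envι_level, sub_eq_zero]
    exact Algebra.commutes _ _
  | level =>
    rw [tensors_ι, affineHom_central, envι_level, map_one, map_one, map_one]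

/-- The induced morphism of enveloping algebras. -/
def env : Env 𝔤 κ N V →+* Env 𝔤 κ M W :=
  RingQuot.lift ⟨ε.tensors 𝔤 κ, fun _ _ hxy => ε.tensors_rel 𝔤 κ hxy⟩

theorem env_ι (x : Affine 𝔤 N V) :
    ε.env 𝔤 κ (envι 𝔤 κ N V x) = envι 𝔤 κ M W (ε.affineHom 𝔤 x) := by
  have := RingQuot.lift_mkRingHom_apply (r := EnvRel 𝔤 κ N V) (ε.tensors 𝔤 κ)
    (fun _ _ hxy => ε.tensors_rel 𝔤 κ hxy) (tι 𝔤 N V x)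
  rw [← tensors_ι, ← this, ← RingQuot.mkAlgHom_coe (N.A V)]
  rfl

theorem env_algebraMap (a : N.A V) :
    ε.env 𝔤 κ (algebraMap _ _ a) = algebraMap _ _ (ε.base a) := by
  rw [← envι_level, env_ι, affineHom_central, envι_level]

theorem env_nhd {n : ℕ} {a : Env 𝔤 κ N V} (ha : a ∈ envNhd 𝔤 κ N V n) :
    ε.env 𝔤 κ a ∈ envNhd 𝔤 κ M W n := by
  suffices envNhd 𝔤 κ N V n ≤ (envNhd 𝔤 κ M W n).comap (ε.env 𝔤 κ) from this ha
  refine Ideal.span_le.2 ?_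
  rintro _ ⟨x, hx, X, rfl⟩
  obtain ⟨y, hy, e⟩ := ε.van hx
  refine Ideal.subset_span ⟨y, hy, X, ?_⟩
  rw [env_ι, affineHom_affine, e]

variable {C : N.Chart} {D : M.Chart} (ε : PuncturedHom N C.W M D.W)

/-- The induced morphism of enveloping algebras, over charts. -/
def chartEnv : ChartEnv 𝔤 κ C →+* ChartEnv 𝔤 κ D := ε.env 𝔤 κ

theorem continuous_chartEnv : Continuous (ε.chartEnv 𝔤 κ) := by
  refine continuous_of_continuousAt_zero (ε.chartEnv 𝔤 κ) ?_
  rw [ContinuousAt, map_zero]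
  refine ((chartNhd_basis 𝔤 κ C).hasBasis_nhds_zero.tendsto_iff
    (chartNhd_basis 𝔤 κ D).hasBasis_nhds_zero).2 fun n _ => ⟨n, trivial, fun x hx => ?_⟩
  exact ε.env_nhd 𝔤 κ hx

/-- The induced morphism of completed enveloping algebras. -/
def completed : Completed 𝔤 κ C →+* Completed 𝔤 κ D :=
  UniformSpace.Completion.mapRingHom (ε.chartEnv 𝔤 κ) (ε.continuous_chartEnv 𝔤 κ)

theorem continuous_completed : Continuous (ε.completed 𝔤 κ) :=
  UniformSpace.Completion.continuous_map

theorem completed_toCompleted (a : ChartEnv 𝔤 κ C) :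
    ε.completed 𝔤 κ (toCompleted 𝔤 κ C a) = toCompleted 𝔤 κ D (ε.chartEnv 𝔤 κ a) :=
  UniformSpace.Completion.mapRingHom_coe (ε.continuous_chartEnv 𝔤 κ) a

theorem completed_gen (X : 𝔤) (f : N.K C.W) :
    ε.completed 𝔤 κ (gen 𝔤 κ C X f) = gen 𝔤 κ D X (ε.map f) :=
  (ε.completed_toCompleted 𝔤 κ _).trans (congrArg (toCompleted 𝔤 κ D)
    ((ε.env_ι 𝔤 κ _).trans (congrArg (envι 𝔤 κ M D.W) (ε.affineHom_affine 𝔤 X f))))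

theorem completed_algebraMap (a : N.A C.W) :
    ε.completed 𝔤 κ (algebraMap _ _ a) = algebraMap _ _ (ε.base a) :=
  (ε.completed_toCompleted 𝔤 κ (algebraMap _ _ a)).trans
    (congrArg (toCompleted 𝔤 κ D) (ε.env_algebraMap 𝔤 κ a))

end PuncturedHom

/-! ### Topological generators of the completed enveloping algebra. -/

section Completed

variable {𝔤 : Type u} [LieRing 𝔤] [LieAlgebra ℂ 𝔤] {κ : LinearMap.BilinForm ℂ 𝔤}
  {M : MarkedCurve} {C : M.Chart}

theorem completedMap_gen {M' : MarkedCurve} (m : Collapse M' M) {C' : M'.Chart}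
    (h : C'.W ≤ m.f ⁻¹ᵁ C.W) (X : 𝔤) (f : M.K C.W) :
    completedMap 𝔤 κ m h (gen 𝔤 κ C X f) = gen 𝔤 κ C' X (m.punctured h f) :=
  (completedMap_toCompleted 𝔤 κ m h _).trans (congrArg (toCompleted 𝔤 κ C')
    ((envMap_ι 𝔤 κ m h _).trans (congrArg (envι 𝔤 κ M' C'.W) (affineMap_affine 𝔤 m h X f))))

theorem completedMap_algebraMap {M' : MarkedCurve} (m : Collapse M' M) {C' : M'.Chart}
    (h : C'.W ≤ m.f ⁻¹ᵁ C.W) (a : M.A C.W) :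
    completedMap 𝔤 κ m h (algebraMap _ _ a) = algebraMap _ _ (m.base h a) :=
  (completedMap_toCompleted 𝔤 κ m h (algebraMap _ _ a)).trans
    (congrArg (toCompleted 𝔤 κ C') (envMap_algebraMap 𝔤 κ m h a))

/-- The completed enveloping algebra is topologically generated by `𝒪_S` and the `X ⊗ f`. -/
theorem completed_gen_induction {P : Completed 𝔤 κ C → Prop} (hP : IsClosed {x | P x})
    (halg : ∀ a, P (algebraMap (M.A C.W) _ a)) (hgen : ∀ X f, P (gen 𝔤 κ C X f))
    (hmul : ∀ a b, P a → P b → P (a * b)) (hadd : ∀ a b, P a → P b → P (a + b))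
    (x : Completed 𝔤 κ C) : P x := by
  refine completed_induction 𝔤 κ hP (fun a => ?_) x
  refine env_induction (𝔤 := 𝔤) (κ := κ) (P := fun a => P (toCompleted 𝔤 κ C a)) halg hgen
    (fun a b ha hb => ?_) (fun a b ha hb => ?_) a
  · exact ((map_mul (toCompleted 𝔤 κ C) a b).symm ▸ hmul _ _ ha hb :)
  · exact ((map_add (toCompleted 𝔤 κ C) a b).symm ▸ hadd _ _ ha hb :)

/-- Continuous morphisms out of the completed enveloping algebra are determined by generators. -/
theorem completed_hom_ext {B : Type*} [Ring B] [TopologicalSpace B] [T2Space B]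
    {φ ψ : Completed 𝔤 κ C →+* B} (hφ : Continuous φ) (hψ : Continuous ψ)
    (halg : ∀ a, φ (algebraMap (M.A C.W) _ a) = ψ (algebraMap (M.A C.W) _ a))
    (hgen : ∀ X f, φ (gen 𝔤 κ C X f) = ψ (gen 𝔤 κ C X f)) : φ = ψ :=
  RingHom.ext fun x => completed_gen_induction (P := fun x => φ x = ψ x) (isClosed_eq hφ hψ)
    halg hgen (fun a b ha hb => by simp only [map_mul, ha, hb])
    (fun a b ha hb => by simp only [map_add, ha, hb]) x

theorem gen_add (X : 𝔤) (f g : M.K C.W) :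
    gen 𝔤 κ C X (f + g) = gen 𝔤 κ C X f + gen 𝔤 κ C X g := by
  rw [gen, affine_add, map_add, map_add]; rfl

theorem gen_zero (X : 𝔤) : gen 𝔤 κ C X 0 = 0 := by
  rw [gen, affine_zero, map_zero, map_zero]

theorem gen_sum {ι : Type*} (s : Finset ι) (X : 𝔤) (f : ι → M.K C.W) :
    gen 𝔤 κ C X (∑ i ∈ s, f i) = ∑ i ∈ s, gen 𝔤 κ C X (f i) :=
  map_sum (AddMonoidHom.mk' (gen 𝔤 κ C X) (gen_add X)) f s

theorem gen_base_mul (X : 𝔤) (a : M.A C.W) (f : M.K C.W) :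
    gen 𝔤 κ C X (algebraMap (M.A C.W) (M.K C.W) a * f) = algebraMap _ _ a * gen 𝔤 κ C X f := by
  rw [gen, ← smul_affine, map_smul, Algebra.smul_def, map_mul]; rfl

/-- Elements `X ⊗ f` and `Y ⊗ g` with `f g = 0` and vanishing residue commute. -/
theorem commute_gen (X Y : 𝔤) {f g : M.K C.W} (h : f * g = 0)
    (hc : MarkedCurve.IsResidue g f 0) : Commute (gen 𝔤 κ C X f) (gen 𝔤 κ C Y g) := by
  have e := envι_bracket (κ := κ) X Y f g 0 hc
  rw [h, affine_zero, smul_zero, map_zero, map_zero, add_zero, sub_eq_zero] at e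
  exact ((map_mul (toCompleted 𝔤 κ C) _ _).symm.trans (congrArg (toCompleted 𝔤 κ C) e)).trans
    (map_mul (toCompleted 𝔤 κ C) _ _)

end Completed

/-- Commutation is a closed condition, stable under sums and products in each variable, so
generators suffice. Scalars are central, and the two hypotheses kill both terms of the bracket of `X
⊗ f` and `Y ⊗ g`. -/
theorem PuncturedHom.commute_completed (𝔤 : Type u) [LieRing 𝔤] [LieAlgebra ℂ 𝔤]
    (κ : LinearMap.BilinForm ℂ 𝔤) {N N' M : MarkedCurve} {C : N.Chart} {C' : N'.Chart}
    {D : M.Chart} (ε : PuncturedHom N C.W M D.W) (ε' : PuncturedHom N' C'.W M D.W)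
    (h : ∀ f g, ε.map f * ε'.map g = 0)
    (hc : ∀ f g, MarkedCurve.IsResidue (ε'.map g) (ε.map f) 0)
    (x : Completed 𝔤 κ C) (y : Completed 𝔤 κ C') :
    Commute (ε.completed 𝔤 κ x) (ε'.completed 𝔤 κ y) := by
  refine completed_gen_induction (P := fun x => Commute (ε.completed 𝔤 κ x)
    (ε'.completed 𝔤 κ y)) ?_ ?_ ?_ ?_ ?_ x
  · exact isClosed_eq ((ε.continuous_completed 𝔤 κ).mul continuous_const)
      (continuous_const.mul (ε.continuous_completed 𝔤 κ))
  · intro a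
    rw [completed_algebraMap]
    exact Algebra.commutes _ _
  · intro X f
    rw [completed_gen]
    refine completed_gen_induction (P := fun y => Commute _ (ε'.completed 𝔤 κ y)) ?_ ?_ ?_ ?_ ?_ y
    · exact isClosed_eq (continuous_const.mul (ε'.continuous_completed 𝔤 κ))
        ((ε'.continuous_completed 𝔤 κ).mul continuous_const)
    · intro a
      rw [completed_algebraMap]
      exact (Algebra.commutes _ _).symm
    · intro Y g
      rw [completed_gen]
      exact commute_gen X Y (h f g) (hc f g)
    · intro a b ha hb
      rw [RingHom.map_mul]; exact ha.mul_right hb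
    · intro a b ha hb
      rw [map_add]; exact ha.add_right hb
  · intro a b ha hb
    rw [RingHom.map_mul]; exact ha.mul_left hb
  · intro a b ha hb
    rw [map_add]; exact ha.add_left hb

/-! ### Insertion of one block into the whole family. -/

namespace Partition

open MarkedCurve

variable {M : MarkedCurve} {I : Type} [Fintype I] {P : Partition M.J I} {W : M.S.Opens}

/-- A separating open subset as a chart for the whole family. -/
abbrev IsSeparating.wholeChart (hW : P.IsSeparating W) : M.Chart := ⟨W, hW.whole⟩

/-- A separating open subset as a chart for a subfamily. -/
abbrev IsSeparating.partChart (hW : P.IsSeparating W) (i : I) : (M.sub (P.incl i)).Chart :=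
  ⟨W, hW.part i⟩

/-- Extension by zero, as a morphism of functions on punctured formal neighbourhoods. -/
def extendHom (hW : P.IsSeparating W) (i : I) : PuncturedHom (M.sub (P.incl i)) W M W where
  base := RingHom.id (M.A W)
  map := extend hW i
  base_algebraMap _ := rfl
  map_base_mul := extend_smul hW i
  map_mul := extend_mul hW i
  isResidue H := hW.splits.isResidue_of_isExtension (isExtension_extend hW i _)
    (isExtension_extend hW i _) H
  van {n x} hx := by
    classical
    -- The extension by zero of a formal function is formal, and vanishes to the same order since it
    -- is zero on the other blocks.
    obtain ⟨y, hy⟩ := hW.splits.exists_toPart_eq (Function.update 0 i x)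
    refine ⟨y, hW.splits.mem_van fun l => ?_, IsExtension.extend_eq hW ?_⟩
    · rw [hy]
      by_cases hl : l = i
      · subst hl; rw [Function.update_self]; exact hx
      · rw [Function.update_of_ne hl]; exact zero_mem _
    · have := isExtension_algebraMap (P := P) (i := i) (b := y) fun k hk => by
        rw [hy, Function.update_of_ne hk, Pi.zero_apply]
      rwa [hy, Function.update_self] at this

variable (𝔤 : Type u) [LieRing 𝔤] [LieAlgebra ℂ 𝔤] (κ : LinearMap.BilinForm ℂ 𝔤)
  (hW : P.IsSeparating W)

/-- The morphism `X ⊗ f ↦ X ⊗ f̃` of completed enveloping algebras, where `f̃` is the extension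
by zero of `f`. -/
def insertHom (i : I) :
    Completed 𝔤 κ (hW.partChart i) →+* Completed 𝔤 κ hW.wholeChart :=
  PuncturedHom.completed 𝔤 κ (C := hW.partChart i) (D := hW.wholeChart) (extendHom hW i)

theorem continuous_insertHom (i : I) : Continuous (insertHom 𝔤 κ hW i) :=
  PuncturedHom.continuous_completed 𝔤 κ (C := hW.partChart i) (D := hW.wholeChart) (extendHom hW i)

theorem insertHom_gen (i : I) (X : 𝔤) {f : (M.sub (P.incl i)).K W} {g : M.K W}
    (h : P.IsExtension i f g) :
    insertHom 𝔤 κ hW i (gen 𝔤 κ (hW.partChart i) X f) =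
      gen 𝔤 κ hW.wholeChart X g := by
  rw [← h.extend_eq hW]
  exact PuncturedHom.completed_gen 𝔤 κ (C := hW.partChart i) (D := hW.wholeChart) (extendHom hW i)
    X f

/-- The morphism `X ⊗ f ↦ X ⊗ f̃`, as a morphism of algebras. -/
def insertAlgHom (i : I) : (envelope 𝔤 κ (M.sub (P.incl i))).obj ⟨W, hW.part i⟩ →ₐ[M.A W]
    (envelope 𝔤 κ M).obj ⟨W, hW.whole⟩ where
  __ := insertHom 𝔤 κ hW i
  commutes' a := PuncturedHom.completed_algebraMap 𝔤 κ (C := hW.partChart i) (D := hW.wholeChart)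
    (extendHom hW i) a

theorem continuous_insertAlgHom (i : I) : Continuous (insertAlgHom 𝔤 κ hW i) :=
  continuous_insertHom 𝔤 κ hW i

/-- Extensions by zero from distinct blocks have product zero and residue zero. -/
theorem commute_insertAlgHom {i k : I} (hik : i ≠ k)
    (x : (envelope 𝔤 κ (M.sub (P.incl i))).obj ⟨W, hW.part i⟩)
    (y : (envelope 𝔤 κ (M.sub (P.incl k))).obj ⟨W, hW.part k⟩) :
    Commute (insertAlgHom 𝔤 κ hW i x) (insertAlgHom 𝔤 κ hW k y) :=
  PuncturedHom.commute_completed 𝔤 κ (C := hW.partChart i) (C' := hW.partChart k)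
    (D := hW.wholeChart) (extendHom hW i) (extendHom hW k)
    (fun f g => extend_mul_extend hW hik f g) (fun f g => IsExtension.isResidue_zero hW.splits
      hik.symm (isExtension_extend hW k g) (isExtension_extend hW i f)) x y

end Partition

/-! ### Tensor products of topological algebras and commuting morphisms. -/

section Bang

open scoped Topology

variable {I : Type} {R : Type} [CommRing R] {B : I → Type u} [∀ i, Ring (B i)]
  [∀ i, Algebra R (B i)]

/-- This puts the factor `i` on the right, turning multilinearity and ideal membership into
statements about a single factor. -/
theorem update_eq_update_mul_mulSingle [DecidableEq I] (b : ∀ i, B i) (i : I) (x : B i) :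
    Function.update b i x = Function.update b i 1 * Pi.mulSingle i x := by
  funext j
  by_cases hj : j = i
  · subst hj
    rw [Pi.mul_apply, Function.update_self, Function.update_self, Pi.mulSingle_eq_same, one_mul]
  · rw [Pi.mul_apply, Function.update_of_ne hj, Function.update_of_ne hj,
      Pi.mulSingle_eq_of_ne hj, mul_one]

section Lift

variable [Fintype I] {S : Type u} [Ring S] [Algebra R S] (ψ : ∀ i, B i →ₐ[R] S)
  (hψ : Pairwise fun i j => ∀ x y, Commute (ψ i x) (ψ j y))

/-- The product of commuting morphisms of algebras. -/
def commutingHom : (∀ i, B i) →* S :=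
  MonoidHom.noncommPiCoprod (fun i => (ψ i : B i →* S)) hψ

theorem commutingHom_mulSingle [DecidableEq I] (i : I) (x : B i) :
    commutingHom ψ hψ (Pi.mulSingle i x) = ψ i x :=
  MonoidHom.noncommPiCoprod_mulSingle (hcomm := hψ) _ i x

/-- The product of commuting morphisms of algebras, as a multilinear map. -/
def commutingProd : MultilinearMap R B S where
  toFun := commutingHom ψ hψ
  map_update_add' b i x y := by
    rw [update_eq_update_mul_mulSingle b i (x + y), update_eq_update_mul_mulSingle b i x,
      update_eq_update_mul_mulSingle b i y, map_mul, map_mul, map_mul,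
      commutingHom_mulSingle, commutingHom_mulSingle, commutingHom_mulSingle, ← mul_add,
      map_add (ψ i)]
  map_update_smul' b i r x := by
    rw [update_eq_update_mul_mulSingle b i (r • x), update_eq_update_mul_mulSingle b i x,
      map_mul, map_mul, commutingHom_mulSingle, commutingHom_mulSingle, ← mul_smul_comm,
      map_smul (ψ i)]

/-- The morphism out of a tensor product of algebras given by commuting morphisms. -/
def bangLift : (⨂[R] i, B i) →ₐ[R] S :=
  PiTensorProduct.liftAlgHom (commutingProd ψ hψ)
    (map_one (commutingHom ψ hψ)) (map_mul (commutingHom ψ hψ))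

theorem bangLift_tprod (b : ∀ i, B i) : bangLift ψ hψ (PiTensorProduct.tprod R b) =
    commutingHom ψ hψ b :=
  PiTensorProduct.lift.tprod (φ := commutingProd ψ hψ) b

theorem bangLift_mulSingle [DecidableEq I] (i : I) (x : B i) :
    bangLift ψ hψ (PiTensorProduct.tprod R (Pi.mulSingle i x)) = ψ i x :=
  (bangLift_tprod ψ hψ _).trans (commutingHom_mulSingle ψ hψ i x)

/-- Since the images commute, the `i`-th factor can be written last in the product, and `L` is a
left ideal. -/
theorem bangLift_mem {L : Ideal S} {b : ∀ i, B i} {i : I} (h : ψ i (b i) ∈ L) :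
    bangLift ψ hψ (PiTensorProduct.tprod R b) ∈ L := by
  classical
  have e : b = Function.update b i 1 * Pi.mulSingle i (b i) := by
    rw [← update_eq_update_mul_mulSingle, Function.update_eq_self]
  rw [e, ← PiTensorProduct.tprod_mul_tprod, map_mul, bangLift_mulSingle]
  exact Ideal.mul_mem_left _ _ h

end Lift

/-- The inclusion of a factor into a tensor product. -/
def bangSingle [DecidableEq I] (i : I) : B i →+ ⨂[R] i, B i :=
  (PiTensorProduct.singleAlgHom (R := R) i : B i →ₐ[R] ⨂[R] i, B i)

section Map

variable {B' : I → Type u} [∀ i, Ring (B' i)] [∀ i, Algebra R (B' i)]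
  (f : ∀ i, B i →ₐ[R] B' i)

/-- The tensor product of morphisms of algebras. -/
def bangMap : (⨂[R] i, B i) →ₐ[R] ⨂[R] i, B' i :=
  PiTensorProduct.liftAlgHom ((PiTensorProduct.tprod R).compLinearMap fun i => (f i).toLinearMap)
    (congrArg (PiTensorProduct.tprod R) (funext fun i => map_one (f i))) fun x y =>
      (congrArg (PiTensorProduct.tprod R) (funext fun i => map_mul (f i) (x i) (y i))).trans
        (PiTensorProduct.tprod_mul_tprod _ _).symm

theorem bangMap_tprod (b : ∀ i, B i) : bangMap f (PiTensorProduct.tprod R b) =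
    PiTensorProduct.tprod R fun i => f i (b i) :=
  PiTensorProduct.lift.tprod b

end Map

variable [∀ i, TopologicalSpace (B i)]

/-- The neighbourhoods of zero in a tensor product defined by open submodules of the factors. -/
def bangNhd (N : ∀ i, Submodule R (B i)) : Submodule R (⨂[R] i, B i) :=
  Submodule.span R {z | ∃ b : ∀ i, B i, (∃ i, b i ∈ N i) ∧ z = PiTensorProduct.tprod R b}

theorem isTopologicalAddGroup_bot (Q : Type*) [AddGroup Q] : @IsTopologicalAddGroup Q ⊥ _ :=
  let := (⊥ : TopologicalSpace Q)
  have : DiscreteTopology Q := ⟨rfl⟩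
  { continuous_add := continuous_of_discreteTopology
    continuous_neg := continuous_of_discreteTopology }

theorem isTopologicalAddGroup_induced_mkQ {R E : Type*} [CommRing R] [AddCommGroup E] [Module R E]
    (N : Submodule R E) : @IsTopologicalAddGroup E (TopologicalSpace.induced N.mkQ ⊥) _ := by
  let : TopologicalSpace (E ⧸ N) := ⊥
  have := isTopologicalAddGroup_bot (E ⧸ N)
  exact topologicalAddGroup_induced N.mkQ

/-- The quotient by `N` is discrete, so continuity at zero means landing in `N` near zero. -/
theorem continuous_to_induced_mkQ {R E F : Type*} [CommRing R] [AddCommGroup E] [Module R E]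
    (N : Submodule R E) [AddGroup F] [TopologicalSpace F] [IsTopologicalAddGroup F] (φ : F →+ E)
    (h : ∀ᶠ x in 𝓝 (0 : F), φ x ∈ N) :
    @Continuous _ _ _ (TopologicalSpace.induced N.mkQ ⊥) φ := by
  refine continuous_induced_rng.2 ?_
  let : TopologicalSpace (E ⧸ N) := ⊥
  have : DiscreteTopology (E ⧸ N) := ⟨rfl⟩
  have := isTopologicalAddGroup_bot (E ⧸ N)
  refine continuous_of_continuousAt_zero (N.mkQ.toAddMonoidHom.comp φ) ?_
  rw [ContinuousAt, map_zero, nhds_discrete (E ⧸ N), Filter.tendsto_pure]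
  filter_upwards [h] with x hx
  exact (Submodule.Quotient.mk_eq_zero _).2 hx

theorem isTopologicalAddGroup_bangTopology :
    @IsTopologicalAddGroup (⨂[R] i, B i) (bangTopology R B) _ :=
  topologicalAddGroup_iInf fun N => topologicalAddGroup_iInf fun _ =>
    isTopologicalAddGroup_induced_mkQ (bangNhd N)

theorem bangNhd_mem_nhds {N : ∀ i, Submodule R (B i)} (hN : ∀ i, IsOpen (N i : Set (B i))) :
    (bangNhd N : Set (⨂[R] i, B i)) ∈ @nhds _ (bangTopology R B) 0 := by
  let := bangTopology R B
  refine IsOpen.mem_nhds ?_ (zero_mem _)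
  have h1 : bangTopology R B ≤ TopologicalSpace.induced (bangNhd N).mkQ ⊥ :=
    iInf₂_le (f := fun (N : ∀ i, Submodule R (B i)) (_ : ∀ i, IsOpen (N i : Set (B i))) =>
      TopologicalSpace.induced (bangNhd N).mkQ ⊥) N hN
  refine h1 _ ?_
  let : TopologicalSpace ((⨂[R] i, B i) ⧸ bangNhd N) := ⊥
  exact ⟨{0}, trivial, Set.ext fun x => by simp⟩

theorem continuous_bang {E : Type*} [AddGroup E] [TopologicalSpace E] [IsTopologicalAddGroup E]
    (φ : (⨂[R] i, B i) →+ E) (h : ∀ U ∈ 𝓝 (0 : E), ∃ N : ∀ i, Submodule R (B i),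
      (∀ i, IsOpen (N i : Set (B i))) ∧ ∀ x ∈ bangNhd N, φ x ∈ U) :
    @Continuous _ _ (bangTopology R B) _ φ := by
  let := bangTopology R B
  have := isTopologicalAddGroup_bangTopology (R := R) (B := B)
  refine continuous_of_continuousAt_zero φ ?_
  rw [ContinuousAt, map_zero]
  intro U hU
  obtain ⟨N, hN, hx⟩ := h U hU
  exact Filter.mem_map.2 (Filter.mem_of_superset (bangNhd_mem_nhds hN) hx)

theorem continuous_to_bang {E : Type*} [AddGroup E] [TopologicalSpace E] [IsTopologicalAddGroup E]
    (φ : E →+ ⨂[R] i, B i) (h : ∀ N : ∀ i, Submodule R (B i),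
      (∀ i, IsOpen (N i : Set (B i))) → ∀ᶠ x in 𝓝 (0 : E), φ x ∈ bangNhd N) :
    @Continuous _ _ _ (bangTopology R B) φ := by
  exact continuous_iInf_rng.2 fun N => continuous_iInf_rng.2 fun hN =>
    continuous_to_induced_mkQ (bangNhd N) φ (h N hN)

theorem continuous_bangSingle [DecidableEq I] [∀ i, IsTopologicalRing (B i)] (i : I) :
    @Continuous _ _ _ (bangTopology R B) (bangSingle (R := R) (B := B) i) := by
  refine continuous_to_bang _ fun N hN => ?_
  filter_upwards [(hN i).mem_nhds (zero_mem _)] with x hx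
  exact Submodule.subset_span ⟨_, ⟨i, (congrArg (· ∈ N i) (Pi.mulSingle_eq_same i x)).mpr hx⟩, rfl⟩

/-- Preimages of an open left ideal under the `ψ i` are open submodules. By `bangLift_mem`, a pure
tensor with some factor in the corresponding preimage is sent into the ideal. This is where a basis
of left ideals is needed. -/
theorem continuous_bangLift [Fintype I] {S : Type u} [Ring S] [Algebra R S] [TopologicalSpace S]
    [IsTopologicalRing S] [IsLinearTopology S S] (ψ : ∀ i, B i →ₐ[R] S)
    (hψ : Pairwise fun i j => ∀ x y, Commute (ψ i x) (ψ j y)) (hc : ∀ i, Continuous (ψ i)) :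
    @Continuous _ _ (bangTopology R B) _ (bangLift ψ hψ) := by
  refine continuous_bang (bangLift ψ hψ : (⨂[R] i, B i) →+ S) fun U hU => ?_
  obtain ⟨L, hL, hLU⟩ := (IsLinearTopology.hasBasis_open_submodule (R := S) (M := S)).mem_iff.1 hU
  let L' : Submodule R S := L.restrictScalars R
  refine ⟨fun i => L'.comap (ψ i).toLinearMap, fun i => hL.preimage (hc i), fun x hx => hLU ?_⟩
  suffices bangNhd (fun i => L'.comap (ψ i).toLinearMap) ≤ L'.comap (bangLift ψ hψ).toLinearMap from
    this hx
  refine Submodule.span_le.2 ?_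
  rintro _ ⟨b, ⟨i, hi⟩, rfl⟩
  exact bangLift_mem ψ hψ (L := L) hi

theorem continuous_bangMap {B' : I → Type u} [∀ i, Ring (B' i)] [∀ i, Algebra R (B' i)]
    [∀ i, TopologicalSpace (B' i)] (f : ∀ i, B i →ₐ[R] B' i) (hf : ∀ i, Continuous (f i)) :
    @Continuous _ _ (bangTopology R B) (bangTopology R B') (bangMap f) := by
  let := bangTopology R B
  have := isTopologicalAddGroup_bangTopology (R := R) (B := B)
  refine continuous_to_bang (bangMap f : (⨂[R] i, B i) →+ ⨂[R] i, B' i) fun N hN => ?_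
  filter_upwards [bangNhd_mem_nhds (N := fun i => (N i).comap (f i).toLinearMap)
    fun i => (hN i).preimage (hf i)] with x hx
  suffices bangNhd (fun i => (N i).comap (f i).toLinearMap) ≤
    (bangNhd N).comap (bangMap f).toLinearMap from this hx
  refine Submodule.span_le.2 ?_
  rintro _ ⟨b, ⟨i, hi⟩, rfl⟩
  exact Submodule.subset_span ⟨_, ⟨i, hi⟩, bangMap_tprod f b⟩

end Bang

/-! ### The completed enveloping algebra has a basis of open left ideals. -/

section Linear

variable (𝔤 : Type u) [LieRing 𝔤] [LieAlgebra ℂ 𝔤] (κ : LinearMap.BilinForm ℂ 𝔤)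
  {M : MarkedCurve} (C : M.Chart)

/-- The closure in the completion of a left ideal `U¹ ĝ^{≥ n}`. -/
def completedClosure (n : ℕ) : AddSubgroup (Completed 𝔤 κ C) :=
  ((chartNhd 𝔤 κ C n).toAddSubgroup.map
    (toCompleted 𝔤 κ C : ChartEnv 𝔤 κ C →+ Completed 𝔤 κ C)).topologicalClosure

/-- Density is used twice: to let `r` range over the completion while `x` comes from the left ideal
before completion, then to pass to limits in `x`. -/
theorem mul_mem_completedClosure (n : ℕ) (r : Completed 𝔤 κ C) {x : Completed 𝔤 κ C}
    (hx : x ∈ completedClosure 𝔤 κ C n) : r * x ∈ completedClosure 𝔤 κ C n := by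
  have hcl : IsClosed (completedClosure 𝔤 κ C n : Set (Completed 𝔤 κ C)) :=
    AddSubgroup.isClosed_topologicalClosure _
  have h1 : ∀ a ∈ chartNhd 𝔤 κ C n, ∀ r, r * toCompleted 𝔤 κ C a ∈ completedClosure 𝔤 κ C n := by
    intro a ha r
    refine completed_induction 𝔤 κ (P := fun r => r * toCompleted 𝔤 κ C a ∈ completedClosure 𝔤 κ C n)
      (hcl.preimage (continuous_mul_const _)) (fun b => ?_) r
    rw [← map_mul]
    exact subset_closure ⟨b * a, Ideal.mul_mem_left _ _ ha, rfl⟩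
  have h2 : (completedClosure 𝔤 κ C n : Set (Completed 𝔤 κ C)) ⊆
      (fun x => r * x) ⁻¹' (completedClosure 𝔤 κ C n : Set (Completed 𝔤 κ C)) := by
    refine closure_minimal ?_ (hcl.preimage (continuous_const_mul r))
    rintro _ ⟨a, ha, rfl⟩
    exact h1 a ha r
  exact h2 hx

/-- The closure in the completion of a left ideal `U¹ ĝ^{≥ n}`, as a left ideal. -/
def completedNhd (n : ℕ) : Ideal (Completed 𝔤 κ C) where
  __ := completedClosure 𝔤 κ C n
  smul_mem' r _ hx := mul_mem_completedClosure 𝔤 κ C n r hx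

/-- In a completion, the closures of a basis of neighbourhoods of zero in the dense subspace form
such a basis. -/
theorem hasBasis_completedNhd :
    (nhds (0 : Completed 𝔤 κ C)).HasBasis (fun _ => True)
      fun n => (completedNhd 𝔤 κ C n : Set (Completed 𝔤 κ C)) := by
  have h := (chartNhd_basis 𝔤 κ C).hasBasis_nhds_zero.hasBasis_of_isDenseInducing
    (UniformSpace.Completion.isDenseInducing_coe (α := ChartEnv 𝔤 κ C))
  exact h

instance : IsLinearTopology (Completed 𝔤 κ C) (Completed 𝔤 κ C) :=
  IsLinearTopology.mk_of_hasBasis' _ (p := fun _ : ℕ => True) (s := completedNhd 𝔤 κ C)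
    (hasBasis_completedNhd 𝔤 κ C)
    fun L r _ hx => L.smul_mem r hx

end Linear

/-! ### The factorization structure on the enveloping algebras. -/

section Factorization

variable {𝔤 : Type u} [LieRing 𝔤] [LieAlgebra ℂ 𝔤] {κ : LinearMap.BilinForm ℂ 𝔤}

instance (M : MarkedCurve) (C : M.Chart) : T2Space ((envelope 𝔤 κ M).obj C) :=
  inferInstanceAs (T2Space (Completed 𝔤 κ C))

instance (M : MarkedCurve) (C : M.Chart) :
    IsLinearTopology ((envelope 𝔤 κ M).obj C) ((envelope 𝔤 κ M).obj C) :=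
  inferInstanceAs (IsLinearTopology (Completed 𝔤 κ C) (Completed 𝔤 κ C))

namespace PuncturedHom

variable (𝔤 κ)

theorem completed_comp {N N' M : MarkedCurve} {C : N.Chart} {C' : N'.Chart} {D : M.Chart}
    (ε : PuncturedHom N C.W M D.W) (ε' : PuncturedHom N' C'.W N C.W)
    (ε'' : PuncturedHom N' C'.W M D.W) (hb : ∀ a, ε''.base a = ε.base (ε'.base a))
    (h : ∀ f, ε''.map f = ε.map (ε'.map f)) (x : Completed 𝔤 κ C') :
    ε''.completed 𝔤 κ x = ε.completed 𝔤 κ (ε'.completed 𝔤 κ x) :=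
  DFunLike.congr_fun (completed_hom_ext (φ := ε''.completed 𝔤 κ)
    (ψ := (ε.completed 𝔤 κ).comp (ε'.completed 𝔤 κ)) (ε''.continuous_completed 𝔤 κ)
    ((ε.continuous_completed 𝔤 κ).comp (ε'.continuous_completed 𝔤 κ))
    (fun a => by
      rw [RingHom.comp_apply, completed_algebraMap, completed_algebraMap, completed_algebraMap, hb])
    (fun X f => by rw [RingHom.comp_apply, completed_gen, completed_gen, completed_gen, h])) x

theorem completedMap_completed {N N' M M' : MarkedCurve} (m : Collapse M' M) (m' : Collapse N' N)
    {C : N.Chart} {C' : N'.Chart} {D : M.Chart} {D' : M'.Chart} (h : D'.W ≤ m.f ⁻¹ᵁ D.W)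
    (h' : C'.W ≤ m'.f ⁻¹ᵁ C.W) (ε : PuncturedHom N C.W M D.W) (ε' : PuncturedHom N' C'.W M' D'.W)
    (hb : ∀ a, m.base h (ε.base a) = ε'.base (m'.base h' a))
    (hε : ∀ f, m.punctured h (ε.map f) = ε'.map (m'.punctured h' f)) (x : Completed 𝔤 κ C) :
    completedMap 𝔤 κ m h (ε.completed 𝔤 κ x) = ε'.completed 𝔤 κ (completedMap 𝔤 κ m' h' x) :=
  DFunLike.congr_fun (completed_hom_ext (φ := (completedMap 𝔤 κ m h).comp (ε.completed 𝔤 κ))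
    (ψ := (ε'.completed 𝔤 κ).comp (completedMap 𝔤 κ m' h'))
    ((continuous_completedMap 𝔤 κ m h).comp (ε.continuous_completed 𝔤 κ))
    ((ε'.continuous_completed 𝔤 κ).comp (continuous_completedMap 𝔤 κ m' h'))
    (fun a => by
      rw [RingHom.comp_apply, RingHom.comp_apply, completed_algebraMap, completedMap_algebraMap,
        completedMap_algebraMap, completed_algebraMap, hb])
    (fun X f => by
      rw [RingHom.comp_apply, RingHom.comp_apply, completed_gen, completedMap_gen,
        completedMap_gen, completed_gen, hε])) x

end PuncturedHom

/-- Continuous morphisms out of the sections of `𝒰_κ(ĝ_Σ)` are determined by generators. -/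
theorem envelope_hom_ext {M : MarkedCurve} {C : M.Chart} {B : Type*} [Ring B] [TopologicalSpace B]
    [T2Space B] {φ ψ : (envelope 𝔤 κ M).obj C →+* B} (hφ : Continuous φ) (hψ : Continuous ψ)
    (halg : ∀ a, φ (algebraMap (M.A C.W) _ a) = ψ (algebraMap (M.A C.W) _ a))
    (hgen : ∀ X f, φ (gen 𝔤 κ C X f) = ψ (gen 𝔤 κ C X f)) : φ = ψ :=
  completed_hom_ext (C := C) hφ hψ halg hgen

/-- A homomorphism from a finite product of monoids is determined on elements with one nontrivial
entry. This reduces the condition on `fact ∘ fact` to the insertion of one block at a time. -/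
theorem monoidHom_refine {I : Type} [Finite I] {L : I → Type} [∀ i, Finite (L i)]
    [DecidableEq I] [∀ i, DecidableEq (L i)] {B : (Σ i, L i) → Type*} [∀ l, Monoid (B l)]
    {B' : I → Type*} [∀ i, Monoid (B' i)] {S : Type*} [Monoid S] (Φ : (∀ l, B l) →* S)
    (Φ' : (∀ i, B' i) →* S) (φ : ∀ i, (∀ l, B ⟨i, l⟩) →* B' i)
    (h : ∀ i l x, Φ (Pi.mulSingle ⟨i, l⟩ x) = Φ' (Pi.mulSingle i (φ i (Pi.mulSingle l x))))
    (a : ∀ l, B l) : Φ a = Φ' fun i => φ i fun l => a ⟨i, l⟩ := by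
  let Ψ : (∀ l, B l) →* (∀ i, B' i) :=
    { toFun := fun a i => φ i fun l => a ⟨i, l⟩
      map_one' := funext fun i => map_one (φ i)
      map_mul' := fun a b => funext fun i => map_mul (φ i) _ _ }
  refine DFunLike.congr_fun (MonoidHom.pi_ext (f := Φ) (g := Φ'.comp Ψ) ?_) a
  rintro ⟨i, l⟩ x
  rw [h, MonoidHom.comp_apply]
  refine congrArg Φ' (funext fun k => ?_)
  change _ = φ k fun l' => (Pi.mulSingle (⟨i, l⟩ : Σ i, L i) x : ∀ l, B l) ⟨k, l'⟩
  by_cases hk : k = i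
  · subst hk
    rw [Pi.mulSingle_eq_same]
    refine congrArg (φ k) (funext fun l' => ?_)
    by_cases hl : l' = l
    · subst hl; rw [Pi.mulSingle_eq_same, Pi.mulSingle_eq_same]
    · rw [Pi.mulSingle_eq_of_ne hl, Pi.mulSingle_eq_of_ne]
      exact fun e => hl (eq_of_heq (Sigma.mk.inj e).2)
  · rw [Pi.mulSingle_eq_of_ne hk, ← map_one (φ k)]
    refine congrArg (φ k) (funext fun l' => ?_)
    rw [Pi.mulSingle_eq_of_ne, Pi.one_apply]
    exact fun e => hk (Sigma.mk.inj e).1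

/-- The same reduction to single entries, used for the condition relating `Ran` and `fact`. -/
theorem monoidHom_natural {I : Type} [Finite I] [DecidableEq I] {B B' : I → Type*}
    [∀ i, Monoid (B i)] [∀ i, Monoid (B' i)] {S S' : Type*} [Monoid S] [Monoid S']
    (Φ : (∀ i, B i) →* S) (Φ' : (∀ i, B' i) →* S') (r : S →* S') (ρ : ∀ i, B i →* B' i)
    (h : ∀ i x, r (Φ (Pi.mulSingle i x)) = Φ' (Pi.mulSingle i (ρ i x))) (a : ∀ i, B i) :
    r (Φ a) = Φ' fun i => ρ i (a i) := by
  refine DFunLike.congr_fun (MonoidHom.pi_ext (f := r.comp Φ) (g := Φ'.comp (MonoidHom.piMap ρ))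
    fun i x => ?_) a
  refine (h i x).trans (congrArg Φ' (funext fun k => ?_))
  change _ = ρ k ((Pi.mulSingle i x : ∀ i, B i) k)
  by_cases hk : k = i
  · subst hk; rw [Pi.mulSingle_eq_same, Pi.mulSingle_eq_same]
  · rw [Pi.mulSingle_eq_of_ne hk, Pi.mulSingle_eq_of_ne hk, map_one]

variable {M : MarkedCurve} {I : Type} [Fintype I] (P : Partition M.J I) {W : M.S.Opens}
  (hW : P.IsSeparating W)

variable (𝔤 κ) in
/-- The factorization morphism of `𝒰_κ(ĝ_Σ)`. -/
def envelopeFact : BangTensor (envelope 𝔤 κ) hW →ₐ[M.A W] (envelope 𝔤 κ M).obj ⟨W, hW.whole⟩ :=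
  bangLift (fun i => Partition.insertAlgHom 𝔤 κ hW i)
    fun _ _ hik => Partition.commute_insertAlgHom 𝔤 κ hW hik

theorem continuous_envelopeFact :
    @Continuous (BangTensor (envelope 𝔤 κ) hW) ((envelope 𝔤 κ M).obj ⟨W, hW.whole⟩)
      (bangTopology (M.A W) fun i => (envelope 𝔤 κ (M.sub (P.incl i))).obj ⟨W, hW.part i⟩) _
      (envelopeFact 𝔤 κ P hW) :=
  continuous_bangLift _ _ fun i => Partition.continuous_insertAlgHom 𝔤 κ hW i

/-- The factorization morphism as a morphism of monoids from the product of the factors. -/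
def envelopeFactHom : (∀ i, (envelope 𝔤 κ (M.sub (P.incl i))).obj ⟨W, hW.part i⟩) →*
    (envelope 𝔤 κ M).obj ⟨W, hW.whole⟩ :=
  (envelopeFact 𝔤 κ P hW : BangTensor (envelope 𝔤 κ) hW →* _).comp
    (PiTensorProduct.tprodMonoidHom (M.A W))

theorem envelopeFactHom_mulSingle [DecidableEq I] (i : I)
    (x : (envelope 𝔤 κ (M.sub (P.incl i))).obj ⟨W, hW.part i⟩) :
    envelopeFactHom P hW (Pi.mulSingle i x) = Partition.insertAlgHom 𝔤 κ hW i x :=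
  bangLift_mulSingle (B := fun i => (envelope 𝔤 κ (M.sub (P.incl i))).obj ⟨W, hW.part i⟩)
    (fun i => Partition.insertAlgHom 𝔤 κ hW i) _ i x

/-- Both sides are continuous and agree on `X ⊗ f`, because extension by zero in two steps is
extension by zero in one step. -/
theorem insertAlgHom_trans {L : I → Type} [∀ i, Fintype (L i)]
    (Q : ∀ i, Partition (P.part i) (L i))
    (hQ : ∀ i, Partition.IsSeparating (M := M.sub (P.incl i)) (Q i) W)
    (hPQ : (P.refine Q).IsSeparating W) (i : I) (l : L i)
    (x : (envelope 𝔤 κ (M.sub ((P.refine Q).incl ⟨i, l⟩))).obj ⟨W, hPQ.part ⟨i, l⟩⟩) :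
    Partition.insertAlgHom 𝔤 κ hPQ ⟨i, l⟩ x = Partition.insertAlgHom 𝔤 κ hW i
      (Partition.insertAlgHom (M := M.sub (P.incl i)) 𝔤 κ (hQ i) l x) :=
  PuncturedHom.completed_comp 𝔤 κ (C' := hPQ.partChart ⟨i, l⟩) (C := hW.partChart i)
    (D := hW.wholeChart) (Partition.extendHom hW i)
    (Partition.extendHom (M := M.sub (P.incl i)) (hQ i) l) (Partition.extendHom hPQ ⟨i, l⟩)
    (fun _ => rfl) (fun f => Partition.IsExtension.extend_eq hPQ
      ((Partition.isExtension_extend (M := M.sub (P.incl i)) (hQ i) l f).trans hW hQ hPQ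
        (Partition.isExtension_extend hW i _))) x

theorem completedMap_insertAlgHom {M' : MarkedCurve} (m : Collapse M' M)
    (P' : Partition M'.J I) (c : ∀ i, P.part i → P'.part i)
    (hc : ∀ i a, m.π (P.incl i a) = P'.incl i (c i a)) {W' : M'.S.Opens}
    (hW' : P'.IsSeparating W') (h : W' ≤ m.f ⁻¹ᵁ W) (i : I)
    (x : (envelope 𝔤 κ (M.sub (P.incl i))).obj ⟨W, hW.part i⟩) :
    completedMap 𝔤 κ m (C := hW.wholeChart) (C' := hW'.wholeChart) h
        (Partition.insertAlgHom 𝔤 κ hW i x) =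
      Partition.insertAlgHom 𝔤 κ hW' i
        (completedMap 𝔤 κ (m.part P P' c hc i) (C := hW.partChart i) (C' := hW'.partChart i)
          h x) :=
  PuncturedHom.completedMap_completed 𝔤 κ m (m.part P P' c hc i) (C := hW.partChart i)
    (C' := hW'.partChart i) (D := hW.wholeChart) (D' := hW'.wholeChart) h h
    (Partition.extendHom hW i) (Partition.extendHom hW' i) (fun _ => rfl)
    (fun f => (Partition.IsExtension.extend_eq hW'
      ((Partition.isExtension_extend hW i f).map m hc h)).symm) x

theorem envelopeFactHom_refine {L : I → Type} [∀ i, Fintype (L i)]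
    (Q : ∀ i, Partition (P.part i) (L i))
    (hQ : ∀ i, Partition.IsSeparating (M := M.sub (P.incl i)) (Q i) W)
    (hPQ : (P.refine Q).IsSeparating W)
    (a : ∀ l : (Σ i, L i), (envelope 𝔤 κ (M.sub ((P.refine Q).incl l))).obj ⟨W, hPQ.part l⟩) :
    envelopeFactHom (P.refine Q) hPQ a = envelopeFactHom P hW fun i =>
      envelopeFactHom (M := M.sub (P.incl i)) (Q i) (hQ i) fun l => a ⟨i, l⟩ := by
  classical
  refine monoidHom_refine (envelopeFactHom (P.refine Q) hPQ) (envelopeFactHom P hW)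
    (fun i => envelopeFactHom (M := M.sub (P.incl i)) (Q i) (hQ i)) (fun i l x => ?_) a
  rw [envelopeFactHom_mulSingle, envelopeFactHom_mulSingle]
  refine (insertAlgHom_trans P hW Q hQ hPQ i l x).trans ?_
  exact congrArg _ (envelopeFactHom_mulSingle (M := M.sub (P.incl i)) (Q i) (hQ i) l x).symm

variable (𝔤 κ) in
/-- Pullback of sections of `𝒰_κ(ĝ_Σ)`. -/
def envelopeRan {M' M : MarkedCurve} (m : Collapse M' M) {C : M.Chart} {C' : M'.Chart}
    (h : C'.W ≤ m.f ⁻¹ᵁ C.W) : (envelope 𝔤 κ M).obj C →+* (envelope 𝔤 κ M').obj C' :=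
  completedMap 𝔤 κ m h

theorem envelopeRan_factHom {M' : MarkedCurve} (m : Collapse M' M)
    (P' : Partition M'.J I) (c : ∀ i, P.part i → P'.part i)
    (hc : ∀ i a, m.π (P.incl i a) = P'.incl i (c i a)) {W' : M'.S.Opens}
    (hW' : P'.IsSeparating W') (h : W' ≤ m.f ⁻¹ᵁ W)
    (a : ∀ i, (envelope 𝔤 κ (M.sub (P.incl i))).obj ⟨W, hW.part i⟩) :
    envelopeRan 𝔤 κ m (C := hW.wholeChart) (C' := hW'.wholeChart) h (envelopeFactHom P hW a) =
      envelopeFactHom P' hW' fun i => envelopeRan 𝔤 κ (m.part P P' c hc i) (C := hW.partChart i)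
        (C' := hW'.partChart i) h (a i) := by
  classical
  exact monoidHom_natural (envelopeFactHom (𝔤 := 𝔤) (κ := κ) P hW)
    (envelopeFactHom (𝔤 := 𝔤) (κ := κ) P' hW')
    (envelopeRan 𝔤 κ m (C := hW.wholeChart) (C' := hW'.wholeChart) h : _ →* _)
    (fun i => (envelopeRan 𝔤 κ (m.part P P' c hc i) (C := hW.partChart i)
      (C' := hW'.partChart i) h : _ →* _))
    (fun i x => by
      rw [envelopeFactHom_mulSingle, envelopeFactHom_mulSingle]
      exact completedMap_insertAlgHom P hW m P' c hc hW' h i x) a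

variable (𝔤 κ) in
/-- The natural factorization structure of `𝒰_κ(ĝ_Σ)`. -/
def envelopeFactorization : PseudoFactorization (envelope 𝔤 κ) where
  ran {_ _} m {C C'} h := completedMap 𝔤 κ m (C := C) (C' := C') h
  continuous_ran {_ _} m {_ _} h := continuous_completedMap 𝔤 κ m h
  ran_algebraMap {_ _} m {_ _} h a := completedMap_algebraMap m h a
  ran_refl {_ _ _} _ _ := rfl
  ran_comp {_ _ _} m m' {_ _ _} h h' h'' x := completedMap_comp 𝔤 κ m m' h h' h'' x
  fact {_ _} _ P {_} hW := envelopeFact 𝔤 κ P hW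
  continuous_fact {_ _} _ P {_} hW := continuous_envelopeFact P hW
  fact_refine {_ _} _ {_} _ P Q {_} hP hQ hPQ a := envelopeFactHom_refine P hP Q hQ hPQ a
  ran_fact {_ _} m {_} _ P P' c hc {_ _} hW hW' h a :=
    envelopeRan_factHom P hW m P' c hc hW' h a

theorem isNatural_envelopeFactorization : IsNatural (envelopeFactorization 𝔤 κ) where
  ran {_ _} m {_ _} h X f := completedMap_gen m h X f
  fact {_ _} _ P {_} hW i X f g hfg a ha ha' := by
    classical
    have e : a = Pi.mulSingle i (a i) := funext fun k => by
      by_cases hk : k = i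
      · subst hk; rw [Pi.mulSingle_eq_same]
      · rw [Pi.mulSingle_eq_of_ne hk, ha' k hk]
    rw [e]
    refine (envelopeFactHom_mulSingle P hW i (a i)).trans ?_
    rw [ha]
    exact Partition.insertHom_gen 𝔤 κ hW i X hfg

/-! ### Uniqueness of the natural factorization structure. -/

section Uniqueness

variable {F : PseudoFactorization (envelope 𝔤 κ)}

theorem IsNatural.ran_eq (hF : IsNatural F) {M' M : MarkedCurve} (m : Collapse M' M) {C : M.Chart} {C' : M'.Chart}
    (h : C'.W ≤ m.f ⁻¹ᵁ C.W) : F.ran m h = completedMap 𝔤 κ m h :=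
  envelope_hom_ext (F.continuous_ran m h) (continuous_completedMap 𝔤 κ m h)
    (fun a => (F.ran_algebraMap m h a).trans (completedMap_algebraMap m h a).symm)
    fun X f => (hF.ran m h X f).trans (completedMap_gen m h X f).symm

/-- Composing `fact` with the inclusion of one factor gives a continuous homomorphism out of a
completed enveloping algebra, where naturality prescribes the images of the generators. -/
theorem IsNatural.fact_single (hF : IsNatural F) [DecidableEq I] (i : I)
    (x : (envelope 𝔤 κ (M.sub (P.incl i))).obj ⟨W, hW.part i⟩) :
    F.fact P hW (bangSingle (B := fun i => (envelope 𝔤 κ (M.sub (P.incl i))).obj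
      ⟨W, hW.part i⟩) i x) = Partition.insertAlgHom 𝔤 κ hW i x := by
  let s : (envelope 𝔤 κ (M.sub (P.incl i))).obj ⟨W, hW.part i⟩ →ₐ[M.A W]
    BangTensor (envelope 𝔤 κ) hW := PiTensorProduct.singleAlgHom (R := M.A W)
      (A := fun i => (envelope 𝔤 κ (M.sub (P.incl i))).obj ⟨W, hW.part i⟩) i
  refine DFunLike.congr_fun (f := ((F.fact P hW).comp s).toRingHom)
    (g := (Partition.insertAlgHom 𝔤 κ hW i).toRingHom) (envelope_hom_ext ?_ ?_ ?_ ?_) x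
  · exact @Continuous.comp _ _ _ _ (bangTopology (M.A W) fun i =>
      (envelope 𝔤 κ (M.sub (P.incl i))).obj ⟨W, hW.part i⟩) _ _ _ (F.continuous_fact P hW)
      (continuous_bangSingle i)
  · exact Partition.continuous_insertAlgHom 𝔤 κ hW i
  · intro a
    exact (((F.fact P hW).comp s).commutes a).trans
      ((Partition.insertAlgHom 𝔤 κ hW i).commutes a).symm
  · intro X f
    refine (hF.fact P hW i X f _ (Partition.isExtension_extend hW i f) _ ?_ ?_).trans
      (Partition.insertHom_gen 𝔤 κ hW i X (Partition.isExtension_extend hW i f)).symm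
    · exact Pi.mulSingle_eq_same i _
    · exact fun k hk => Pi.mulSingle_eq_of_ne hk _

/-- Algebra homomorphisms out of the tensor product are determined by their restrictions to the
factors. -/
theorem IsNatural.fact_eq (hF : IsNatural F) : F.fact P hW = envelopeFact 𝔤 κ P hW := by
  classical
  refine PiTensorProduct.algHom_ext fun i => AlgHom.ext fun x => ?_
  exact (hF.fact_single P hW i x).trans (envelopeFactHom_mulSingle P hW i x).symm

end Uniqueness

end Factorization

/-- A pseudo-factorization structure is determined by its morphisms `Ran` and `fact`. -/
theorem PseudoFactorization.eq_of_ran_fact {𝒜 : ∀ M : MarkedCurve, ChartAlgebra.{u} M}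
    {F G : PseudoFactorization 𝒜}
    (hr : ∀ {M' M : MarkedCurve} (m : Collapse M' M) {C : M.Chart} {C' : M'.Chart}
      (h : C'.W ≤ m.f ⁻¹ᵁ C.W), F.ran m h = G.ran m h)
    (hf : ∀ {M : MarkedCurve} {I : Type} [Fintype I] (P : Partition M.J I) {W : M.S.Opens}
      (hW : P.IsSeparating W), F.fact P hW = G.fact P hW) : F = G := by
  obtain ⟨ran, _, _, _, _, fact, _, _, _⟩ := F
  obtain ⟨ran', _, _, _, _, fact', _, _, _⟩ := G
  obtain rfl : @ran = @ran' := by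
    funext M' M m C C' h
    exact hr m h
  obtain rfl : @fact = @fact' := by
    funext M I _ P W hW
    exact hf P hW
  rfl

/-! ### The center is tested on generators and is stable under pullback. -/

section Density

open Filter Topology

variable {𝔤 : Type u} [LieRing 𝔤] [LieAlgebra ℂ 𝔤] {κ : LinearMap.BilinForm ℂ 𝔤}
  {M : MarkedCurve} {C : M.Chart}

theorem gen_mem_completedNhd (X : 𝔤) {n : ℕ} {x : M.R C.W} (hx : x ∈ M.van n C.W) :
    gen 𝔤 κ C X (algebraMap (M.R C.W) (M.K C.W) x) ∈ completedNhd 𝔤 κ C n :=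
  subset_closure ⟨_, Ideal.subset_span ⟨x, hx, X, rfl⟩, rfl⟩

/-- An element commuting with `X ⊗ f` for `f` arbitrarily close to `g` commutes with `X ⊗ g`. -/
theorem commute_gen_of_approx (w : Completed 𝔤 κ C) (X : 𝔤) (g : M.K C.W)
    (h : ∀ n, ∃ z, ∃ x ∈ M.van n C.W, g = z + algebraMap (M.R C.W) (M.K C.W) x ∧
      Commute w (gen 𝔤 κ C X z)) : Commute w (gen 𝔤 κ C X g) := by
  choose z x hx hg hz using h
  have h1 : Tendsto (fun n => gen 𝔤 κ C X (algebraMap (M.R C.W) (M.K C.W) (x n))) atTop (𝓝 0) := by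
    refine (hasBasis_completedNhd 𝔤 κ C).tendsto_right_iff.2 fun n _ => ?_
    filter_upwards [eventually_ge_atTop n] with k hk
    exact gen_mem_completedNhd X (van_antitone hk (hx k))
  have h2 := (h1.const_mul w).sub (h1.mul_const w)
  rw [mul_zero, zero_mul, sub_zero] at h2
  have h3 : ∀ n, w * gen 𝔤 κ C X g - gen 𝔤 κ C X g * w =
      w * gen 𝔤 κ C X (algebraMap (M.R C.W) (M.K C.W) (x n)) -
        gen 𝔤 κ C X (algebraMap (M.R C.W) (M.K C.W) (x n)) * w := by
    intro n
    rw [hg n, gen_add, mul_add, add_mul, (hz n).eq]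
    abel
  rw [← funext h3] at h2
  exact sub_eq_zero.1 (tendsto_nhds_unique tendsto_const_nhds h2)

/-- The image of `w` commutes with `X ⊗ f'` for every pullback `f'`, hence with `𝒪`-combinations of
such elements, and these approximate `X ⊗ g` for every `g`. -/
theorem commute_completedMap_gen {M' : MarkedCurve} (m : Collapse M' M) {C' : M'.Chart}
    (h : C'.W ≤ m.f ⁻¹ᵁ C.W) {w : Completed 𝔤 κ C} (hw : ∀ X f, Commute w (gen 𝔤 κ C X f)) (X : 𝔤)
    (g : M'.K C'.W) : Commute (completedMap 𝔤 κ m h w) (gen 𝔤 κ C' X g) := by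
  refine commute_gen_of_approx _ X g fun n => ?_
  obtain ⟨z, hz, x, hx, e⟩ := m.exists_punctured_approx h n g
  refine ⟨z, x, hx, e, ?_⟩
  refine AddSubmonoid.closure_induction (motive := fun z _ => Commute (completedMap 𝔤 κ m h w)
    (gen 𝔤 κ C' X z)) ?_ ?_ ?_ hz
  · rintro _ ⟨a, f, rfl⟩
    rw [gen_base_mul, ← completedMap_gen (κ := κ) m h]
    exact (show Commute _ _ from (Algebra.commutes _ _).symm).mul_right ((hw X f).map _)
  · rw [gen_zero]; exact Commute.zero_right _
  · intro a b _ _ ha hb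
    rw [gen_add]; exact ha.add_right hb

/-- Restriction to a smaller chart is pullback along the identity collapse, so commuting with the
generators over `C` already forces commuting with the generators over every smaller chart, and by
density with all sections there. -/
theorem mem_centerSections_iff {z : (envelope 𝔤 κ M).obj C} :
    z ∈ (envelope 𝔤 κ M).centerSections C ↔
      ∀ X f, Commute (S := Completed 𝔤 κ C) z (gen 𝔤 κ C X f) := by
  constructor
  · intro hz X f
    have := hz C (le_refl C) (gen 𝔤 κ C X f)
    rwa [(envelope 𝔤 κ M).res_refl] at this
  · intro hz C' h a
    refine completed_gen_induction (P := fun a => Commute (completedMap 𝔤 κ (Collapse.refl M)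
      (C := C) (C' := C') h z) a) ?_ ?_ ?_ ?_ ?_ a
    · exact isClosed_eq (continuous_const.mul continuous_id) (continuous_id.mul continuous_const)
    · intro a
      exact (Algebra.commutes _ _).symm
    · intro X f
      exact commute_completedMap_gen (Collapse.refl M) h hz X f
    · intro a b ha hb
      exact ha.mul_right hb
    · intro a b ha hb
      exact ha.add_right hb

theorem envelopeRan_mem_centerSections {M' : MarkedCurve} (m : Collapse M' M) {C' : M'.Chart}
    (h : C'.W ≤ m.f ⁻¹ᵁ C.W) {z : (envelope 𝔤 κ M).obj C}
    (hz : z ∈ (envelope 𝔤 κ M).centerSections C) :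
    envelopeRan 𝔤 κ m h z ∈ (envelope 𝔤 κ M').centerSections C' :=
  mem_centerSections_iff.2 fun X g =>
    commute_completedMap_gen m h (w := z) (mem_centerSections_iff.1 hz) X g

end Density

theorem bangLift_tprod_mem {I : Type} [Fintype I] {R : Type} [CommRing R] {B : I → Type u}
    [∀ i, Ring (B i)] [∀ i, Algebra R (B i)] {S : Type u} [Ring S] [Algebra R S]
    (ψ : ∀ i, B i →ₐ[R] S) (hψ : Pairwise fun i j => ∀ x y, Commute (ψ i x) (ψ j y))
    {Z : Subalgebra R S} {b : ∀ i, B i} (hb : ∀ i, ψ i (b i) ∈ Z) :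
    bangLift ψ hψ (PiTensorProduct.tprod R b) ∈ Z := by
  rw [bangLift_tprod]
  exact Submonoid.noncommProd_mem Z.toSubmonoid _ _ (fun _ _ _ _ hik => hψ hik _ _) fun i _ => hb i

/-! ### The factorization structure on the centers. -/

section Center

variable {𝔤 : Type u} [LieRing 𝔤] [LieAlgebra ℂ 𝔤] {κ : LinearMap.BilinForm ℂ 𝔤}
  {M : MarkedCurve} {I : Type} [Fintype I] (P : Partition M.J I) {W : M.S.Opens}
  (hW : P.IsSeparating W)

/-- Every `X ⊗ g` is a sum of elements inserted from the blocks. Those from block `i` commute with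
the image of `z` because `z` is central there; those from the other blocks commute with everything
inserted from block `i`. -/
theorem insertAlgHom_mem_centerSections (i : I)
    {z : (envelope 𝔤 κ (M.sub (P.incl i))).obj ⟨W, hW.part i⟩}
    (hz : z ∈ (envelope 𝔤 κ (M.sub (P.incl i))).centerSections ⟨W, hW.part i⟩) :
    Partition.insertAlgHom 𝔤 κ hW i z ∈ (envelope 𝔤 κ M).centerSections ⟨W, hW.whole⟩ := by
  refine mem_centerSections_iff.2 fun X g => ?_
  obtain ⟨f, rfl⟩ := Partition.sum_extend_surjective hW g
  have h0 : ∀ k, Commute (Partition.insertHom 𝔤 κ hW i z)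
      (gen 𝔤 κ hW.wholeChart X (Partition.extend hW k (f k))) := by
    intro k
    rw [← Partition.insertHom_gen 𝔤 κ hW k X (Partition.isExtension_extend hW k (f k))]
    by_cases hk : i = k
    · subst hk
      exact Commute.map (show Commute (show Completed 𝔤 κ (hW.partChart i) from z) _ from
        mem_centerSections_iff.1 hz X (f i)) _
    · exact Partition.commute_insertAlgHom 𝔤 κ hW hk z _
  have h1 : Commute (Partition.insertHom 𝔤 κ hW i z)
      (gen 𝔤 κ hW.wholeChart X (∑ k, Partition.extend hW k (f k))) := by
    rw [gen_sum]
    exact Commute.sum_right _ _ _ fun k _ => h0 k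
  exact h1

/-- The inclusions of the centers, on tensor products. -/
def centerTensorIncl : BangTensor (envelopeCenter 𝔤 κ) hW →ₐ[M.A W] BangTensor (envelope 𝔤 κ) hW :=
  bangMap fun i => (envelope 𝔤 κ (M.sub (P.incl i))).centerIncl ⟨W, hW.part i⟩

/-- A pure tensor of central sections goes to a product of inserted central sections, and the center
is a subalgebra. -/
theorem envelopeFact_mem_centerSections (x : BangTensor (envelopeCenter 𝔤 κ) hW) :
    envelopeFact 𝔤 κ P hW (centerTensorIncl P hW x) ∈
      (envelope 𝔤 κ M).centerSections ⟨W, hW.whole⟩ := by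
  induction x using PiTensorProduct.induction_on with
  | smul_tprod r z =>
    rw [map_smul, map_smul]
    refine Subalgebra.smul_mem _ ?_ r
    rw [show centerTensorIncl P hW (PiTensorProduct.tprod (M.A W) z) = _ from bangMap_tprod _ z]
    exact bangLift_tprod_mem _ _ fun i => insertAlgHom_mem_centerSections P hW i (z i).2
  | add x y hx hy =>
    rw [map_add, map_add]
    exact add_mem hx hy

variable (𝔤 κ) in
/-- The factorization morphism of the center. -/
def centerFact : BangTensor (envelopeCenter 𝔤 κ) hW →ₐ[M.A W]
    (envelopeCenter 𝔤 κ M).obj ⟨W, hW.whole⟩ :=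
  AlgHom.codRestrict ((envelopeFact 𝔤 κ P hW).comp (centerTensorIncl P hW))
    ((envelope 𝔤 κ M).centerSections ⟨W, hW.whole⟩) (envelopeFact_mem_centerSections P hW)

theorem centerFact_tprod (z : ∀ i, (envelopeCenter 𝔤 κ (M.sub (P.incl i))).obj ⟨W, hW.part i⟩) :
    (envelope 𝔤 κ M).centerIncl ⟨W, hW.whole⟩
      (centerFact 𝔤 κ P hW (PiTensorProduct.tprod (M.A W) z)) =
      envelopeFactHom P hW fun i =>
        (envelope 𝔤 κ (M.sub (P.incl i))).centerIncl ⟨W, hW.part i⟩ (z i) :=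
  congrArg (envelopeFact 𝔤 κ P hW) (bangMap_tprod _ z)

/-- The tensor product of the centers carries its own `!`-topology. Its map to the larger tensor
product is continuous because open submodules of the factors restrict to open submodules of the
centers. -/
theorem continuous_centerFact :
    @Continuous (BangTensor (envelopeCenter 𝔤 κ) hW) ((envelopeCenter 𝔤 κ M).obj ⟨W, hW.whole⟩)
      (bangTopology (M.A W) fun i => (envelopeCenter 𝔤 κ (M.sub (P.incl i))).obj ⟨W, hW.part i⟩) _
      (centerFact 𝔤 κ P hW) := by
  refine continuous_induced_rng.2 ?_
  exact @Continuous.comp _ _ _ (bangTopology (M.A W) fun i =>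
    (envelopeCenter 𝔤 κ (M.sub (P.incl i))).obj ⟨W, hW.part i⟩) (bangTopology (M.A W) fun i =>
    (envelope 𝔤 κ (M.sub (P.incl i))).obj ⟨W, hW.part i⟩) _ _ _ (continuous_envelopeFact P hW)
    (continuous_bangMap _ fun i => continuous_subtype_val)

variable (𝔤 κ) in
/-- Pullback of sections of the center. -/
def centerRan {M' M : MarkedCurve} (m : Collapse M' M) {C : M.Chart} {C' : M'.Chart}
    (h : C'.W ≤ m.f ⁻¹ᵁ C.W) : (envelopeCenter 𝔤 κ M).obj C →+* (envelopeCenter 𝔤 κ M').obj C' :=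
  ((envelopeRan 𝔤 κ m h).comp ((envelope 𝔤 κ M).centerSections C).val.toRingHom).codRestrict
    ((envelope 𝔤 κ M').centerSections C').toSubring
    fun z => envelopeRan_mem_centerSections m h z.2

theorem centerIncl_injective (C : M.Chart) :
    Function.Injective ((envelope 𝔤 κ M).centerIncl C) := Subtype.val_injective

/-- The inclusion of the center is injective, so the identity is inherited from the enveloping
algebras. -/
theorem centerFact_refine {L : I → Type} [∀ i, Fintype (L i)]
    (Q : ∀ i, Partition (P.part i) (L i))
    (hQ : ∀ i, Partition.IsSeparating (M := M.sub (P.incl i)) (Q i) W)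
    (hPQ : (P.refine Q).IsSeparating W)
    (a : ∀ l : (Σ i, L i),
      (envelopeCenter 𝔤 κ (M.sub ((P.refine Q).incl l))).obj ⟨W, hPQ.part l⟩) :
    centerFact 𝔤 κ (P.refine Q) hPQ (PiTensorProduct.tprod (M.A W) a) =
      centerFact 𝔤 κ P hW (PiTensorProduct.tprod (M.A W) fun i =>
        centerFact 𝔤 κ (M := M.sub (P.incl i)) (Q i) (hQ i)
          (PiTensorProduct.tprod (M.A W) fun l => a ⟨i, l⟩)) := by
  apply centerIncl_injective
  rw [centerFact_tprod, centerFact_tprod]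
  refine (envelopeFactHom_refine P hW Q hQ hPQ _).trans ?_
  refine congrArg (envelopeFactHom P hW) (funext fun i => ?_)
  exact (centerFact_tprod (M := M.sub (P.incl i)) (Q i) (hQ i) fun l => a ⟨i, l⟩).symm

theorem centerRan_fact {M' : MarkedCurve} (m : Collapse M' M)
    (P' : Partition M'.J I) (c : ∀ i, P.part i → P'.part i)
    (hc : ∀ i a, m.π (P.incl i a) = P'.incl i (c i a)) {W' : M'.S.Opens}
    (hW' : P'.IsSeparating W') (h : W' ≤ m.f ⁻¹ᵁ W)
    (a : ∀ i, (envelopeCenter 𝔤 κ (M.sub (P.incl i))).obj ⟨W, hW.part i⟩) :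
    centerRan 𝔤 κ m (C := hW.wholeChart) (C' := hW'.wholeChart) h
        (centerFact 𝔤 κ P hW (PiTensorProduct.tprod (M.A W) a)) =
      centerFact 𝔤 κ P' hW' (PiTensorProduct.tprod (M'.A W') fun i =>
        centerRan 𝔤 κ (m.part P P' c hc i) (C := hW.partChart i) (C' := hW'.partChart i) h
          (a i)) := by
  apply centerIncl_injective
  rw [centerFact_tprod P' hW']
  refine Eq.trans ?_ (envelopeRan_factHom P hW m P' c hc hW' h
    fun i => (envelope 𝔤 κ (M.sub (P.incl i))).centerIncl ⟨W, hW.part i⟩ (a i))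
  exact congrArg (envelopeRan 𝔤 κ m (C := hW.wholeChart) (C' := hW'.wholeChart) h)
    (centerFact_tprod P hW a)

variable (𝔤 κ) in
/-- The natural factorization structure of the center. -/
def centerFactorization : PseudoFactorization (envelopeCenter 𝔤 κ) where
  ran {_ _} m {_ _} h := centerRan 𝔤 κ m h
  continuous_ran {_ _} m {_ _} h :=
    ((continuous_completedMap 𝔤 κ m h).comp continuous_subtype_val).subtype_mk _
  ran_algebraMap {_ _} m {_ _} h a := Subtype.ext (completedMap_algebraMap m h a)
  ran_refl {_ _ _} _ _ := rfl
  ran_comp {_ _ _} m m' {_ _ _} h h' h'' x :=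
    Subtype.ext (completedMap_comp 𝔤 κ m m' h h' h'' x.1)
  fact {_ _} _ P {_} hW := centerFact 𝔤 κ P hW
  continuous_fact {_ _} _ P {_} hW := continuous_centerFact P hW
  fact_refine {_ _} _ {_} _ P Q {_} hP hQ hPQ a := centerFact_refine P hP Q hQ hPQ a
  ran_fact {_ _} m {_} _ P P' c hc {_ _} hW hW' h a := centerRan_fact P hW m P' c hc hW' h a

theorem induces_centerFactorization :
    Induces (envelopeFactorization 𝔤 κ) (centerFactorization 𝔤 κ) where
  ran {_ _} _ {_ _} _ _ := rfl
  fact {_ _} _ P {_} hW z := centerFact_tprod P hW z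

theorem Induces.unique {F : PseudoFactorization (envelope 𝔤 κ)}
    {G G' : PseudoFactorization (envelopeCenter 𝔤 κ)} (hG : Induces F G) (hG' : Induces F G') :
    G = G' :=
  PseudoFactorization.eq_of_ran_fact
    (fun {_ _} m {C C'} h => RingHom.ext fun z =>
      centerIncl_injective C' ((hG.ran m h z).trans (hG'.ran m h z).symm))
    (fun {_ _} _ P {W} hW => AlgHom.toLinearMap_injective (PiTensorProduct.ext (MultilinearMap.ext fun z =>
      centerIncl_injective ⟨W, hW.whole⟩ ((hG.fact P hW z).trans (hG'.fact P hW z).symm))))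

theorem IsNatural.eq_envelopeFactorization {F : PseudoFactorization (envelope 𝔤 κ)}
    (hF : IsNatural F) : F = envelopeFactorization 𝔤 κ :=
  PseudoFactorization.eq_of_ran_fact (fun {_ _} m {_ _} h => hF.ran_eq m h) fun {_ _} _ P {_} hW =>
    hF.fact_eq P hW

end Center

/-! ### Completeness of the center. -/

section Complete

variable {𝔤 : Type u} [LieRing 𝔤] [LieAlgebra ℂ 𝔤] {κ : LinearMap.BilinForm ℂ 𝔤}
  {M : MarkedCurve} (C : M.Chart)

/-- A closed subring of a complete topological ring is complete. -/
theorem completeSpace_rightUniformSpace {A S : Type*} [Ring A] [UniformSpace A]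
    [IsUniformAddGroup A] [CompleteSpace A] [SetLike S A] [SubringClass S A] {Z : S}
    (hZ : IsClosed (Z : Set A)) [IsTopologicalAddGroup Z] :
    @CompleteSpace Z (IsTopologicalAddGroup.rightUniformSpace Z) := by
  have h : IsUniformAddGroup Z :=
    IsUniformInducing.isUniformAddGroup (AddSubgroupClass.subtype Z) isUniformEmbedding_subtype_val.isUniformInducing
  rw [IsUniformAddGroup.rightUniformSpace_eq]
  exact hZ.completeSpace_coe

/-- The traces on `Z` of the left ideals of `A` are left ideals of `Z`, and form a basis for the
subspace topology. -/
theorem isLinearTopology_subring {A S : Type*} [Ring A] [TopologicalSpace A]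
    [IsLinearTopology A A] [SetLike S A] [SubringClass S A] (Z : S) : IsLinearTopology Z Z := by
  have h := (IsLinearTopology.hasBasis_submodule (R := A) (M := A)).comap (Subtype.val : Z → A)
  have h0 : Filter.comap (Subtype.val : Z → A) (nhds 0) = nhds (0 : Z) := by
    rw [nhds_induced]; rfl
  rw [h0] at h
  let J : Ideal A → Ideal Z := fun L =>
    { carrier := {z | (z : A) ∈ L}
      add_mem' := fun ha hb => L.add_mem ha hb
      zero_mem' := L.zero_mem
      smul_mem' := fun r _ hx => L.smul_mem (r : A) hx }
  exact IsLinearTopology.mk_of_hasBasis' _ (s := J) h fun L r _ hx => L.smul_mem r hx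

/-- The center is an intersection of equalizers of continuous maps into Hausdorff spaces, one for
each smaller chart and each section over it. -/
theorem isClosed_centerSections :
    IsClosed ((envelope 𝔤 κ M).centerSections C : Set ((envelope 𝔤 κ M).obj C)) := by
  have h : ((envelope 𝔤 κ M).centerSections C : Set ((envelope 𝔤 κ M).obj C)) =
      ⋂ (C' : M.Chart) (h : C' ≤ C) (a : (envelope 𝔤 κ M).obj C'),
        {z | (envelope 𝔤 κ M).res h z * a = a * (envelope 𝔤 κ M).res h z} := by
    ext z
    simp only [Set.mem_iInter]
    rfl
  rw [h]
  refine isClosed_iInter fun C' => isClosed_iInter fun h => isClosed_iInter fun a => ?_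
  exact isClosed_eq (((envelope 𝔤 κ M).continuous_res h).mul continuous_const)
    (continuous_const.mul ((envelope 𝔤 κ M).continuous_res h))

instance : IsUniformAddGroup (Completed 𝔤 κ C) :=
  inferInstanceAs (IsUniformAddGroup (UniformSpace.Completion (ChartEnv 𝔤 κ C)))

instance : CompleteSpace (Completed 𝔤 κ C) :=
  inferInstanceAs (CompleteSpace (UniformSpace.Completion (ChartEnv 𝔤 κ C)))

theorem isComplete_envelopeCenter (M : MarkedCurve) : (envelopeCenter 𝔤 κ M).IsComplete := by
  intro C
  refine ⟨inferInstanceAs (T2Space ((envelope 𝔤 κ M).centerSections C)), ?_,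
    isLinearTopology_subring ((envelope 𝔤 κ M).centerSections C)⟩
  let Z : Subring (Completed 𝔤 κ C) := ((envelope 𝔤 κ M).centerSections C).toSubring
  have hZ : IsClosed (Z : Set (Completed 𝔤 κ C)) := isClosed_centerSections C
  exact completeSpace_rightUniformSpace hZ

end Complete

end FactorizableCenter

end

theorem mainTheorem11 {𝔤 : Type*} [LieRing 𝔤] [LieAlgebra ℂ 𝔤] [FiniteDimensional ℂ 𝔤]
    (κ : LinearMap.BilinForm ℂ 𝔤) (hsymm : ∀ X Y : 𝔤, κ X Y = κ Y X)
    (hinv : ∀ X Y Z : 𝔤, κ ⁅X, Y⁆ Z = κ X ⁅Y, Z⁆) :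
    (∃! F : FactorizableCenter.PseudoFactorization (FactorizableCenter.envelope 𝔤 κ),
      FactorizableCenter.IsNatural F) ∧
    (∀ F : FactorizableCenter.PseudoFactorization (FactorizableCenter.envelope 𝔤 κ),
      FactorizableCenter.IsNatural F →
        ∃! G : FactorizableCenter.PseudoFactorization (FactorizableCenter.envelopeCenter 𝔤 κ),
          FactorizableCenter.Induces F G) ∧
    ∀ M : FactorizableCenter.MarkedCurve,
      (FactorizableCenter.envelopeCenter 𝔤 κ M).IsComplete := by
  refine ⟨⟨_, FactorizableCenter.isNatural_envelopeFactorization,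
    fun F hF => hF.eq_envelopeFactorization⟩, fun F hF => ?_,
    FactorizableCenter.isComplete_envelopeCenter⟩
  -- By uniqueness in part 1, the given natural structure is the constructed one, for which the
  -- induced structure on the centers is already available.
  obtain rfl := hF.eq_envelopeFactorization
  exact ⟨_, FactorizableCenter.induces_centerFactorization,
    fun G hG => hG.unique FactorizableCenter.induces_centerFactorization⟩
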